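/- **Circuits.** A \emph{truncated linear gate} with rational parameters $a,b,c$ reads two variables and computes $x_i := \mathrm{T}_{[0,1]}(a x_j + b x_k + c)$, where $\mathrm{T}_{[s,t]}$ denotes projection of $\mathbb{R}$ onto the interval $[s,t]$. More generally we consider linear arithmetic circuits with gates $x_j+x_k$, $x_j-x_k$, constants $c$, $c\cdot x_j$, $\min\{x_j,x_k\}$, $\max\{x_j,x_k\}$ and $\mathrm{T}_{[s,t]}(a x_j+b x_k+c)$, with rational parameters. If $m$ is the number of $\min$, $\max$ and truncation gates of such a circuit $\mathcal{C}$ and $\pi\in\mathbb{R}^m$, then $\mathcal{C}^\pi$ denotes the circuit in which the $i$th of these gates is replaced, respectively, by $\min\{x_j,x_k+\pi_i\}$, $\max\{x_j,x_k+\pi_i\}$ or $\mathrm{T}_{[s,t]}(a x_j+b x_k+c+\pi_i)$. **Mesas.** For $\ell,\Gamma>0$, $p,g\in\mathbb{R}^2$ and $A=(a_c,a_r,a_t,a_l,a_b)\in\mathbb{R}^5$ let $M(x;p,A,g)$ be the minimum of the five affine functions of $x\in\mathbb{R}^2$ $$\begin{aligned} P_c&=(x_1-p_1)g_1+(x_2-p_2)g_2+a_c,\\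 P_r&=(x_1-p_1)(-\Gamma+g_1)+(x_2-p_2)g_2+a_r+\Gamma\ell/2,\\ P_t&=(x_1-p_1)g_1+(x_2-p_2)(-\Gamma+g_2)+a_t+\Gamma\ell/2,\\ P_l&=(x_1-p_1)(\Gamma+g_1)+(x_2-p_2)g_2+a_l+\Gamma\ell/2,\\ P_b&=(x_1-p_1)g_1+(x_2-p_2)(\Gamma+g_2)+a_b+\Gamma\ell/2. \end{aligned}$$ **Lemma.** Let the following be given: a rational $\delta'>0$, $\ell=1/(2^n-1)$ for some integer $n\ge 1$, a rational $\Gamma\ge 12/\ell$, and Boolean circuits (with NOT and AND gates) computing functions $a:G\to[0.45,0.55]$ and $g:G\to[-0.01,0.01]^2$ on the grid $G=\{0,\ell,2\ell,\dots,1-\ell,1\}^2$. Here a grid point $(i\ell,j\ell)$ is presented to the circuits by the $n$-bit binary representations of $i$ and $j$, and the values of $a$, $g_1$, $g_2$ are output as signed binary numbers: the bits $x^+_1,\dots,x^+_k,x^-_1,\dots,x^-_k$ represent $\sum_i x^+_i2^{-i}-\sum_i x^-_i2^{-i}$. Then, in time polynomial in the length of the description of these data (rational numbers being written in binary), one can compute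 a rational $\delta>0$ and a linear arithmetic circuit $\mathcal{C}$ with two inputs and one output, such that for every perturbation $\pi\in[-\delta,\delta]^m$ there exists a vector $\tau\in[-\delta',\delta']^{G\times\{c,r,t,l,b\}}$ such that for all $x\in[0,1]^2$ $$\mathcal{C}^\pi(x)=\max_{p\in G}M\big(x;p,A^{p,\tau},g(p)\big),\qquad A^{p,\tau}=\big(a(p)+\tau_{p,c},\,a(p)+\tau_{p,r},\,a(p)+\tau_{p,t},\,a(p)+\tau_{p,l},\,a(p)+\tau_{p,b}\big).$$ This holds 1. for circuits $\mathcal{C}$ that consist of truncated linear gates only, where $m$ is the number of gates of $\mathcal{C}$ (so every gate is perturbed), and 2. for circuits $\mathcal{C}$ that may use all the gates listed above, where $m$ is the number of $\min$, $\max$ and truncation gates of $\mathcal{C}$. -/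

import Mathlib

/-! ### Boolean circuits -/

/-- A gate of a Boolean circuit; the arguments are the indices of the variables that it reads. -/
inductive BoolGate where
  | not (j : ℕ)
  | and (j k : ℕ)

/-- A Boolean circuit, with its gates listed in topological order.
In a circuit with `k` inputs the variables `0, …, k - 1` are the inputs, and the gate at position
`i` of the list computes the variable `k + i`.  The list `outputs` names the output variables. -/
structure BoolCircuit where
  gates : List BoolGate
  outputs : List ℕ

/-- All variables that the gate reads have index smaller than `b`. -/
def BoolGate.ReadsBelow (b : ℕ) : BoolGate → Prop
  | .not j => j < b
  | .and j k => j < b ∧ k < b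

/-- The value of a gate, where `v` lists the values of the variables computed so far. -/
def BoolGate.eval (v : List Bool) : BoolGate → Bool
  | .not j => !(v.getD j false)
  | .and j k => v.getD j false && v.getD k false

namespace BoolCircuit

/-- The circuit is a legal acyclic circuit with `k` inputs. -/
def WellFormed (C : BoolCircuit) (k : ℕ) : Prop :=
  (∀ i : Fin C.gates.length, (C.gates.get i).ReadsBelow (k + i)) ∧
  ∀ j ∈ C.outputs, j < k + C.gates.length

/-- The values of all variables on the input bits `x`. -/
def values (C : BoolCircuit) (x : List Bool) : List Bool :=
  C.gates.foldl (fun v G => v ++ [G.eval v]) x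

/-- The output bits of the circuit on the input bits `x`. -/
def eval (C : BoolCircuit) (x : List Bool) : List Bool :=
  C.outputs.map fun j => (C.values x).getD j false

end BoolCircuit

/-! ### Binary variables -/

/-- The number `0.b₁b₂…b_k` in binary. -/
def binaryFraction (b : List Bool) : ℚ :=
  ∑ i : Fin b.length, if b.get i then 1 / 2 ^ ((i : ℕ) + 1) else 0

/-- A signed binary number: `x⁺₁ … x⁺ₖ x⁻₁ … x⁻ₖ` represents `0.x⁺₁…x⁺ₖ - 0.x⁻₁…x⁻ₖ`. -/
def signedFraction (b : List Bool) : ℚ :=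
  binaryFraction (b.take (b.length / 2)) - binaryFraction (b.drop (b.length / 2))

/-- The `n` bits of `i`, most significant bit first. -/
def bitsMSB (n i : ℕ) : List Bool :=
  List.ofFn fun k : Fin n => i.testBit (n - 1 - k)

/-! ### Linear arithmetic circuits -/

/-- A gate of a linear arithmetic circuit: `x_j + x_k`, `x_j - x_k`, the constant `c`, `c * x_j`,
`min {x_j, x_k}`, `max {x_j, x_k}`, and the truncation of `a * x_j + b * x_k + c` to the interval
`[lo, hi]`. -/
inductive LinearGate where
  | add (j k : ℕ)
  | sub (j k : ℕ)
  | const (c : ℚ)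
  | scale (c : ℚ) (j : ℕ)
  | minimum (j k : ℕ)
  | maximum (j k : ℕ)
  | trunc (lo hi a b c : ℚ) (j k : ℕ)

/-- A linear arithmetic circuit, with its gates listed in topological order.  In a circuit with `k`
inputs the variables `0, …, k - 1` are the inputs, and the gate at position `i` of the list computes
the variable `k + i`.  The last variable is the output. -/
structure LinearCircuit where
  gates : List LinearGate

namespace LinearGate

/-- All variables that the gate reads have index smaller than `b`, and the interval of a
truncation gate is nonempty. -/
def Legal (b : ℕ) : LinearGate → Prop
  | add j k => j < b ∧ k < b
  | sub j k => j < b ∧ k < b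
  | const _ => True
  | scale _ j => j < b
  | minimum j k => j < b ∧ k < b
  | maximum j k => j < b ∧ k < b
  | trunc lo hi _ _ _ j k => lo ≤ hi ∧ j < b ∧ k < b

/-- The gate is a truncated linear gate, that is, `trunc_[0,1] (a * x_j + b * x_k + c)`. -/
def IsTruncatedLinear (G : LinearGate) : Prop :=
  ∃ (a b c : ℚ) (j k : ℕ), G = trunc 0 1 a b c j k

/-- The value of a gate perturbed by `e`, where `v` lists the values of the variables computed so
far.  Only truncation, minimum and maximum gates are affected by the perturbation. -/
noncomputable def eval (e : ℝ) (v : List ℝ) : LinearGate → ℝ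
  | add j k => v.getD j 0 + v.getD k 0
  | sub j k => v.getD j 0 - v.getD k 0
  | const c => (c : ℝ)
  | scale c j => (c : ℝ) * v.getD j 0
  | minimum j k => min (v.getD j 0) (v.getD k 0 + e)
  | maximum j k => max (v.getD j 0) (v.getD k 0 + e)
  | trunc lo hi a b c j k =>
      max (lo : ℝ) (min (hi : ℝ) ((a : ℝ) * v.getD j 0 + (b : ℝ) * v.getD k 0 + (c : ℝ) + e))

end LinearGate

namespace LinearCircuit

/-- The number of gates. -/
def size (C : LinearCircuit) : ℕ := C.gates.length

/-- The circuit is a legal acyclic circuit with `k` inputs. -/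
def WellFormed (C : LinearCircuit) (k : ℕ) : Prop :=
  ∀ i : Fin C.gates.length, (C.gates.get i).Legal (k + i)

/-- The circuit consists of truncated linear gates only. -/
def IsTruncatedLinear (C : LinearCircuit) : Prop :=
  ∀ G ∈ C.gates, G.IsTruncatedLinear

/-- The output of the circuit perturbed by `π` on the input `x`.  There is one entry of `π` per
gate, and the entries at gates other than truncation, minimum and maximum gates have no effect. -/
noncomputable def perturbedEval (C : LinearCircuit) (π : Fin C.size → ℝ) {k : ℕ}
    (x : Fin k → ℝ) : ℝ :=
  ((C.gates.zip (List.ofFn π)).foldl (fun v Ge => v ++ [Ge.1.eval Ge.2 v]) (List.ofFn x)).getLastD 0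

end LinearCircuit

/-! ### Mesa functions -/

/-- The five affine pieces of a mesa: center, right, top, left, bottom. -/
inductive MesaPiece where
  | c
  | r
  | t
  | l
  | b

/-- The affine pieces of the mesa with side length `ℓ`, boundary slope `Γ`, center `p`, value `a` and
gradient `g`. -/
noncomputable def mesaPiece (ℓ Γ : ℝ) (d : MesaPiece) (x p : Fin 2 → ℝ) (a : ℝ) (g : Fin 2 → ℝ) :
    ℝ :=
  match d with
  | .c => (x 0 - p 0) * g 0 + (x 1 - p 1) * g 1 + a
  | .r => (x 0 - p 0) * (-Γ + g 0) + (x 1 - p 1) * g 1 + a + Γ * ℓ / 2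
  | .t => (x 0 - p 0) * g 0 + (x 1 - p 1) * (-Γ + g 1) + a + Γ * ℓ / 2
  | .l => (x 0 - p 0) * (Γ + g 0) + (x 1 - p 1) * g 1 + a + Γ * ℓ / 2
  | .b => (x 0 - p 0) * g 0 + (x 1 - p 1) * (Γ + g 1) + a + Γ * ℓ / 2

/-- The mesa function `M(x; p, A, g)` in which the piece `d` has its own value `A d`. -/
noncomputable def mesa (ℓ Γ : ℝ) (x p : Fin 2 → ℝ) (A : MesaPiece → ℝ) (g : Fin 2 → ℝ) : ℝ :=
  min (mesaPiece ℓ Γ .c x p (A .c) g) <| min (mesaPiece ℓ Γ .r x p (A .r) g) <|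
    min (mesaPiece ℓ Γ .t x p (A .t) g) <| min (mesaPiece ℓ Γ .l x p (A .l) g)
      (mesaPiece ℓ Γ .b x p (A .b) g)

/-! ### Inputs of the construction -/

/-- The data that is given: the tolerance `δ'` (here `tol`), the side length `ℓ = 1 / (2 ^ n - 1)`,
the boundary slope `Γ`, and Boolean circuits for the values and the gradients on the grid. -/
structure MesaInstance where
  tol : ℚ
  n : ℕ
  Γ : ℚ
  valueCircuit : BoolCircuit
  gradCircuit : BoolCircuit

/-- The indices of the points of the grid `{0, ℓ, 2ℓ, …, 1}²`; the index `(i₀, i₁)` stands for the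
point `(i₀ ℓ, i₁ ℓ)`. -/
abbrev GridIndex (n : ℕ) : Type := Fin 2 → Fin (2 ^ n)

namespace MesaInstance

/-- The side length. -/
def ℓ (I : MesaInstance) : ℚ := 1 / (2 ^ I.n - 1)

/-- The point of the grid with a given index. -/
noncomputable def point (I : MesaInstance) (p : GridIndex I.n) : Fin 2 → ℝ :=
  fun i => ((p i : ℕ) : ℝ) * (I.ℓ : ℝ)

/-- The input of the Boolean circuits that encodes a grid point. -/
def pointBits (I : MesaInstance) (p : GridIndex I.n) : List Bool :=
  bitsMSB I.n (p 0) ++ bitsMSB I.n (p 1)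

/-- The function `a` on the grid that the first Boolean circuit computes. -/
def value (I : MesaInstance) (p : GridIndex I.n) : ℚ :=
  signedFraction (I.valueCircuit.eval (I.pointBits p))

/-- The function `g` on the grid that the second Boolean circuit computes; the first half of its
output bits is the signed binary number `g₁`, the second half is `g₂`. -/
def grad (I : MesaInstance) (p : GridIndex I.n) : Fin 2 → ℚ :=
  let y := I.gradCircuit.eval (I.pointBits p)
  ![signedFraction (y.take (y.length / 2)), signedFraction (y.drop (y.length / 2))]

/-- The hypotheses on the data. -/
structure Valid (I : MesaInstance) : Prop where
  tol_pos : 0 < I.tol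
  n_pos : 1 ≤ I.n
  slope : 12 / I.ℓ ≤ I.Γ
  value_wellFormed : I.valueCircuit.WellFormed (2 * I.n)
  value_length : 2 ∣ I.valueCircuit.outputs.length
  value_mem : ∀ p, I.value p ∈ Set.Icc (45 / 100 : ℚ) (55 / 100)
  grad_wellFormed : I.gradCircuit.WellFormed (2 * I.n)
  grad_length : 4 ∣ I.gradCircuit.outputs.length
  grad_mem : ∀ p i, I.grad p i ∈ Set.Icc (-(1 / 100) : ℚ) (1 / 100)

end MesaInstance

/-- The linear arithmetic circuit `C` implements the mesa construction of `I` robustly with respect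
to perturbations of magnitude at most `δ`: each such perturbation `π` only shifts the value of each
piece of each mesa by a constant of magnitude at most `δ'`. -/
def RobustlyImplements (C : LinearCircuit) (δ : ℚ) (I : MesaInstance) : Prop :=
  ∀ π : Fin C.size → ℝ, (∀ i, π i ∈ Set.Icc (-(δ : ℝ)) δ) →
    ∃ τ : GridIndex I.n → MesaPiece → ℝ,
      (∀ p d, τ p d ∈ Set.Icc (-(I.tol : ℝ)) I.tol) ∧
      ∀ x : Fin 2 → ℝ, (∀ i, x i ∈ Set.Icc (0 : ℝ) 1) →
        C.perturbedEval π x =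
          (Finset.univ : Finset (GridIndex I.n)).sup' Finset.univ_nonempty fun p =>
            mesa (I.ℓ : ℝ) (I.Γ : ℝ) x (I.point p) (fun d => (I.value p : ℝ) + τ p d)
              (fun i => (I.grad p i : ℝ))

/-! ### Encodings as strings

Data are written as sequences of binary words, and a sequence of words is written as a string over
the three symbols `some false`, `some true` and `none`, where `none` ends a word.  Rational numbers
are written in binary (sign, numerator and denominator of the irreducible fraction, least significant
bit first).  The index of a variable of a circuit is written in unary, which changes the length of
the description of a circuit at most quadratically. -/

/-- The string that represents a sequence of binary words. -/
def encodeWords (ws : List (List Bool)) : List (Option Bool) :=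
  ws.flatMap fun w => w.map some ++ [none]

/-- A number in unary, as a word. -/
def unaryWord (j : ℕ) : List Bool := List.replicate j true

/-- The words for a rational number in binary. -/
def ratWords (q : ℚ) : List (List Bool) :=
  [[decide (q < 0)], q.num.natAbs.bits, q.den.bits]

/-- The words for a list: each element is announced by the word `1`, and the word `0` ends the
list. -/
def listWords {α : Type} (f : α → List (List Bool)) (xs : List α) : List (List Bool) :=
  (xs.flatMap fun x => [true] :: f x) ++ [[false]]

/-- The words for a gate of a Boolean circuit. -/
def BoolGate.words : BoolGate → List (List Bool)
  | .not j => [[false], unaryWord j]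
  | .and j k => [[true], unaryWord j, unaryWord k]

/-- The words for a Boolean circuit. -/
def BoolCircuit.words (C : BoolCircuit) : List (List Bool) :=
  listWords BoolGate.words C.gates ++ listWords (fun j => [unaryWord j]) C.outputs

/-- The words for a gate of a linear arithmetic circuit; the first word is its type. -/
def LinearGate.words : LinearGate → List (List Bool)
  | add j k => [unaryWord 0, unaryWord j, unaryWord k]
  | sub j k => [unaryWord 1, unaryWord j, unaryWord k]
  | const c => unaryWord 2 :: ratWords c
  | scale c j => unaryWord 3 :: ratWords c ++ [unaryWord j]
  | minimum j k => [unaryWord 4, unaryWord j, unaryWord k]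
  | maximum j k => [unaryWord 5, unaryWord j, unaryWord k]
  | trunc lo hi a b c j k =>
      unaryWord 6 :: ratWords lo ++ ratWords hi ++ ratWords a ++ ratWords b ++ ratWords c ++
        [unaryWord j, unaryWord k]

/-- The input string: `δ'`, `ℓ`, `Γ` and the two Boolean circuits. -/
def MesaInstance.encode (I : MesaInstance) : List (Option Bool) :=
  encodeWords (ratWords I.tol ++ ratWords I.ℓ ++ ratWords I.Γ ++
    I.valueCircuit.words ++ I.gradCircuit.words)

/-- The output string: the number `δ` and the linear arithmetic circuit. -/
def encodeOutput (o : ℚ × LinearCircuit) : List (Option Bool) :=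
  encodeWords (ratWords o.1 ++ listWords LinearGate.words o.2.gates)

/-- A function from the admissible data to pairs `(δ, C)` can be computed in polynomial time, by a
Turing machine with finitely many stacks. -/
def PolyTimeConstruction (F : {I : MesaInstance // I.Valid} → ℚ × LinearCircuit) : Prop :=
  Nonempty (Turing.TM2ComputableInPolyTime (fun I => I.1.encode) encodeOutput F)

/-!
One circuit of truncated linear gates serves for both kinds of circuits. It is the concatenation of
four blocks, one for each pair of parities `(e₁, e₂)`. The block of `(e₁, e₂)` is responsible for the
grid points `(i ℓ, j ℓ)` whose indices have these parities.  It locates the input `x`, that is, it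
computes the binary digits of `i` and `j` and the offset of `x` from the grid point, then it simulates
the Boolean circuits on these digits and takes the maximum of the mesa of the grid point and the result
of the previous blocks.

The digits are extracted from the top one down (`digitStage`, `digits_spec`): a gate with slope `Γ`
compares the remainder with the threshold, and the digit times its weight is subtracted.  A digit
fails to be Boolean only if the remainder lies within a distance `1 / Γ` above the threshold.  The
thresholds lie halfway between consecutive grid points of one parity, so in this case `x` is far from
all the grid points of the block.  Further gates recognize this case, with some margin, and raise an
alarm, which makes the result of the block negligible (`combine_alarm`).  No alarm is raised
near a grid point of the block (`extraction_spec`).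

Perturbations are harmless, provided they end up as shifts of the five pieces of a mesa that do not
depend on `x`.  A gate whose exact result is far outside of `[0, 1]` before truncation absorbs its
perturbation; this applies to the comparisons and to all simulated Boolean gates (`boolGates_spec`).
The other gates pass their perturbations on as additive errors.  The value `a(p)` and the products of
an offset with a component of `g(p)` are accumulated bit by bit (`accumulate_spec`); as the bits are
exact, the accumulated error depends only on the perturbations and on the grid point, and it is
independent of `x`.  Writing a mesa as an affine function minus the maximum of `0` and
four excesses (`mesa_eq_sub`), one finds that the block computes the positive part of the mesa with
shifted pieces (`block_located`, `block_spec`).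

A mesa is negative outside the square of radius `3 / 4 * ℓ` around its center, and it is at least
`4 / 10` if its center is the grid point nearest to `x` (`gridMesa_bounds`).  So the blocks that are not
responsible for a grid point near `x` do not affect the maximum, and the circuit computes the maximum
of all mesas (`iterated_max_spec`, `mesaGates_spec`).  If `L` is the length of the description, then all
numbers involved are at most `2 ^ L`, and perturbations up to `2 ^ (-3 L - 20)` are admissible
(`robustlyImplements_circuit`).

For the polynomial running time, `Prog` is a small language of register programs with loops over the
symbols of a register; programs are compiled to stack machines that need one step per program step
(`Run.simulation`, `polyTime_of_run`).  The class `FP` of string functions that such programs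
compute in polynomial time is closed under concatenation, case distinctions and, above all, under
transducers that see the part of the string that they have read (`FP.scan`).  The description of the
data is parsed by a finite automaton (`ParseState`), and the description of the circuit is put
together from its parts (`polyTimeConstruction_circuit`).
-/

/-! ### Register programs -/

/-- The alphabet of the input and output strings. -/
abbrev Letter := Option Bool

/-- Strings of bits, `none` being the end mark of a word. -/
abbrev Str := List Letter

/-- Structured programs on registers that hold strings, each string being a stack.
`loop r Q q₀ next body` pops the symbols of the register `r` until it is empty; it remembers a state
in the finite type `Q`, and at the symbol `a` in state `q` it runs `body q a` and enters the state
`next q a`. -/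
inductive Prog : Type 1
  | nop
  | push (r : ℕ) (a : Letter)
  | pop (r : ℕ)
  | seq (p q : Prog)
  | loop (r : ℕ) (Q : Type) [Fintype Q] (q₀ : Q) (next : Q → Letter → Q) (body : Q → Letter → Prog)

namespace Prog

open Function Turing

/-- `Run p S S' t`: started with the register contents `S`, the program `p` ends with the contents
`S'` after `t` steps. -/
inductive Run : Prog → (ℕ → Str) → (ℕ → Str) → ℕ → Prop
  | nop (S) : Run nop S S 1
  | push (S r a) : Run (push r a) S (update S r (a :: S r)) 1
  | pop (S r) : Run (pop r) S (update S r (S r).tail) 1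
  | seq {p q S S' S'' t t'} : Run p S S' t → Run q S' S'' t' → Run (seq p q) S S'' (t + t')
  | loop_nil {r Q} [Fintype Q] {q : Q} {next body S} : S r = [] → Run (loop r Q q next body) S S 1
  | loop_cons {r Q} [Fintype Q] {q : Q} {next body S S' S'' a s t t'} : S r = a :: s →
      Run (body q a) (update S r s) S' t → Run (loop r Q (next q a) next body) S' S'' t' →
      Run (loop r Q q next body) S S'' (1 + t + t')

/-- The labels of the stack machine code of a program. -/
def Lab : Prog → Type
  | nop => Unit
  | push _ _ => Unit
  | pop _ => Unit
  | seq p q => Lab p ⊕ Lab q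
  | loop _ Q _ _ body => Q ⊕ Σ x : Q × Letter, Lab (body x.1 x.2)

instance instFintypeLab : (p : Prog) → Fintype (Lab p)
  | nop => inferInstanceAs (Fintype Unit)
  | push _ _ => inferInstanceAs (Fintype Unit)
  | pop _ => inferInstanceAs (Fintype Unit)
  | seq p q =>
    letI := instFintypeLab p
    letI := instFintypeLab q
    inferInstanceAs (Fintype (Lab p ⊕ Lab q))
  | loop _ Q _ _ body =>
    letI := fun x : Q × Letter => instFintypeLab (body x.1 x.2)
    inferInstanceAs (Fintype (Q ⊕ Σ x : Q × Letter, Lab (body x.1 x.2)))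

/-- The label at which the code of a program starts. -/
def entry : (p : Prog) → Lab p
  | nop => ()
  | push _ _ => ()
  | pop _ => ()
  | seq p _ => Sum.inl (entry p)
  | loop _ _ q₀ _ _ => Sum.inl q₀

/-- The code of a program on a stack machine with the stacks `K` and the labels `Λ`.  The register
`r` is kept in the stack `κ r`, the labels of the program are embedded by `emb`, and the code exits
to the label `e`. -/
def code {K Λ : Type} (κ : ℕ → K) : (p : Prog) → (Lab p → Λ) → Λ → Lab p →
    TM2.Stmt (fun _ : K => Letter) Λ (Option Letter)
  | nop, _, e, _ => .goto fun _ => e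
  | push r a, _, e, _ => .push (κ r) (fun _ => a) (.goto fun _ => e)
  | pop r, _, e, _ => .pop (κ r) (fun v _ => v) (.goto fun _ => e)
  | seq p q, emb, _, .inl l => code κ p (fun l => emb (.inl l)) (emb (.inr (entry q))) l
  | seq _ q, emb, e, .inr l => code κ q (fun l => emb (.inr l)) e l
  | loop r _ _ _ body, emb, e, .inl q => .pop (κ r) (fun _ h => h) (.goto fun v =>
      match v with
      | none => e
      | some a => emb (.inr ⟨(q, a), entry (body q a)⟩))
  | loop _ _ _ next body, emb, _, .inr ⟨x, l⟩ =>
      code κ (body x.1 x.2) (fun l => emb (.inr ⟨x, l⟩)) (emb (.inl (next x.1 x.2))) l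

/-- All registers that the program uses are less than `M`. -/
def RegsBelow (M : ℕ) : Prog → Prop
  | nop => True
  | push r _ => r < M
  | pop r => r < M
  | seq p q => RegsBelow M p ∧ RegsBelow M q
  | loop r _ _ _ body => r < M ∧ ∀ q a, RegsBelow M (body q a)

theorem RegsBelow.mono {M M' : ℕ} (h : M ≤ M') : ∀ {p : Prog}, RegsBelow M p → RegsBelow M' p
  | nop, _ => trivial
  | push _ _, hp => lt_of_lt_of_le hp h
  | pop _, hp => lt_of_lt_of_le hp h
  | seq _ _, hp => ⟨hp.1.mono h, hp.2.mono h⟩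
  | loop _ _ _ _ _, hp => ⟨lt_of_lt_of_le hp.1 h, fun q a => (hp.2 q a).mono h⟩

theorem exists_regsBelow : ∀ p : Prog, ∃ M, RegsBelow M p
  | nop => ⟨0, trivial⟩
  | push r _ => ⟨r + 1, Nat.lt_succ_self r⟩
  | pop r => ⟨r + 1, Nat.lt_succ_self r⟩
  | seq p q => by
    obtain ⟨M, hM⟩ := exists_regsBelow p
    obtain ⟨M', hM'⟩ := exists_regsBelow q
    exact ⟨max M M', hM.mono (le_max_left _ _), hM'.mono (le_max_right _ _)⟩
  | loop r Q _ _ body => by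
    choose M hM using fun q a => exists_regsBelow (body q a)
    refine ⟨r + 1 + ∑ x : Q × Letter, M x.1 x.2, by omega, fun q a => (hM q a).mono ?_⟩
    have := Finset.single_le_sum (f := fun x : Q × Letter => M x.1 x.2) (fun _ _ => Nat.zero_le _)
      (Finset.mem_univ (q, a))
    simp only at this
    omega

/-- The contents of the first `M` registers, as the stack contents of a machine. -/
def stackContents (M : ℕ) (S : ℕ → Str) : Fin (M + 1) → Str := fun r => S r

/-- The stack of a machine with `M + 1` stacks that holds the register `r`. -/
def regStack (M r : ℕ) : Fin (M + 1) := Fin.ofNat (M + 1) r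

theorem val_regStack {M r : ℕ} (h : r < M) : (regStack M r : ℕ) = r := by
  simp [regStack, Nat.mod_eq_of_lt (by omega : r < M + 1)]

theorem update_stackContents {M r : ℕ} (h : r < M) (S : ℕ → Str) (s : Str) :
    update (stackContents M S) (regStack M r) s = stackContents M (update S r s) := by
  funext i
  by_cases hi : i = regStack M r
  · subst hi
    simp [stackContents, val_regStack h]
  · have : (i : ℕ) ≠ r := fun h' => hi (Fin.ext (by rw [h', val_regStack h]))
    simp [stackContents, hi, this]

theorem stackContents_apply {M r : ℕ} (h : r < M) (S : ℕ → Str) :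
    stackContents M S (regStack M r) = S r := by
  simp [stackContents, val_regStack h]

/-- The code of a program simulates the program step by step. -/
theorem Run.simulation {p : Prog} {S S' : ℕ → Str} {t : ℕ} (h : Run p S S' t) {M : ℕ}
    (hp : RegsBelow M p) {Λ : Type} (m : Λ → TM2.Stmt (fun _ : Fin (M + 1) => Letter) Λ (Option Letter))
    (emb : Lab p → Λ) (e : Λ) (hm : ∀ l, m (emb l) = code (regStack M) p emb e l)
    (v : Option Letter) : ∃ v',
      (flip bind (TM2.step m))^[t] (some ⟨some (emb (entry p)), v, stackContents M S⟩) =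
        some ⟨some e, v', stackContents M S'⟩ := by
  induction h generalizing v Λ with
  | nop S => exact ⟨v, by simp [flip, hm, code]⟩
  | push S r a =>
    refine ⟨v, ?_⟩
    simp only [RegsBelow] at hp
    simp [flip, hm, code, update_stackContents hp, stackContents_apply hp]
  | pop S r =>
    refine ⟨v, ?_⟩
    simp only [RegsBelow] at hp
    simp [flip, hm, code, update_stackContents hp, stackContents_apply hp]
  | @seq p q S S' S'' t t' _ _ ih₁ ih₂ =>
    obtain ⟨v', h₁⟩ := ih₁ hp.1 m (fun l => emb (.inl l)) (emb (.inr (entry q)))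
      (fun l => hm (.inl l)) v
    obtain ⟨v'', h₂⟩ := ih₂ hp.2 m (fun l => emb (.inr l)) e (fun l => hm (.inr l)) v'
    refine ⟨v'', ?_⟩
    rw [Nat.add_comm t t', iterate_add_apply]
    change (flip bind (TM2.step m))^[t'] ((flip bind (TM2.step m))^[t]
      (some ⟨some (emb (.inl (entry p))), v, stackContents M S⟩)) = _
    rw [h₁, h₂]
  | @loop_nil r Q _ q next body S hS =>
    refine ⟨none, ?_⟩
    have h1 := hm (.inl q)
    simp only [RegsBelow] at hp
    have h2 : update S r [] = S := by rw [← hS, update_eq_self]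
    simp only [iterate_one, flip, Option.bind_eq_bind, Option.bind_some, entry, TM2.step, h1, code,
      TM2.stepAux, update_stackContents hp.1, stackContents_apply hp.1, hS, List.head?_nil, List.tail_nil, h2]
  | @loop_cons r Q _ q next body S S' S'' a s t t' hS _ _ ih₁ ih₂ =>
    have h1 := hm (.inl q)
    obtain ⟨v', h₁⟩ := ih₁ (hp.2 q a) m (fun l => emb (.inr ⟨(q, a), l⟩)) (emb (.inl (next q a)))
      (fun l => hm (.inr ⟨(q, a), l⟩)) (some a)
    obtain ⟨v'', h₂⟩ := ih₂ hp m emb e (fun l => (hm l).trans (by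
      rcases l with l | l <;> rfl)) v'
    refine ⟨v'', ?_⟩
    rw [Nat.add_comm (1 + t) t', iterate_add_apply, Nat.add_comm 1 t, iterate_add_apply]
    have h3 : (flip bind (TM2.step m))^[1]
        (some ⟨some (emb (.inl q)), v, stackContents M S⟩) =
        some ⟨some (emb (.inr ⟨(q, a), entry (body q a)⟩)), some a, stackContents M (update S r s)⟩ := by
      simp only [RegsBelow] at hp
      simp only [iterate_one, flip, Option.bind_eq_bind, Option.bind_some, TM2.step, h1, code,
        TM2.stepAux, update_stackContents hp.1, stackContents_apply hp.1, hS, List.head?_cons, List.tail_cons]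
    exact (congrArg _ ((congrArg _ h3).trans h₁)).trans h₂

/-- The stack machine that runs a program on the input in register `0` and returns the contents of
register `1`. -/
def machine (p : Prog) (M : ℕ) : FinTM2 where
  K := Fin (M + 2 + 1)
  k₀ := 0
  k₁ := 1
  Γ _ := Letter
  Λ := Option (Lab p)
  main := some (entry p)
  σ := Option Letter
  initialState := none
  m l := match l with
    | none => .load (fun _ => none) .halt
    | some l => code (regStack _) p some none l

/-- A program that reads its input in the register `0` and leaves only the output, in the register
`1`, is realized by a stack machine with the same time bound. -/
theorem polyTime_of_run {α : Type} {ea : α → Str} {β : Type} {eb : β → Str} {f : α → β} (p : Prog)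
    (time : Polynomial ℕ)
    (h : ∀ a, ∃ t ≤ time.eval (ea a).length,
      Run p (update (fun _ => []) 0 (ea a)) (update (fun _ => []) 1 (eb (f a))) t) :
    Nonempty (TM2ComputableInPolyTime ea eb f) := by
  obtain ⟨M, hM⟩ := exists_regsBelow p
  choose t ht hr using h
  refine ⟨{ tm := machine p M, inputAlphabet := Equiv.refl _, outputAlphabet := Equiv.refl _,
            time := time + 1, outputsFun := fun a =>
              { steps := t a + 1, evals_in_steps := ?_, steps_le_m := ?_ } }⟩
  · obtain ⟨v, hv⟩ := (hr a).simulation (hM.mono (Nat.le_add_right M 2)) (machine p M).m some none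
      (fun l => rfl) none
    rw [Nat.add_comm (t a) 1, iterate_add_apply]
    have h0 : initList (machine p M) (List.map (Equiv.refl Letter).invFun (ea a)) =
        ⟨some (some (entry p)), none, stackContents (M + 2) (update (fun _ => []) 0 (ea a))⟩ := by
      refine congrArg (TM2.Cfg.mk (some (some (entry p))) none) (funext fun k => ?_)
      change Fin (M + 2 + 1) at k
      by_cases hk : k = 0
      · subst hk; simp [machine, stackContents]; rfl
      · have : (k : ℕ) ≠ 0 := fun h => hk (Fin.ext h)
        simp [machine, stackContents, hk, this]
    have h1 : haltList (machine p M) (List.map (Equiv.refl Letter).invFun (eb (f a))) =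
        ⟨none, none, stackContents (M + 2) (update (fun _ => []) 1 (eb (f a)))⟩ := by
      refine congrArg (TM2.Cfg.mk none none) (funext fun k => ?_)
      change Fin (M + 2 + 1) at k
      by_cases hk : k = 1
      · subst hk; simp [machine, stackContents]; rfl
      · have : (k : ℕ) ≠ 1 := fun h => hk (Fin.ext (by simpa using h))
        simp [machine, stackContents, hk, this]
    have h2 := congrArg ((flip bind (TM2.step (machine p M).m))^[1]) hv
    refine (congrArg (fun c => (flip bind (TM2.step (machine p M).m))^[1]
      ((flip bind (TM2.step (machine p M).m))^[t a] (some c))) h0).trans (h2.trans ?_)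
    exact congrArg some h1.symm
  · simpa using ht a

end Prog

/-! ### String functions computable in polynomial time -/

/-- The data of type `X` are given to a program as the list `regs x` of register contents. -/
class Registers (X : Type) where
  regs : X → List Str

open Registers

/-- An additional string, as an additional first register. -/
instance instRegistersProd {X : Type} [Registers X] : Registers (X × Str) where
  regs x := x.2 :: regs x.1

/-- The total length of the registers that represent `x`. -/
def regSize {X : Type} [Registers X] (x : X) : ℕ := ((regs x).map List.length).sum

/-- The number `t x` is bounded by a polynomial in the size of `x`. -/
def PolyBounded {X : Type} [Registers X] (t : X → ℕ) : Prop := ∃ c, ∀ x, t x ≤ (regSize x + 2) ^ c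

/-- The string `f x` can be computed in polynomial time from the representation of `x`: wherever
the registers `ρ` of the representation lie below `b`, there is a program that writes `f x` into the
register `b` and leaves the other registers as they were, where the registers from `b` on are empty
at the start. -/
def FP {X : Type} [Registers X] (f : X → Str) : Prop :=
  ∀ (ρ : List ℕ) (b : ℕ), (∀ r ∈ ρ, r < b) → ∃ (p : Prog) (T : X → ℕ), PolyBounded T ∧
    ∀ (x : X) (S : ℕ → Str), ρ.map S = regs x → (∀ r, b ≤ r → S r = []) →
      ∃ t ≤ T x, p.Run S (Function.update S b (f x)) t

namespace PolyBounded

variable {X : Type} [Registers X] {s t : X → ℕ}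

theorem mono (ht : PolyBounded t) (h : ∀ x, s x ≤ t x) : PolyBounded s := by
  obtain ⟨c, hc⟩ := ht
  exact ⟨c, fun x => (h x).trans (hc x)⟩

theorem const (k : ℕ) : PolyBounded fun _ : X => k := by
  refine ⟨k, fun x => ?_⟩
  calc k ≤ 2 ^ k := Nat.lt_two_pow_self.le
    _ ≤ _ := Nat.pow_le_pow_left (by omega) k

theorem regSize : PolyBounded fun x : X => regSize x := ⟨1, fun x => by rw [pow_one]; exact Nat.le_add_right _ 2⟩

theorem add (hs : PolyBounded s) (ht : PolyBounded t) : PolyBounded fun x => s x + t x := by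
  obtain ⟨c, hc⟩ := hs
  obtain ⟨d, hd⟩ := ht
  refine ⟨max c d + 1, fun x => ?_⟩
  have h1 := (hc x).trans (Nat.pow_le_pow_right (by omega) (le_max_left c d))
  have h2 := (hd x).trans (Nat.pow_le_pow_right (by omega) (le_max_right c d))
  rw [pow_succ]
  calc s x + t x ≤ (_root_.regSize x + 2) ^ max c d * 2 := by omega
    _ ≤ _ := Nat.mul_le_mul_left _ (by omega)

theorem mul (hs : PolyBounded s) (ht : PolyBounded t) : PolyBounded fun x => s x * t x := by
  obtain ⟨c, hc⟩ := hs
  obtain ⟨d, hd⟩ := ht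
  exact ⟨c + d, fun x => by rw [pow_add]; exact Nat.mul_le_mul (hc x) (hd x)⟩

theorem pow (hs : PolyBounded s) (c : ℕ) : PolyBounded fun x => s x ^ c := by
  obtain ⟨d, hd⟩ := hs
  exact ⟨d * c, fun x => by rw [pow_mul]; exact Nat.pow_le_pow_left (hd x) c⟩

theorem sum {ι : Type} [Fintype ι] {s : ι → X → ℕ} (hs : ∀ i, PolyBounded (s i)) :
    PolyBounded fun x => ∑ i, s i x := by
  classical
  have : ∀ I : Finset ι, PolyBounded fun x => ∑ i ∈ I, s i x := by
    intro I
    induction I using Finset.induction_on with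
    | empty => simpa using const 0
    | insert i I hi ih => simpa [Finset.sum_insert hi] using (hs i).add ih
  exact this _

end PolyBounded

namespace Prog

open Function

/-- A step adds at most one symbol. -/
theorem Run.length_le {p : Prog} {S S' : ℕ → Str} {t : ℕ} (h : Run p S S' t) (r : ℕ) :
    (S' r).length ≤ (S r).length + t := by
  induction h with
  | nop S => omega
  | push S r' a => by_cases h : r = r' <;> simp [h]
  | pop S r' => by_cases h : r = r' <;> simp [h]; omega
  | seq _ _ ih₁ ih₂ => omega
  | loop_nil => omega
  | @loop_cons r' _ _ _ _ _ S _ _ a s _ _ hS _ _ ih₁ ih₂ =>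
    by_cases h : r = r'
    · subst h; simp [hS] at *; omega
    · simp [h] at *; omega

/-- A loop without states. -/
def forEach (r : ℕ) (body : Letter → Prog) : Prog := loop r Unit () (fun _ _ => ()) fun _ => body

theorem run_forEach_nil {r : ℕ} {body : Letter → Prog} {S : ℕ → Str} (h : S r = []) :
    Run (forEach r body) S S 1 := Run.loop_nil h

theorem run_forEach_cons {r : ℕ} {body : Letter → Prog} {S S' S'' : ℕ → Str} {t t' : ℕ} (a : Letter)
    (s : Str) (h : S r = a :: s) (h₁ : Run (body a) (update S r s) S' t)
    (h₂ : Run (forEach r body) S' S'' t') : Run (forEach r body) S S'' (1 + t + t') :=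
  Run.loop_cons h h₁ h₂

/-- Move the contents of the register `r`, reversed, to the top of `r'`. -/
def move (r r' : ℕ) : Prog := forEach r fun a => push r' a

theorem run_move {r r' : ℕ} (h : r ≠ r') (S : ℕ → Str) :
    Run (move r r') S (update (update S r []) r' ((S r).reverse ++ S r')) (2 * (S r).length + 1) := by
  unfold move
  suffices ∀ (s w : Str), Run (forEach r fun a => push r' a) (update (update S r s) r' w)
      (update (update S r []) r' (s.reverse ++ w)) (2 * s.length + 1) by
    simpa using this (S r) (S r')
  intro s
  induction s with
  | nil => intro w; simpa using run_forEach_nil (by simp [h])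
  | cons a s ih =>
    intro w
    have h1 : Run (push r' a) (update (update (update S r (a :: s)) r' w) r s)
        (update (update S r s) r' (a :: w)) 1 := by
      convert Run.push _ r' a using 1
      funext i
      simp only [update_apply]
      split_ifs <;> simp_all
    have := run_forEach_cons a s (by simp [h]) h1 (ih (a :: w))
    have e : 2 * (a :: s).length + 1 = 1 + 1 + (2 * s.length + 1) := by simp; ring
    rw [e]
    simpa using this

/-- Move the contents of the register `r`, reversed, to the top of both `r'` and `r''`. -/
def moveTwice (r r' r'' : ℕ) : Prog := forEach r fun a => seq (push r' a) (push r'' a)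

theorem run_moveTwice {r r' r'' : ℕ} (h : r ≠ r') (h' : r ≠ r'') (h'' : r' ≠ r'') (S : ℕ → Str) :
    Run (moveTwice r r' r'') S (update (update (update S r []) r' ((S r).reverse ++ S r')) r''
      ((S r).reverse ++ S r'')) (3 * (S r).length + 1) := by
  unfold moveTwice
  suffices ∀ (s w w' : Str), Run (forEach r fun a => seq (push r' a) (push r'' a)) (update (update (update S r s) r' w) r'' w')
      (update (update (update S r []) r' (s.reverse ++ w)) r'' (s.reverse ++ w'))
      (3 * s.length + 1) by
    simpa using this (S r) (S r') (S r'')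
  intro s
  induction s with
  | nil => intro w w'; simpa using run_forEach_nil (by simp [h, h'])
  | cons a s ih =>
    intro w w'
    have h1 : Run (seq (push r' a) (push r'' a))
        (update (update (update (update S r (a :: s)) r' w) r'' w') r s)
        (update (update (update S r s) r' (a :: w)) r'' (a :: w')) 2 := by
      convert Run.seq (Run.push _ r' a) (Run.push _ r'' a) using 1
      funext i
      simp only [update_apply]
      split_ifs <;> simp_all
    have := run_forEach_cons a s (by simp [h, h']) h1 (ih (a :: w) (a :: w'))
    have e : 3 * (a :: s).length + 1 = 1 + 2 + (3 * s.length + 1) := by simp; ring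
    rw [e]
    simpa using this

/-- Empty the register `r`. -/
def clear (r : ℕ) : Prog := forEach r fun _ => nop

theorem run_clear (r : ℕ) (S : ℕ → Str) :
    Run (clear r) S (update S r []) (2 * (S r).length + 1) := by
  unfold clear
  suffices ∀ s : Str, Run (forEach r fun _ => nop) (update S r s) (update S r []) (2 * s.length + 1) by
    simpa using this (S r)
  intro s
  induction s with
  | nil => simpa using run_forEach_nil (by simp)
  | cons a s ih =>
    have e : 2 * (a :: s).length + 1 = 1 + 1 + (2 * s.length + 1) := by simp; ring
    rw [e]
    exact run_forEach_cons a s (by simp) (Run.nop _) (by simpa using ih)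

theorem Run.congr {p : Prog} {S S' S'' : ℕ → Str} {t : ℕ} (h : Run p S S' t) (e : S' = S'') :
    Run p S S'' t := e ▸ h

end Prog

namespace FP

open Function Prog

variable {X : Type} [Registers X] {f g : X → Str}

theorem map_update {ρ : List ℕ} {b r : ℕ} (hρ : ∀ r ∈ ρ, r < b) (hr : b ≤ r) (S : ℕ → Str)
    (s : Str) : ρ.map (update S r s) = ρ.map S := by
  refine List.map_congr_left fun i hi => ?_
  have := hρ i hi
  simp [show i ≠ r by omega]

theorem const (w : Str) : FP fun _ : X => w := by
  intro ρ b hρ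
  suffices ∃ p : Prog, ∃ k, ∀ S : ℕ → Str, S b = [] → p.Run S (update S b w) k by
    obtain ⟨p, k, h⟩ := this
    exact ⟨p, fun _ => k, .const k, fun x S _ hS => ⟨k, le_rfl, h S (hS b le_rfl)⟩⟩
  induction w with
  | nil =>
    refine ⟨.nop, 1, fun S hS => (Run.nop S).congr ?_⟩
    rw [← hS, update_eq_self]
  | cons a w ih =>
    obtain ⟨p, k, h⟩ := ih
    exact ⟨.seq p (.push b a), k + 1, fun S hS =>
      (Run.seq (h S hS) (Run.push _ b a)).congr (by simp)⟩

/-- The string in the first register can be copied without loss. -/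
theorem of_head (h : ∀ x, (regs x).head? = some (f x)) : FP f := by
  intro ρ b hρ
  rcases ρ with _ | ⟨r, ρ⟩
  · exact ⟨.nop, fun _ => 0, .const 0, fun x S hS _ => by have := h x; simp [← hS] at this⟩
  have hr := hρ r (by simp)
  refine ⟨.seq (move r (b + 1)) (moveTwice (b + 1) r b),
    fun x => 5 * regSize x + 2, ((PolyBounded.const 5).mul .regSize).add (.const 2),
    fun x S hS hb => ?_⟩
  have hx : S r = f x := by have := h x; simpa [← hS] using this
  refine ⟨_, ?_, Run.seq (run_move (by omega) S) ((run_moveTwice (by omega) (by omega) (by omega)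
    _).congr ?_)⟩
  · have : (S r).length ≤ regSize x := by simp [regSize, ← hS]
    simp [hb (b + 1) (by omega)]
    omega
  · have h1 := hb (b + 1) (by omega)
    have h2 := hb b le_rfl
    funext i
    simp only [update_apply]
    split_ifs <;> first | omega | simp_all

theorem weaken (hf : FP f) : FP fun y : X × Str => f y.1 := by
  intro ρ b hρ
  rcases ρ with _ | ⟨r, ρ⟩
  · exact ⟨.nop, fun _ => 0, .const 0, fun x S hS _ => by simp [regs] at hS⟩
  obtain ⟨p, T, ⟨c, hc⟩, h⟩ := hf ρ b fun i hi => hρ i (by simp [hi])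
  refine ⟨p, fun y => T y.1, ⟨c, fun y => (hc y.1).trans (Nat.pow_le_pow_left ?_ c)⟩,
    fun y S hS hb => h y.1 S ?_ hb⟩
  · simp [regSize, regs]
  · simp only [regs, List.map_cons, List.cons.injEq] at hS
    exact hS.2

theorem append (hf : FP f) (hg : FP g) : FP fun x => f x ++ g x := by
  intro ρ b hρ
  obtain ⟨p, T, hT, h⟩ := hg ρ b hρ
  obtain ⟨p', T', hT', h'⟩ := hf ρ (b + 1) fun i hi => (hρ i hi).trans (Nat.lt_succ_self b)
  refine ⟨.seq p (.seq p' (.seq (move (b + 1) (b + 2)) (move (b + 2) b))),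
    fun x => T x + 5 * T' x + 2, (hT.add ((PolyBounded.const 5).mul hT')).add (.const 2),
    fun x S hS hb => ?_⟩
  obtain ⟨t, ht, hr⟩ := h x S hS hb
  obtain ⟨t', ht', hr'⟩ := h' x (update S b (g x)) (by rw [map_update hρ le_rfl, hS])
    fun r hr => by rw [update_of_ne (by omega)]; exact hb r (by omega)
  have hl := hr'.length_le (b + 1)
  have h1 := hb (b + 1) (by omega)
  have h2 := hb (b + 2) (by omega)
  refine ⟨_, ?_, Run.seq hr (Run.seq hr' (Run.seq (run_move (by omega) _)
    ((run_move (by omega) _).congr ?_)))⟩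
  · simp [h1, h2] at hl ⊢
    omega
  · funext i
    simp only [update_apply]
    split_ifs <;> first | omega | simp_all

/-- Removing as many symbols as `g x` has; on numbers in unary this is truncated subtraction. -/
theorem drop (hf : FP f) (hg : FP g) : FP fun x => (f x).drop (g x).length := by
  intro ρ b hρ
  obtain ⟨p, T, hT, h⟩ := hf ρ b hρ
  obtain ⟨p', T', hT', h'⟩ := hg ρ (b + 1) fun i hi => (hρ i hi).trans (Nat.lt_succ_self b)
  have key : ∀ (s w : Str) (S : ℕ → Str), Run (forEach (b + 1) fun _ => .pop b)
      (update (update S b w) (b + 1) s)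
      (update (update S b (w.drop s.length)) (b + 1) []) (2 * s.length + 1) := by
    intro s
    induction s with
    | nil => intro w S; simpa using run_forEach_nil (by simp)
    | cons a s ih =>
      intro w S
      have e : 2 * (a :: s).length + 1 = 1 + 1 + (2 * s.length + 1) := by simp; ring
      rw [e]
      refine run_forEach_cons a s (by simp) (Run.pop _ b) ?_
      convert ih w.tail S using 1
      · funext i
        simp only [update_apply]
        split_ifs <;> first | omega | simp_all
      · simp
  refine ⟨.seq p (.seq p' (forEach (b + 1) fun _ => .pop b)),
    fun x => T x + 3 * T' x + 1, (hT.add ((PolyBounded.const 3).mul hT')).add (.const 1),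
    fun x S hS hb => ?_⟩
  obtain ⟨t, ht, hr⟩ := h x S hS hb
  obtain ⟨t', ht', hr'⟩ := h' x (update S b (f x)) (by rw [map_update hρ le_rfl, hS])
    fun r hr => by rw [update_of_ne (by omega)]; exact hb r (by omega)
  have hl := hr'.length_le (b + 1)
  have h1 := hb (b + 1) (by omega)
  refine ⟨_, ?_, Run.seq hr (Run.seq hr' ((key _ _ _).congr ?_))⟩
  · simp [h1] at hl ⊢
    omega
  · funext i
    simp only [update_apply]
    split_ifs <;> first | omega | simp_all

end FP

/-- The output of a transducer that reads the third argument in the states `Q`: at the symbol `a` in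
the state `q`, with the symbols `pre` read so far (last one first), it emits `body q a pre`. -/
def scan {Q : Type} (next : Q → Letter → Q) (body : Q → Letter → Str → Str) : Q → Str → Str → Str
  | _, _, [] => []
  | q, pre, a :: s => body q a pre ++ scan next body (next q a) (a :: pre) s

namespace FP

open Function Prog

variable {X : Type} [Registers X] {f g : X → Str}

/-- Closure under transducers that see the symbols read so far.  All recursions along lists and
numbers are instances.  The program keeps the symbols read in a register of its own, which serves as an
additional input of `body`. -/
theorem scan {Q : Type} [Fintype Q] (q₀ : Q) (next : Q → Letter → Q)
    {body : Q → Letter → X → Str → Str} (hf : FP f)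
    (hb : ∀ q a, FP fun y : X × Str => body q a y.1 y.2) :
    FP fun x => scan next (fun q a => body q a x) q₀ [] (f x) := by
  intro ρ b hρ
  obtain ⟨p, T, hT, h⟩ := hf ρ b hρ
  choose pb Tb hTb hrun using fun q a => hb q a ((b + 1) :: ρ) (b + 3) (by
    intro i hi
    rcases List.mem_cons.1 hi with rfl | hi
    · omega
    · have := hρ i hi; omega)
  choose c hc using hTb
  -- A bound for one round of the loop, in terms of the size of `x` and of the scanned string.
  let B : X → ℕ := fun x => ∑ i : Q × Letter, (regSize x + T x + 2) ^ c i.1 i.2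
  have hB : PolyBounded B := PolyBounded.sum fun i =>
    (((PolyBounded.regSize).add hT).add (.const 2)).pow (c i.1 i.2)
  let loopBody : Q → Letter → Prog := fun q a =>
    .seq (pb q a) (.seq (move (b + 3) (b + 2)) (.push (b + 1) a))
  -- The loop, started with the rest `s` of the scanned string, the prefix `pre` and the reversed
  -- output `acc`.
  have key : ∀ (x : X) (S : ℕ → Str), ρ.map S = regs x → (∀ r, b ≤ r → S r = []) →
      ∀ (s : Str) (q : Q) (pre acc : Str), pre.length + s.length ≤ T x →
      ∃ t ≤ (3 * B x + 3) * s.length + 1, ∃ w : Str, w.length ≤ pre.length + s.length ∧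
      Run (.loop b Q q next loopBody)
        (update (update (update S b s) (b + 1) pre) (b + 2) acc)
        (update (update S (b + 1) w) (b + 2)
          ((_root_.scan next (fun q a => body q a x) q pre s).reverse ++ acc)) t := by
    intro x S hS hb s
    induction s with
    | nil =>
      intro q pre acc hl
      refine ⟨1, by omega, pre, by simp, (Run.loop_nil (by simp)).congr ?_⟩
      have := hb b le_rfl
      funext i
      simp only [update_apply, _root_.scan]
      split_ifs <;> simp_all
    | cons a s ih =>
      intro q pre acc hl
      obtain ⟨t', ht', w, hw, hr'⟩ := ih (next q a) (a :: pre)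
        ((body q a x pre).reverse ++ acc) (by simp at hl ⊢; omega)
      obtain ⟨t, ht, hr⟩ := hrun q a (x, pre)
        (update (update (update S b s) (b + 1) pre) (b + 2) acc) (by
          simp only [List.map_cons, regs]
          rw [map_update hρ (by omega), map_update hρ (by omega), map_update hρ le_rfl, hS]
          simp) fun r hr => by
          rw [update_of_ne (by omega), update_of_ne (by omega), update_of_ne (by omega)]
          exact hb r (by omega)
      have hlen := hr.length_le (b + 3)
      have h3 := hb (b + 3) (by omega)
      have hBt : t ≤ B x := by
        refine ht.trans ((hc q a (x, pre)).trans ?_)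
        refine le_trans (Nat.pow_le_pow_left ?_ _) (Finset.single_le_sum
          (f := fun i : Q × Letter => (regSize x + T x + 2) ^ c i.1 i.2)
          (fun _ _ => Nat.zero_le _) (Finset.mem_univ (q, a)))
        simp only [regSize, regs, List.map_cons, List.sum_cons]
        simp at hl
        omega
      have hr₁ : Run (pb q a)
          (update (update (update (update S b (a :: s)) (b + 1) pre) (b + 2) acc) b s)
          (update (update (update (update S b s) (b + 1) pre) (b + 2) acc) (b + 3)
            (body q a x pre)) t := by
        convert hr using 1
        funext i
        simp only [update_apply]
        split_ifs <;> first | omega | simp_all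
      refine ⟨_, ?_, w, by simp at hw ⊢; omega, Run.loop_cons (a := a) (s := s) (by simp)
        (Run.seq hr₁ (Run.seq (run_move (by omega) _) (Run.push _ (b + 1) a)))
        (Run.congr (S' := update (update S (b + 1) w) (b + 2)
          ((_root_.scan next (fun q a => body q a x) (next q a) (a :: pre) s).reverse ++
            ((body q a x pre).reverse ++ acc))) (t := t') ?_ ?_)⟩
      · simp [h3] at hlen ⊢
        nlinarith
      · convert hr' using 1
        funext i
        simp only [update_apply]
        split_ifs <;> first | omega | simp_all
      · simp [_root_.scan]
  refine ⟨.seq p (.seq (.loop b Q q₀ next loopBody) (.seq (clear (b + 1)) (move (b + 2) b))),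
    fun x => T x + 3 * ((3 * B x + 3) * T x + 1) + 2 * T x + 2,
    ((hT.add ((PolyBounded.const 3).mul (((((PolyBounded.const 3).mul hB).add (.const 3)).mul
      hT).add (.const 1)))).add ((PolyBounded.const 2).mul hT)).add (.const 2),
    fun x S hS hb => ?_⟩
  obtain ⟨t, ht, hr⟩ := h x S hS hb
  have h0 := hb b le_rfl
  have h1 := hb (b + 1) (by omega)
  have h2 := hb (b + 2) (by omega)
  have hl := hr.length_le b
  simp only [update_self, h0, List.length_nil, Nat.zero_add] at hl
  obtain ⟨t', ht', w, hw, hr'⟩ := key x S hS hb (f x) q₀ [] [] (by simp; omega)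
  have e : update (update (update S b (f x)) (b + 1) []) (b + 2) [] = update S b (f x) := by
    rw [update_eq_self_iff.2 (by simp [h2]), update_eq_self_iff.2 (by simp [h1])]
  rw [e] at hr'
  have hl' := hr'.length_le (b + 2)
  simp [h2] at hl'
  have hm : (3 * B x + 3) * (f x).length ≤ (3 * B x + 3) * T x :=
    Nat.mul_le_mul_left _ (by omega)
  refine ⟨_, ?_, Run.seq hr (Run.seq hr' (Run.seq (run_clear _ _)
    ((run_move (by omega) _).congr ?_)))⟩
  · simp at hw ⊢
    omega
  · funext i
    simp only [update_apply]
    clear key hrun hc h hr hr'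
    split_ifs <;> first | omega | (subst_vars; simp [h0, h1, h2])

end FP

/-! ### Numbers, words and case distinctions in polynomial time -/

/-- The output of a transducer without access to the symbols read so far. -/
def transduce {Q : Type} (next : Q → Letter → Q) (out : Q → Letter → Str) : Q → Str → Str
  | _, [] => []
  | q, a :: s => out q a ++ transduce next out (next q a) s

theorem scan_eq_transduce {Q : Type} (next : Q → Letter → Q) (out : Q → Letter → Str) (q : Q)
    (pre s : Str) : scan next (fun q a _ => out q a) q pre s = transduce next out q s := by
  induction s generalizing q pre with
  | nil => rfl
  | cons a s ih => simp [scan, transduce, ih]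

/-- A number in unary, as a string without an end mark. -/
def unary (j : ℕ) : Str := List.replicate j (some true)

@[simp] theorem length_unary (j : ℕ) : (unary j).length = j := by simp [unary]

theorem unary_succ (j : ℕ) : unary (j + 1) = some true :: unary j := rfl

theorem unary_add (i j : ℕ) : unary (i + j) = unary i ++ unary j := by
  simp [unary, List.replicate_append_replicate]

/-- The string of the words that represent a rational number. -/
def ratStr (q : ℚ) : Str := encodeWords (ratWords q)

/-- The string of the binary digits of a number. -/
def bitsStr (m : ℕ) : Str := m.bits.map some

/-- The number `j x` can be computed in unary in polynomial time. -/
def FPNat {X : Type} [Registers X] (j : X → ℕ) : Prop := FP fun x => unary (j x)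

/-- The representation of the rational number `q x` can be computed in polynomial time. -/
def FPRat {X : Type} [Registers X] (q : X → ℚ) : Prop := FP fun x => ratStr (q x)

/-- The binary digits of the number `m x` can be computed in polynomial time. -/
def FPBits {X : Type} [Registers X] (m : X → ℕ) : Prop := FP fun x => bitsStr (m x)

namespace FP

variable {X : Type} [Registers X] {f g h : X → Str}

theorem congr (hf : FP f) (e : ∀ x, f x = g x) : FP g := (funext e : f = g) ▸ hf

theorem snd : FP fun y : X × Str => y.2 := of_head fun _ => rfl

theorem transduce {Q : Type} [Fintype Q] (q₀ : Q) (next : Q → Letter → Q) {out : Q → Letter → X → Str}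
    (hf : FP f) (ho : ∀ q a, FP (out q a)) :
    FP fun x => transduce next (fun q a => out q a x) q₀ (f x) :=
  (scan q₀ next hf (body := fun q a x _ => out q a x) fun q a => (ho q a).weaken).congr
    fun x => scan_eq_transduce next (fun q a => out q a x) q₀ [] (f x)

theorem flatMap_letter {out : Letter → X → Str} (hf : FP f) (ho : ∀ a, FP (out a)) :
    FP fun x => (f x).flatMap fun a => out a x := by
  refine (transduce () (fun _ _ => ()) (out := fun _ => out) hf fun _ => ho).congr fun x => ?_
  induction f x with
  | nil => rfl
  | cons a s ih => simp [_root_.transduce, ih]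

theorem length (hf : FP f) : FPNat fun x => (f x).length := by
  refine (flatMap_letter hf (out := fun _ _ => [some true]) fun _ => const _).congr fun x => ?_
  simp [unary, List.flatMap, List.map_const', List.flatten_replicate_singleton]

theorem ite_ne_nil (hf : FP f) (hg : FP g) (hh : FP h) :
    FP fun x => if f x ≠ [] then g x else h x := by
  have first : ∀ {f g : X → Str}, FP f → FP g → FP fun x => if f x ≠ [] then g x else [] := by
    intro f g hf hg
    refine (transduce true (fun _ _ => false) (out := fun q _ x => if q then g x else []) hf ?_).congr
      fun x => ?_
    · rintro (_ | _) a
      · exact const _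
      · simpa using hg
    · have : ∀ s : Str, _root_.transduce (fun _ _ => false)
          (fun q _ => if q = true then g x else []) false s = [] := by
        intro s
        induction s with
        | nil => rfl
        | cons a s ih => simpa [_root_.transduce] using ih
      cases f x <;> simp [_root_.transduce, this]
  have hn : FP fun x => ([none] : Str).drop (f x).length := (const [none]).drop hf
  refine ((first hf hg).append (first hn hh)).congr fun x => ?_
  cases f x <;> simp

end FP

namespace FPNat

variable {X : Type} [Registers X] {i j k : X → ℕ} {f g : X → Str}

theorem congr (hi : FPNat i) (e : ∀ x, i x = j x) : FPNat j := (funext e : i = j) ▸ hi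

theorem const (c : ℕ) : FPNat fun _ : X => c := FP.const _

theorem weaken (hi : FPNat i) : FPNat fun y : X × Str => i y.1 := FP.weaken hi

theorem add (hi : FPNat i) (hj : FPNat j) : FPNat fun x => i x + j x :=
  (FP.append hi hj).congr fun _ => (unary_add _ _).symm

theorem const_mul (c : ℕ) (hi : FPNat i) : FPNat fun x => c * i x := by
  induction c with
  | zero => exact (const 0).congr fun x => by simp
  | succ c ih => exact (ih.add hi).congr fun x => by ring

theorem sub (hi : FPNat i) (hj : FPNat j) : FPNat fun x => i x - j x :=
  (FP.drop hi hj).congr fun x => by simp [unary]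

theorem ite_lt (hi : FPNat i) (hj : FPNat j) (hf : FP f) (hg : FP g) :
    FP fun x => if i x < j x then f x else g x := by
  refine (FP.ite_ne_nil (hj.sub hi) hf hg).congr fun x => ?_
  simp [unary, Nat.sub_eq_zero_iff_le]

theorem sumCount (hf : FP f) : FPNat fun x => (f x).count none := by
  refine (FP.flatMap_letter hf (out := fun a _ => if a = none then [some true] else [])
    fun a => FP.const _).congr fun x => ?_
  change _ = unary ((f x).count none)
  induction f x with
  | nil => rfl
  | cons a s ih => cases a <;> simp [ih, unary_succ]

theorem flatMap_range {F : X → ℕ → Str} (hi : FPNat i)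
    (hF : FP fun y : X × Str => F y.1 y.2.length) :
    FP fun x => (List.range (i x)).flatMap (F x) := by
  refine (FP.scan () (fun _ _ => ()) (body := fun _ _ x pre => F x pre.length) hi
    fun _ _ => hF).congr fun x => ?_
  have : ∀ (m : ℕ) (pre : Str), scan (fun _ _ => ()) (fun _ _ pre => F x pre.length) () pre
      (unary m) = (List.range' pre.length m).flatMap (F x) := by
    intro m
    induction m with
    | zero => intro pre; rfl
    | succ m ih => intro pre; simp [unary_succ, scan, ih, List.range'_succ]
  rw [this, List.range_eq_range']
  rfl

end FPNat

/-! ### Rational numbers -/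

theorem encodeWords_append (u v : List (List Bool)) :
    encodeWords (u ++ v) = encodeWords u ++ encodeWords v := by simp [encodeWords]

theorem encodeWords_cons (w : List Bool) (ws : List (List Bool)) :
    encodeWords (w :: ws) = w.map some ++ none :: encodeWords ws := by simp [encodeWords]

@[simp] theorem encodeWords_nil : encodeWords [] = [] := rfl

theorem map_unaryWord (j : ℕ) : (unaryWord j).map some = unary j := by simp [unaryWord, unary]

theorem ratStr_eq (q : ℚ) :
    ratStr q = [some (decide (q < 0)), none] ++ bitsStr q.num.natAbs ++ [none] ++ bitsStr q.den ++
      [none] := by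
  simp [ratStr, ratWords, encodeWords_cons, bitsStr]

theorem ratStr_div {a b : ℕ} (hb : 0 < b) (h : a.Coprime b) :
    ratStr ((a : ℚ) / b) = [some false, none] ++ bitsStr a ++ [none] ++ bitsStr b ++ [none] := by
  have h1 : ((a : ℚ) / b).num = a := by
    simpa using Rat.num_div_eq_of_coprime (a := a) (b := b) (by exact_mod_cast hb) (by simpa using h)
  have h2 : ((a : ℚ) / b).den = b := by
    have := Rat.den_div_eq_of_coprime (a := a) (b := b) (by exact_mod_cast hb) (by simpa using h)
    simpa only [Int.cast_natCast, Nat.cast_inj] using this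
  have h3 : ¬ ((a : ℚ) / b < 0) := not_lt.2 (by positivity)
  rw [ratStr_eq, h1, h2]
  simp [h3]

theorem ratStr_neg {q : ℚ} (h : 0 < q) :
    ratStr (-q) = [some true, none] ++ bitsStr q.num.natAbs ++ [none] ++ bitsStr q.den ++ [none] := by
  rw [ratStr_eq]
  simp [h]

theorem bits_two_pow (j : ℕ) : (2 ^ j).bits = List.replicate j false ++ [true] := by
  induction j with
  | zero => simp
  | succ j ih =>
    rw [pow_succ, mul_comm, Nat.bit0_bits _ (by positivity), ih]
    rfl

theorem bits_two_pow_sub_one (j : ℕ) : (2 ^ j - 1).bits = List.replicate j true := by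
  induction j with
  | zero => simp
  | succ j ih =>
    have : 2 ^ (j + 1) - 1 = 2 * (2 ^ j - 1) + 1 := by
      have := Nat.one_le_two_pow (n := j)
      rw [pow_succ]; omega
    rw [this, Nat.bit1_bits, ih]
    rfl

namespace FPBits

variable {X : Type} [Registers X] {a b : X → ℕ} {j : X → ℕ}

theorem const (c : ℕ) : FPBits fun _ : X => c := FP.const _

theorem two_pow (hj : FPNat j) : FPBits fun x => 2 ^ j x := by
  refine ((FP.flatMap_letter hj (out := fun _ _ => [some false]) fun _ => FP.const _).append
    (FP.const [some true])).congr fun x => ?_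
  simp [unary, bitsStr, bits_two_pow, List.flatMap, List.flatten_replicate_singleton]

theorem two_pow_sub_one (hj : FPNat j) : FPBits fun x => 2 ^ j x - 1 :=
  FP.congr hj fun x => by simp [bitsStr, bits_two_pow_sub_one, unary]

theorem two_mul (ha : FPBits a) (h : ∀ x, 0 < a x) : FPBits fun x => 2 * a x := by
  refine (FP.append (FP.const [some false]) ha).congr fun x => ?_
  simp [bitsStr, Nat.bit0_bits _ (h x).ne']

theorem div (ha : FPBits a) (hb : FPBits b) (h : ∀ x, 0 < b x) (hab : ∀ x, (a x).Coprime (b x)) :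
    FPRat fun x => (a x : ℚ) / b x :=
  (((((FP.const _).append ha).append (FP.const _)).append hb).append (FP.const _)).congr
    fun x => (ratStr_div (h x) (hab x)).symm

theorem neg_div (ha : FPBits a) (hb : FPBits b) (ha' : ∀ x, 0 < a x) (h : ∀ x, 0 < b x)
    (hab : ∀ x, (a x).Coprime (b x)) : FPRat fun x => -((a x : ℚ) / b x) := by
  refine (((((FP.const [some true, none]).append ha).append (FP.const [none])).append hb).append
    (FP.const [none])).congr fun x => ?_
  have hq : (0 : ℚ) < (a x : ℚ) / b x := by
    have := ha' x
    have := h x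
    positivity
  have h1 : ((a x : ℚ) / b x).num = a x := by
    simpa using Rat.num_div_eq_of_coprime (a := a x) (b := b x) (by exact_mod_cast h x)
      (by simpa using hab x)
  have h2 : ((a x : ℚ) / b x).den = b x := by
    have := Rat.den_div_eq_of_coprime (a := a x) (b := b x) (by exact_mod_cast h x)
      (by simpa using hab x)
    simpa only [Int.cast_natCast, Nat.cast_inj] using this
  rw [ratStr_neg hq, h1, h2]
  rfl

end FPBits

namespace FPRat

variable {X : Type} [Registers X] {p q : X → ℚ} {j : X → ℕ}

theorem congr (hp : FPRat p) (e : ∀ x, p x = q x) : FPRat q := (funext e : p = q) ▸ hp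

theorem const (c : ℚ) : FPRat fun _ : X => c := FP.const _

theorem weaken (hp : FPRat p) : FPRat fun y : X × Str => p y.1 := FP.weaken hp

theorem inv_two_pow (hj : FPNat j) : FPRat fun x => 1 / 2 ^ j x :=
  ((FPBits.const 1).div (.two_pow hj) (fun _ => by positivity) fun _ => by simp).congr
    fun x => by simp

theorem neg_inv_two_pow (hj : FPNat j) : FPRat fun x => -(1 / 2 ^ j x) :=
  ((FPBits.const 1).neg_div (.two_pow hj) (fun _ => Nat.one_pos) (fun _ => by positivity)
    fun _ => by simp).congr fun x => by simp

end FPRat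

/-! ### Lists of unary words -/

/-- A list of numbers in unary. -/
def outStr (os : List ℕ) : Str := os.flatMap fun o => unary o ++ [none]

@[simp] theorem outStr_nil : outStr [] = [] := rfl

@[simp] theorem outStr_cons (o : ℕ) (os : List ℕ) :
    outStr (o :: os) = unary o ++ none :: outStr os := by simp [outStr]

@[simp] theorem count_unary (j : ℕ) : (unary j).count none = 0 := by
  simp [unary, List.count_replicate]

theorem count_outStr (os : List ℕ) : (outStr os).count none = os.length := by
  induction os with
  | nil => rfl
  | cons o os ih => simp [ih]

theorem scan_unary {Q : Type} (next : Q → Letter → Q) (body : Q → Letter → Str → Str) (q : Q)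
    (h : next q (some true) = q) (j : ℕ) (pre s : Str) :
    scan next body q pre (unary j ++ s) =
      (List.range j).flatMap (fun i => body q (some true) (unary i ++ pre)) ++
        scan next body q (unary j ++ pre) s := by
  induction j generalizing pre with
  | zero => simp [unary]
  | succ j ih =>
    have e : ∀ i : ℕ, unary i ++ some true :: pre = unary (i + 1) ++ pre := fun i => by
      rw [unary_add]; simp [unary]
    conv_lhs => rw [unary_succ, List.cons_append, scan, h, ih, e]
    simp [List.range_succ_eq_map, List.flatMap_map, e, show unary 0 = [] from rfl]

theorem transduce_unary {Q : Type} (next : Q → Letter → Q) (out : Q → Letter → Str) (q : Q)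
    (h : next q (some true) = q) (j : ℕ) (s : Str) :
    transduce next out q (unary j ++ s) =
      (List.replicate j (out q (some true))).flatten ++ transduce next out q s := by
  induction j with
  | zero => simp [unary]
  | succ j ih => simp [unary_succ, transduce, h, ih, List.replicate_succ]

namespace FP

variable {X : Type} [Registers X] {os : X → List ℕ} {k : X → ℕ}

theorem takeWords (ho : FP fun x => outStr (os x)) (hk : FPNat k) :
    FP fun x => outStr ((os x).take (k x)) := by
  refine (scan () (fun _ _ => ()) (body := fun _ a x pre => if pre.count none < k x then [a] else [])
    ho fun _ a => FPNat.ite_lt (.sumCount snd) hk.weaken (const _) (const _)).congr fun x => ?_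
  have : ∀ (l : List ℕ) (pre : Str), _root_.scan (fun _ _ => ())
      (fun _ a pre => if pre.count none < k x then [a] else []) () pre (outStr l) =
      outStr (l.take (k x - pre.count none)) := by
    intro l
    induction l with
    | nil => intro pre; simp [_root_.scan]
    | cons o l ih =>
      intro pre
      rw [outStr_cons, scan_unary _ _ _ rfl]
      by_cases h : pre.count none < k x
      · obtain ⟨d, hd⟩ : ∃ d, k x - pre.count none = d + 1 := ⟨k x - pre.count none - 1, by omega⟩
        have h2 : k x - (pre.count none + 1) = d := by omega
        simp [_root_.scan, ih, h, hd, h2, List.flatMap, List.map_const', unary,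
          List.flatten_replicate_singleton, List.count_replicate]
      · have h2 : k x - pre.count none = 0 := by omega
        have h3 : k x - (pre.count none + 1) = 0 := by omega
        simp [_root_.scan, ih, h, h2, h3, List.flatMap, List.map_const']
  simpa using this (os x) []

theorem dropWords (ho : FP fun x => outStr (os x)) (hk : FPNat k) :
    FP fun x => outStr ((os x).drop (k x)) := by
  refine ((ho.drop (ho.takeWords hk))).congr fun x => ?_
  have : outStr (os x) = outStr ((os x).take (k x)) ++ outStr ((os x).drop (k x)) := by
    simp [outStr, ← List.flatMap_append]
  conv_lhs => rw [this]
  simp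

theorem half (ho : FP fun x => outStr (os x)) : FPNat fun x => (os x).length / 2 := by
  refine (transduce false (fun q a => if a = none then !q else q)
    (out := fun q a _ => if a = none ∧ q then [some true] else []) ho fun _ _ => const _).congr
    fun x => ?_
  have : ∀ (l : List ℕ) (q : Bool), _root_.transduce (fun q a => if a = none then !q else q)
      (fun q a => if a = none ∧ q then [some true] else []) q (outStr l) =
      unary ((l.length + q.toNat) / 2) := by
    intro l
    induction l with
    | nil => rintro (_ | _) <;> rfl
    | cons o l ih =>
      intro q
      rw [outStr_cons, transduce_unary _ _ _ (by simp)]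
      cases q
      · simp [_root_.transduce, ih]
      · have : (l.length + 1 + 1) / 2 = l.length / 2 + 1 := by omega
        simp [_root_.transduce, ih, this, unary_succ]
  simpa using this (os x) false

theorem takeWhile_true {f : X → Str} (hf : FP f) :
    FP fun x => (f x).takeWhile (· = some true) := by
  refine (transduce true (fun q a => q && decide (a = some true))
    (out := fun q a _ => if q ∧ a = some true then [a] else []) hf fun _ _ => const _).congr
    fun x => ?_
  have h0 : ∀ s : Str, _root_.transduce (fun q a => q && decide (a = some true))
      (fun q a => if q ∧ a = some true then [a] else []) false s = [] := by
    intro s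
    induction s with
    | nil => rfl
    | cons a s ih => simpa [_root_.transduce] using ih
  induction f x with
  | nil => rfl
  | cons a s ih =>
    by_cases h : a = some true
    · simpa [_root_.transduce, h] using ih
    · simpa [_root_.transduce, h] using h0 s

end FP

/-! ### The circuit -/

/-- A truncated linear gate. -/
def truncGate (a b c : ℚ) (j k : ℕ) : LinearGate := .trunc 0 1 a b c j k

/-- One stage of the extraction of the binary digits of a coordinate, for the digit of weight
`2⁻⁽ᵏ⁺¹⁾`.  The variable `t` holds the alarm and the variable `t + 1` the remainder `r`, as
`1 / 2 + r / 4`; the new digit is the variable `t + 3`, and the new alarm and remainder are the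
variables `t + 7` and `t + 8`.  The alarm is raised if `r` is slightly above the threshold
`2⁻⁽ᵏ⁺¹⁾`, where the digit would not be Boolean. -/
def digitStage (Γ : ℚ) (k t : ℕ) : List LinearGate :=
  [truncGate 8 (-8) (-(1 / 2 ^ k)) (t + 1) 2,
   truncGate Γ 0 (-3 / 2) (t + 2) 0,
   truncGate Γ 0 (-1 / 4) (t + 2) 0,
   truncGate Γ 0 (-3) (t + 2) 0,
   truncGate 2 (-2) (-1 / 2) (t + 4) (t + 5),
   truncGate 2 2 (-1 / 2) t (t + 6),
   truncGate 1 (-(1 / 2 ^ (k + 3))) 0 (t + 1) (t + 3)]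

/-- The start of the extraction for the coordinate `i` and the parity `e`, at the variable `D`; the
grid has `2 ^ (m + 1)` points in each direction. -/
def digitStart (m D i : ℕ) (e : Bool) : List LinearGate :=
  [truncGate (((2 ^ (m + 1) - 1 : ℕ) : ℚ) / (2 ^ (m + 3) : ℕ)) 0 (1 / 2) i 0,
   truncGate 0 0 (-1) 0 0,
   truncGate 1 0 (if e then 0 else 1 / 2 ^ (m + 3)) D 0]

/-- The end of the extraction, at the variable `t + 2`.  The variable `t + 3` holds the displacement
`y` from the grid point, as `1 / 2 + y / 4`, and the variable `t + 6` the excess of `|y|` over half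
the side length, multiplied by `Γ`. -/
def digitEnd (m : ℕ) (Γ : ℚ) (t : ℕ) : List LinearGate :=
  [truncGate 1 0 (-(1 / 2 ^ (m + 3))) (t + 1) 0,
   truncGate (((2 ^ (m + 1) : ℕ) : ℚ) / (2 ^ (m + 1) - 1 : ℕ))
     (-(((2 ^ (m + 1) : ℕ) : ℚ) / (2 ^ (m + 1) - 1 : ℕ))) (1 / 2) (t + 2) 2,
   truncGate 4 (-4) (-(((1 : ℕ) : ℚ) / (2 * (2 ^ (m + 1) - 1) : ℕ))) (t + 3) 2,
   truncGate (-4) 4 (-(((1 : ℕ) : ℚ) / (2 * (2 ^ (m + 1) - 1) : ℕ))) (t + 3) 2,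
   truncGate Γ Γ 0 (t + 4) (t + 5)]

/-- The extraction of the digits of the coordinate `i`, at the variable `D`. -/
def extraction (m : ℕ) (Γ : ℚ) (D i : ℕ) (e : Bool) : List LinearGate :=
  digitStart m D i e ++ (List.range m).flatMap (fun k => digitStage Γ k (D + 1 + 7 * k)) ++
    digitEnd m Γ (D + 1 + 7 * m)

/-- Copies of the digits of a coordinate, followed by the last digit `e`. -/
def copyDigits (m D : ℕ) (e : Bool) : List LinearGate :=
  (List.range m).flatMap (fun k => [truncGate 2 0 (-1 / 2) (D + 4 + 7 * k) 0]) ++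
    [truncGate 0 0 (if e then 3 / 2 else -1 / 2) 0 0]

/-- A Boolean gate as a truncated linear gate, where the variable `j` of the Boolean circuit is the
variable `B + j`. -/
def boolGate (B : ℕ) : BoolGate → LinearGate
  | .not j => truncGate (-2) 0 (3 / 2) (B + j) 0
  | .and j k => truncGate 2 2 (-5 / 2) (B + j) (B + k)

/-- The simulation of a Boolean circuit at the variable `B`, where the digits of the coordinates are
extracted at `D₁` and `D₂`, followed by a copy of the variable `c`. -/
def simulation (m D₁ D₂ : ℕ) (e₁ e₂ : Bool) (B c : ℕ) (gs : List BoolGate) : List LinearGate :=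
  copyDigits m D₁ e₁ ++ copyDigits m D₂ e₂ ++ gs.map (boolGate B) ++ [truncGate 1 0 0 c 0]

/-- Adds the product of `2⁻⁽ⁱ⁺¹⁾`, the Boolean variable `v` and `y` to an accumulator, with a minus
sign if `neg`.  The variable `Y` holds `1 / 2 + y / 4`; the accumulator, with the contents `s`
represented by `1 / 2 + s / 16`, is the variable `c` before and the variable `c + 3` afterwards. -/
def accumulateBit (neg : Bool) (Y i c v : ℕ) : List LinearGate :=
  [truncGate 1 1 (-1) Y v,
   truncGate 1 (-1 / 2) (1 / 2) (c + 1) v,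
   truncGate 1 (if neg then -(1 / 2 ^ (i + 3)) else 1 / 2 ^ (i + 3))
     (if neg then 1 / 2 ^ (i + 4) else -(1 / 2 ^ (i + 4))) c (c + 2)]

/-- Adds the product of `y` and the binary number with the digits at the variables `B + o`, from the
`i`-th digit on, to the accumulator. -/
def accumulate (neg : Bool) (Y B : ℕ) : ℕ → ℕ → List ℕ → List LinearGate
  | _, _, [] => []
  | i, c, o :: os => accumulateBit neg Y i c (B + o) ++ accumulate neg Y B (i + 1) (c + 3) os

/-- The first half of a list. -/
def firstHalf {α : Type} (l : List α) : List α := l.take (l.length / 2)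

/-- The second half of a list. -/
def secondHalf {α : Type} (l : List α) : List α := l.drop (l.length / 2)

/-- Adds the product of `y` and a signed binary number to the accumulator. -/
def accumulateSigned (Y B c : ℕ) (os : List ℕ) : List LinearGate :=
  accumulate false Y B 0 c (firstHalf os) ++
    accumulate true Y B 0 (c + 3 * (firstHalf os).length) (secondHalf os)

/-- The end of a block: the mesa function, from the accumulator `c`, the alarms `v₁`, `v₂` and the
excesses `z₁`, `z₂`, and its maximum with the variable `A`. -/
def combine (A c v₁ z₁ v₂ z₂ : ℕ) : List LinearGate :=
  [truncGate 16 (-16) 0 c 2,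
   truncGate 1 (-1) 0 z₂ z₁,
   truncGate 1 1 0 z₁ (c + 2),
   truncGate 2 2 (-1 / 2) v₁ v₂,
   truncGate 1 1 0 (c + 3) (c + 4),
   truncGate 1 (-1) 0 (c + 1) (c + 5),
   truncGate 1 (-1) 0 (c + 6) A,
   truncGate 1 1 0 A (c + 7)]

/-- The positions of the parts of a block, where `A` is the last variable before the block:
the simulation of the circuit for the values, … -/
def valuePos (m A : ℕ) : ℕ := A + 17 + 14 * m

/-- … the accumulator before the value is added, … -/
def valueAcc (m A gv : ℕ) : ℕ := valuePos m A + (2 * m + 2) + gv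

/-- … the simulation of the circuit for the gradients, … -/
def gradPos (m A gv ov : ℕ) : ℕ := valueAcc m A gv + 3 * ov + 1

/-- … and the accumulator before the gradient is added; `gv`, `ov` and `gg` are the numbers of gates
and outputs of the Boolean circuits. -/
def gradAcc (m A gv ov gg : ℕ) : ℕ := gradPos m A gv ov + (2 * m + 2) + gg

/-- The block for the grid points with the parities `e₁`, `e₂`: the maximum of the variable `A` and
the mesa of the nearest such grid point. -/
def block (m : ℕ) (Γ : ℚ) (CV CG : BoolCircuit) (A : ℕ) (e₁ e₂ : Bool) : List LinearGate :=
  let gv := CV.gates.length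
  let ov := CV.outputs.length
  let gg := CG.gates.length
  let og := CG.outputs.length
  let D₁ := A + 1
  let D₂ := A + 9 + 7 * m
  extraction m Γ D₁ 0 e₁ ++ extraction m Γ D₂ 1 e₂ ++
  simulation m D₁ D₂ e₁ e₂ (valuePos m A) 2 CV.gates ++
  accumulateSigned 3 (valuePos m A) (valueAcc m A gv) CV.outputs ++
  simulation m D₁ D₂ e₁ e₂ (gradPos m A gv ov) (valueAcc m A gv + 3 * ov) CG.gates ++
  accumulateSigned (D₁ + 4 + 7 * m) (gradPos m A gv ov) (gradAcc m A gv ov gg)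
    (firstHalf CG.outputs) ++
  accumulateSigned (D₂ + 4 + 7 * m) (gradPos m A gv ov)
    (gradAcc m A gv ov gg + 3 * (firstHalf CG.outputs).length) (secondHalf CG.outputs) ++
  combine A (gradAcc m A gv ov gg + 3 * og) (D₁ + 1 + 7 * m) (D₁ + 7 + 7 * m) (D₂ + 1 + 7 * m)
    (D₂ + 7 + 7 * m)

/-- The number of gates of a block. -/
def blockLen (m : ℕ) (CV CG : BoolCircuit) : ℕ :=
  gradAcc m 0 CV.gates.length CV.outputs.length CG.gates.length + 3 * CG.outputs.length + 8

/-- The gates of the circuit: the constants `1 / 2`, `3 / 4` and `0` and four blocks. -/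
def mesaGates (m : ℕ) (Γ : ℚ) (CV CG : BoolCircuit) : List LinearGate :=
  [truncGate 0 0 (1 / 2) 0 0, truncGate 0 0 (3 / 4) 0 0, truncGate 0 0 0 0 0] ++
  block m Γ CV CG 4 false false ++
  block m Γ CV CG (4 + blockLen m CV CG) false true ++
  block m Γ CV CG (4 + 2 * blockLen m CV CG) true false ++
  block m Γ CV CG (4 + 3 * blockLen m CV CG) true true

namespace MesaInstance

/-- The length of the description of the data. -/
def descLen (I : MesaInstance) : ℕ := I.encode.length

/-- The bound on the perturbations. -/
def perturbationBound (I : MesaInstance) : ℚ := 1 / 2 ^ (3 * I.descLen + 20)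

/-- The circuit that is constructed. -/
def circuit (I : MesaInstance) : LinearCircuit :=
  ⟨mesaGates (I.n - 1) I.Γ I.valueCircuit I.gradCircuit⟩

end MesaInstance

/-! ### Parsing the input string -/

/-- The states in which the input string is parsed: in one of the nine words of the rational numbers,
or at some place in the description of the first (`c = false`) or the second circuit. -/
inductive ParseState
  | header (i : Fin 9)
  | gateMark (c : Bool)
  | gateMarkEnd (c : Bool)
  | gatesEnd (c : Bool)
  | kind (c : Bool)
  | notEnd (c : Bool)
  | notArg (c : Bool)
  | andEnd (c : Bool)
  | andFst (c : Bool)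
  | andSnd (c : Bool)
  | outMark (c : Bool)
  | outMarkEnd (c : Bool)
  | outArg (c : Bool)
  | outsEnd (c : Bool)
  | done
  deriving Fintype

namespace ParseState

/-- The transitions of the parser.  Pairs of a state and a symbol that do not occur in a description
leave the state unchanged. -/
def next : ParseState → Letter → ParseState
  | header i, none => if h : (i : ℕ) + 1 < 9 then header ⟨i + 1, h⟩ else gateMark false
  | header i, some _ => header i
  | gateMark c, some true => gateMarkEnd c
  | gateMark c, some false => gatesEnd c
  | gateMarkEnd c, none => kind c
  | gatesEnd c, none => outMark c
  | kind c, some false => notEnd c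
  | kind c, some true => andEnd c
  | notEnd c, none => notArg c
  | notArg c, none => gateMark c
  | andEnd c, none => andFst c
  | andFst c, none => andSnd c
  | andSnd c, none => gateMark c
  | outMark c, some true => outMarkEnd c
  | outMark c, some false => outsEnd c
  | outMarkEnd c, none => outArg c
  | outArg c, none => outMark c
  | outsEnd false, none => gateMark true
  | outsEnd true, none => done
  | q, _ => q

variable (out : ParseState → Letter → Str)

/-- What is emitted while a header word is read. -/
def headerOut (i : Fin 9) (w : List Bool) : Str :=
  w.flatMap (fun b => out (header i) (some b)) ++ out (header i) none

/-- What is emitted while a gate is read. -/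
def gateOut (c : Bool) : BoolGate → Str
  | .not j => out (gateMark c) (some true) ++ out (gateMarkEnd c) none ++
      out (kind c) (some false) ++ out (notEnd c) none ++
      (List.replicate j (out (notArg c) (some true))).flatten ++ out (notArg c) none
  | .and j k => out (gateMark c) (some true) ++ out (gateMarkEnd c) none ++
      out (kind c) (some true) ++ out (andEnd c) none ++
      (List.replicate j (out (andFst c) (some true))).flatten ++ out (andFst c) none ++
      (List.replicate k (out (andSnd c) (some true))).flatten ++ out (andSnd c) none

/-- What is emitted while an output is read. -/
def outputOut (c : Bool) (o : ℕ) : Str :=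
  out (outMark c) (some true) ++ out (outMarkEnd c) none ++
    (List.replicate o (out (outArg c) (some true))).flatten ++ out (outArg c) none

/-- What is emitted while a circuit is read. -/
def circuitOut (c : Bool) (C : BoolCircuit) : Str :=
  C.gates.flatMap (gateOut out c) ++ out (gateMark c) (some false) ++ out (gatesEnd c) none ++
    C.outputs.flatMap (outputOut out c) ++ out (outMark c) (some false) ++ out (outsEnd c) none

theorem transduce_header (i : Fin 9) (w : List Bool) (s : Str) :
    transduce next out (header i) (w.map some ++ none :: s) =
      headerOut out i w ++ transduce next out (next (header i) none) s := by
  induction w with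
  | nil => simp [transduce, headerOut]
  | cons b w ih => simpa [transduce, headerOut, next] using ih

theorem transduce_gates (c : Bool) (gs : List BoolGate) (s : Str) :
    transduce next out (gateMark c) (encodeWords (listWords BoolGate.words gs) ++ s) =
      gs.flatMap (gateOut out c) ++ out (gateMark c) (some false) ++ out (gatesEnd c) none ++
        transduce next out (outMark c) s := by
  induction gs with
  | nil => simp [listWords, encodeWords, transduce, next]
  | cons g gs ih =>
    have e : listWords BoolGate.words (g :: gs) =
        [true] :: (g.words ++ listWords BoolGate.words gs) := by simp [listWords]
    rw [e, encodeWords_cons, encodeWords_append]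
    rcases g with j | ⟨j, k⟩
    · simp [BoolGate.words, encodeWords_cons, map_unaryWord, transduce, next, gateOut,
        transduce_unary next out (notArg c) rfl, ih]
    · simp [BoolGate.words, encodeWords_cons, map_unaryWord, transduce, next, gateOut,
        transduce_unary next out (andFst c) rfl, transduce_unary next out (andSnd c) rfl, ih]

theorem transduce_outputs (c : Bool) (os : List ℕ) (s : Str) :
    transduce next out (outMark c) (encodeWords (listWords (fun j => [unaryWord j]) os) ++ s) =
      os.flatMap (outputOut out c) ++ out (outMark c) (some false) ++ out (outsEnd c) none ++
        transduce next out (if c then done else gateMark true) s := by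
  induction os with
  | nil => cases c <;> simp [listWords, encodeWords, transduce, next]
  | cons o os ih =>
    have e : listWords (fun j => [unaryWord j]) (o :: os) =
        [true] :: ([unaryWord o] ++ listWords (fun j => [unaryWord j]) os) := by simp [listWords]
    rw [e, encodeWords_cons, encodeWords_append]
    simp [encodeWords_cons, map_unaryWord, transduce, next, outputOut,
      transduce_unary next out (outArg c) rfl, ih]

theorem transduce_circuit (c : Bool) (C : BoolCircuit) (s : Str) :
    transduce next out (gateMark c) (encodeWords C.words ++ s) =
      circuitOut out c C ++ transduce next out (if c then done else gateMark true) s := by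
  rw [BoolCircuit.words, encodeWords_append, List.append_assoc, transduce_gates, transduce_outputs]
  simp [circuitOut]

/-- A transducer that runs along with the parser emits the outputs for the nine header words and the
two circuits. -/
theorem transduce_encode (I : MesaInstance) :
    transduce next out (header 0) I.encode =
      headerOut out 0 [decide (I.tol < 0)] ++ headerOut out 1 I.tol.num.natAbs.bits ++
      headerOut out 2 I.tol.den.bits ++
      headerOut out 3 [decide (I.ℓ < 0)] ++ headerOut out 4 I.ℓ.num.natAbs.bits ++
      headerOut out 5 I.ℓ.den.bits ++
      headerOut out 6 [decide (I.Γ < 0)] ++ headerOut out 7 I.Γ.num.natAbs.bits ++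
      headerOut out 8 I.Γ.den.bits ++
      circuitOut out false I.valueCircuit ++ circuitOut out true I.gradCircuit := by
  have e : I.encode = [decide (I.tol < 0)].map some ++ none :: (I.tol.num.natAbs.bits.map some ++
      none :: (I.tol.den.bits.map some ++ none :: ([decide (I.ℓ < 0)].map some ++
      none :: (I.ℓ.num.natAbs.bits.map some ++ none :: (I.ℓ.den.bits.map some ++
      none :: ([decide (I.Γ < 0)].map some ++ none :: (I.Γ.num.natAbs.bits.map some ++
      none :: (I.Γ.den.bits.map some ++ none :: (encodeWords I.valueCircuit.words ++
      (encodeWords I.gradCircuit.words ++ [])))))))))) := by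
    simp [MesaInstance.encode, ratWords, encodeWords_cons, encodeWords_append]
  rw [e]
  simp only [transduce_header, transduce_circuit, show next (header 0) none = header 1 from rfl,
    show next (header 1) none = header 2 from rfl, show next (header 2) none = header 3 from rfl,
    show next (header 3) none = header 4 from rfl, show next (header 4) none = header 5 from rfl,
    show next (header 5) none = header 6 from rfl, show next (header 6) none = header 7 from rfl,
    show next (header 7) none = header 8 from rfl, show next (header 8) none = gateMark false from rfl]
  simp
  simpa [transduce] using transduce_circuit out true I.gradCircuit []

end ParseState

/-! ### The circuit in polynomial time -/

/-- The description of a gate in the output string. -/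
def gateStr (G : LinearGate) : Str := encodeWords ([true] :: G.words)

theorem encodeOutput_eq (δ : ℚ) (gs : List LinearGate) :
    encodeOutput (δ, ⟨gs⟩) = ratStr δ ++ gs.flatMap gateStr ++ [some false, none] := by
  have : ∀ gs : List LinearGate, encodeWords (listWords LinearGate.words gs) =
      gs.flatMap gateStr ++ [some false, none] := by
    intro gs
    induction gs with
    | nil => rfl
    | cons G gs ih =>
      have e : listWords LinearGate.words (G :: gs) =
          [true] :: G.words ++ listWords LinearGate.words gs := by simp [listWords]
      rw [e, encodeWords_append, ih]
      simp [gateStr]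
  simp [encodeOutput, encodeWords_append, this, ratStr]

theorem gateStr_truncGate (a b c : ℚ) (j k : ℕ) :
    gateStr (truncGate a b c j k) = encodeWords ([true] :: unaryWord 6 :: ratWords 0 ++ ratWords 1) ++
      ratStr a ++ ratStr b ++ ratStr c ++ unary j ++ [none] ++ unary k ++ [none] := by
  simp [gateStr, truncGate, LinearGate.words, encodeWords_append, encodeWords_cons, ratStr,
    map_unaryWord]

/-- The description of the list `l x` of gates can be computed in polynomial time. -/
def FPGates {X : Type} [Registers X] (l : X → List LinearGate) : Prop :=
  FP fun x => (l x).flatMap gateStr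

namespace FPGates

variable {X : Type} [Registers X] {l l' : X → List LinearGate} {a b c : X → ℚ} {i j k : X → ℕ}

theorem nil : FPGates fun _ : X => [] := FP.const []

theorem append (hl : FPGates l) (hl' : FPGates l') : FPGates fun x => l x ++ l' x :=
  (FP.append hl hl').congr fun x => by simp

theorem cons (ha : FPRat a) (hb : FPRat b) (hc : FPRat c) (hj : FPNat j) (hk : FPNat k)
    (hl : FPGates l) : FPGates fun x => truncGate (a x) (b x) (c x) (j x) (k x) :: l x :=
  (((((((((FP.const (encodeWords ([true] :: unaryWord 6 :: ratWords 0 ++ ratWords 1))).append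
    ha).append hb).append hc).append hj).append (FP.const [none])).append hk).append
    (FP.const [none])).append hl).congr fun x => by
      simp only [List.flatMap_cons, gateStr_truncGate]

theorem flatMap_range {F : X → ℕ → List LinearGate} (hi : FPNat i)
    (hF : FPGates fun y : X × Str => F y.1 y.2.length) :
    FPGates fun x => (List.range (i x)).flatMap (F x) :=
  (FPNat.flatMap_range (F := fun x n => (F x n).flatMap gateStr) hi hF).congr fun x => by
    simp [List.flatMap_assoc]

end FPGates

section

variable {X : Type} [Registers X]

theorem fpNat_length_snd : FPNat fun y : X × Str => y.2.length := FP.snd.length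

variable {m A B c i v D t : X → ℕ} {Γ : X → ℚ}

theorem fpGates_digitStage {k : X → ℕ} (hΓ : FPRat Γ) (hk : FPNat k) (ht : FPNat t) :
    FPGates fun x => digitStage (Γ x) (k x) (t x) := by
  have h : ∀ n, FPNat fun x => t x + n := fun n => ht.add (.const n)
  have c := fun q : ℚ => FPRat.const (X := X) q
  have n := fun q : ℕ => FPNat.const (X := X) q
  exact .cons (c _) (c _) (.neg_inv_two_pow hk) (h 1) (n 2) <|
    .cons hΓ (c _) (c _) (h 2) (n 0) <| .cons hΓ (c _) (c _) (h 2) (n 0) <|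
    .cons hΓ (c _) (c _) (h 2) (n 0) <| .cons (c _) (c _) (c _) (h 4) (h 5) <|
    .cons (c _) (c _) (c _) ht (h 6) <|
    .cons (c _) (.neg_inv_two_pow (hk.add (.const 3))) (c _) (h 1) (h 3) .nil

theorem coprime_two_pow_sub_one (a b : ℕ) : Nat.Coprime (2 ^ (a + 1) - 1) (2 ^ b) := by
  apply Nat.Coprime.pow_right
  rw [Nat.coprime_two_right, Nat.odd_iff]
  have := Nat.one_le_two_pow (n := a)
  rw [pow_succ]; omega

theorem two_pow_sub_one_pos (a : ℕ) : 0 < 2 ^ (a + 1) - 1 := by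
  have := Nat.one_le_two_pow (n := a)
  rw [pow_succ]; omega

theorem fpGates_extraction (hm : FPNat m) (hΓ : FPRat Γ) (hD : FPNat D) (i : ℕ) (e : Bool) :
    FPGates fun x => extraction (m x) (Γ x) (D x) i e := by
  have c := fun q : ℚ => FPRat.const (X := X) q
  have n := fun q : ℕ => FPNat.const (X := X) q
  have ht : FPNat fun x => D x + 1 + 7 * m x := (hD.add (n 1)).add (.const_mul 7 hm)
  have h : ∀ k, FPNat fun x => D x + 1 + 7 * m x + k := fun k => ht.add (n k)
  have hm1 := hm.add (n 1)
  have hm3 := hm.add (n 3)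
  have hβ : FPRat fun x => ((2 ^ (m x + 1) : ℕ) : ℚ) / (2 ^ (m x + 1) - 1 : ℕ) :=
    (FPBits.two_pow hm1).div (.two_pow_sub_one hm1) (fun x => two_pow_sub_one_pos _)
      fun x => (coprime_two_pow_sub_one _ _).symm
  have hβ' : FPRat fun x => -(((2 ^ (m x + 1) : ℕ) : ℚ) / (2 ^ (m x + 1) - 1 : ℕ)) :=
    (FPBits.two_pow hm1).neg_div (.two_pow_sub_one hm1) (fun x => by positivity)
      (fun x => two_pow_sub_one_pos _) fun x => (coprime_two_pow_sub_one _ _).symm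
  have hℓ : FPRat fun x => -(((1 : ℕ) : ℚ) / (2 * (2 ^ (m x + 1) - 1) : ℕ)) :=
    (FPBits.const 1).neg_div ((FPBits.two_pow_sub_one hm1).two_mul fun x => two_pow_sub_one_pos _)
      (fun x => one_pos) (fun x => by have := two_pow_sub_one_pos (m x); omega) fun x => by simp
  have he : FPRat fun x => (if e then 0 else 1 / 2 ^ (m x + 3) : ℚ) := by
    cases e
    · exact (FPRat.inv_two_pow hm3).congr fun x => by simp
    · exact (FPRat.const 0).congr fun x => by simp
  refine FPGates.append (.append ?_ (.flatMap_range hm (fpGates_digitStage hΓ.weaken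
    fpNat_length_snd ((hD.weaken.add (.const 1)).add (.const_mul 7 fpNat_length_snd))))) ?_
  · exact .cons ((FPBits.two_pow_sub_one hm1).div (.two_pow hm3) (fun x => by positivity)
      fun x => coprime_two_pow_sub_one _ _) (c _) (c _) (n i) (n 0) <|
      .cons (c _) (c _) (c _) (n 0) (n 0) <| .cons (c _) (c _) he hD (n 0) .nil
  · exact .cons (c _) (c _) (.neg_inv_two_pow hm3) (h 1) (n 0) <|
      .cons hβ hβ' (c _) (h 2) (n 2) <| .cons (c _) (c _) hℓ (h 3) (n 2) <|
      .cons (c _) (c _) hℓ (h 3) (n 2) <| .cons hΓ hΓ (c _) (h 4) (h 5) .nil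

theorem fpGates_copyDigits (hm : FPNat m) (hD : FPNat D) (e : Bool) :
    FPGates fun x => copyDigits (m x) (D x) e :=
  .append (.flatMap_range hm (.cons (.const _) (.const _) (.const _) ((hD.weaken.add
    (.const 4)).add (.const_mul 7 fpNat_length_snd)) (.const 0) .nil))
    (.cons (.const _) (.const _) (.const _) (.const 0) (.const 0) .nil)

theorem fpGates_accumulate (neg : Bool) (hY : FPNat i) (hB : FPNat B) (hc : FPNat c)
    {os : X → List ℕ} (ho : FP fun x => outStr (os x)) :
    FPGates fun x => accumulate neg (i x) (B x) 0 (c x) (os x) := by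
  have hn : FPNat fun y : X × Str => y.2.count none := .sumCount .snd
  have hw : FPNat fun y : X × Str => (y.2.takeWhile (· = some true)).length :=
    FP.length (.takeWhile_true .snd)
  have hbit : FPGates fun y : X × Str => accumulateBit neg (i y.1) (y.2.count none)
      (c y.1 + 3 * y.2.count none) (B y.1 + (y.2.takeWhile (· = some true)).length) := by
    have hc' : FPNat fun y : X × Str => c y.1 + 3 * y.2.count none :=
      hc.weaken.add (.const_mul 3 hn)
    have hv := hB.weaken.add hw
    have r := fun q : ℚ => FPRat.const (X := X × Str) q
    refine .cons (r _) (r _) (r _) hY.weaken hv <| .cons (r _) (r _) (r _) (hc'.add (.const 1)) hv <|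
      .cons (r _) ?_ ?_ hc' (hc'.add (.const 2)) .nil
    · cases neg
      · exact (FPRat.inv_two_pow (hn.add (.const 3))).congr fun x => by simp
      · exact (FPRat.neg_inv_two_pow (hn.add (.const 3))).congr fun x => by simp
    · cases neg
      · exact (FPRat.neg_inv_two_pow (hn.add (.const 4))).congr fun x => by simp
      · exact (FPRat.inv_two_pow (hn.add (.const 4))).congr fun x => by simp
  -- at the end mark of a word, its index is the number of end marks read before, and the word
  -- itself consists of the symbols since the last one
  refine (FP.scan () (fun _ _ => ()) (body := fun _ a x pre => if a = none then
    (accumulateBit neg (i x) (pre.count none) (c x + 3 * pre.count none)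
      (B x + (pre.takeWhile (· = some true)).length)).flatMap gateStr else []) ho fun _ a => ?_).congr
    fun x => ?_
  · rcases a with _ | a
    · exact FP.congr hbit fun x => by simp
    · exact (FP.const []).congr fun x => by simp
  · have key : ∀ (l : List ℕ) (pre : Str), pre.head? ≠ some (some true) →
        scan (fun _ _ => ()) (fun _ a pre => if a = none then
          (accumulateBit neg (i x) (pre.count none) (c x + 3 * pre.count none)
            (B x + (pre.takeWhile (· = some true)).length)).flatMap gateStr else []) () pre
          (outStr l) = (accumulate neg (i x) (B x) (pre.count none)
            (c x + 3 * pre.count none) l).flatMap gateStr := by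
      intro l
      induction l with
      | nil => intro pre _; simp [scan, accumulate]
      | cons o l ih =>
        intro pre hpre
        have h1 : (unary o ++ pre).takeWhile (· = some true) = unary o := by
          rw [List.takeWhile_append_of_pos (by simp [unary])]
          rcases pre with _ | ⟨a, pre⟩
          · simp
          · simp at hpre; simp [hpre]
        have h2 : c x + 3 * pre.count none + 3 = c x + 3 * (pre.count none + 1) := by ring
        rw [outStr_cons, scan_unary _ _ _ rfl, scan, ih _ (by simp)]
        simp [accumulate, h1, h2, List.flatMap, List.map_const']
    simpa using key (os x) [] (by simp)

theorem fp_firstHalf {os : X → List ℕ} (ho : FP fun x => outStr (os x)) :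
    FP fun x => outStr (firstHalf (os x)) := ho.takeWords ho.half

theorem fp_secondHalf {os : X → List ℕ} (ho : FP fun x => outStr (os x)) :
    FP fun x => outStr (secondHalf (os x)) := ho.dropWords ho.half

theorem fpNat_length {os : X → List ℕ} (ho : FP fun x => outStr (os x)) :
    FPNat fun x => (os x).length :=
  (FPNat.sumCount ho).congr fun _ => count_outStr _

theorem fpGates_accumulateSigned (hY : FPNat i) (hB : FPNat B) (hc : FPNat c)
    {os : X → List ℕ} (ho : FP fun x => outStr (os x)) :
    FPGates fun x => accumulateSigned (i x) (B x) (c x) (os x) :=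
  (fpGates_accumulate false hY hB hc (fp_firstHalf ho)).append
    (fpGates_accumulate true hY hB (hc.add (.const_mul 3 (fpNat_length (fp_firstHalf ho))))
      (fp_secondHalf ho))

end

instance : Registers {I : MesaInstance // I.Valid} := ⟨fun I => [I.1.encode]⟩

/-- The input data. -/
abbrev Input := {I : MesaInstance // I.Valid}

theorem fp_parse {out : ParseState → Letter → Input → Str} (ho : ∀ q a, FP (out q a)) :
    FP fun I : Input => transduce ParseState.next (fun q a => out q a I) (.header 0) I.1.encode :=
  FP.transduce _ _ (FP.of_head fun _ => rfl) ho

theorem den_sideLength (I : Input) : I.1.ℓ.den = 2 ^ I.1.n - 1 := by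
  obtain ⟨I, hI⟩ := I
  obtain ⟨m, hm⟩ : ∃ m, I.n = m + 1 := ⟨I.n - 1, by have := hI.n_pos; omega⟩
  have h1 := two_pow_sub_one_pos m
  have h2 : I.ℓ = ((1 : ℕ) : ℚ) / ((2 ^ I.n - 1 : ℕ) : ℚ) := by
    simp [MesaInstance.ℓ, Nat.one_le_two_pow]
  have := Rat.den_div_eq_of_coprime (a := (1 : ℕ)) (b := (2 ^ I.n - 1 : ℕ))
    (by rw [hm]; exact_mod_cast h1) (by simp)
  rw [h2]
  simpa only [Int.cast_natCast, Nat.cast_inj] using this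

theorem flatMap_nil_fun {α β : Type} (l : List α) : l.flatMap (fun _ => ([] : List β)) = [] := by
  simp

theorem ParseState.circuitOut_eq {out : ParseState → Letter → Str} {c : Bool} {F : BoolGate → Str}
    {H : ℕ → Str} (hF : ∀ g, gateOut out c g = F g) (hH : ∀ o, outputOut out c o = H o)
    (h₁ : out (gateMark c) (some false) = []) (h₂ : out (gatesEnd c) none = [])
    (h₃ : out (outMark c) (some false) = []) (h₄ : out (outsEnd c) none = []) (C : BoolCircuit) :
    circuitOut out c C = C.gates.flatMap F ++ C.outputs.flatMap H := by
  have e : gateOut out c = F := funext hF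
  have e' : outputOut out c = H := funext hH
  simp [circuitOut, e, e', h₁, h₂, h₃, h₄]

/-- Only the words of the rational numbers contribute. -/
theorem fp_header {out : Fin 9 → Letter → Str} : FP fun I : Input =>
    let out' : ParseState → Letter → Str := fun q a => match q with
      | .header i => out i a
      | _ => []
    ParseState.headerOut out' 0 [decide (I.1.tol < 0)] ++
      ParseState.headerOut out' 1 I.1.tol.num.natAbs.bits ++
      ParseState.headerOut out' 2 I.1.tol.den.bits ++
      ParseState.headerOut out' 3 [decide (I.1.ℓ < 0)] ++
      ParseState.headerOut out' 4 I.1.ℓ.num.natAbs.bits ++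
      ParseState.headerOut out' 5 I.1.ℓ.den.bits ++
      ParseState.headerOut out' 6 [decide (I.1.Γ < 0)] ++
      ParseState.headerOut out' 7 I.1.Γ.num.natAbs.bits ++
      ParseState.headerOut out' 8 I.1.Γ.den.bits := by
  refine (fp_parse (out := fun q a _ => match q with
    | .header i => out i a
    | _ => []) fun q a => FP.const _).congr fun I => ?_
  rw [ParseState.transduce_encode,
    ParseState.circuitOut_eq (F := fun _ => []) (H := fun _ => []) (by
      rintro (_ | _) <;> simp [ParseState.gateOut]) (by simp [ParseState.outputOut]) rfl rfl rfl rfl,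
    ParseState.circuitOut_eq (F := fun _ => []) (H := fun _ => []) (by
      rintro (_ | _) <;> simp [ParseState.gateOut]) (by simp [ParseState.outputOut]) rfl rfl rfl rfl]
  simp only [flatMap_nil_fun, List.append_nil]

/-- The number `n` is read off the denominator `2 ^ n - 1` of `ℓ`, which consists of `n` binary
digits `1`. -/
theorem fpNat_n : FPNat fun I : Input => I.1.n := by
  refine (fp_header (out := fun i a => if i = 5 ∧ a ≠ none then [some true] else [])).congr
    fun I => ?_
  simp [ParseState.headerOut, den_sideLength, bits_two_pow_sub_one, unary, List.flatMap,
    List.map_const', List.flatten_replicate_singleton]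

theorem fpRat_slope : FPRat fun I : Input => I.1.Γ := by
  refine (fp_header (out := fun i a => if 6 ≤ i then [a] else [])).congr fun I => ?_
  have e : ∀ l : List Bool, l.flatMap (fun b => [some b]) = l.map some :=
    fun l => List.map_eq_flatMap.symm
  simp [ParseState.headerOut, ratStr_eq, bitsStr, flatMap_nil_fun, e]

/-- The first (`c = false`) or second circuit of the data. -/
def Input.circuit (I : Input) (c : Bool) : BoolCircuit :=
  if c then I.1.gradCircuit else I.1.valueCircuit

/-- Only one of the circuits contributes. -/
theorem fp_circuit (c : Bool) {out : ParseState → Letter → Input → Str} {F : Input → BoolGate → Str}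
    {H : Input → ℕ → Str} (ho : ∀ q a, FP (out q a))
    (hh : ∀ i a I, out (.header i) a I = [])
    (hF : ∀ I g c', ParseState.gateOut (fun q a => out q a I) c' g = if c' = c then F I g else [])
    (hH : ∀ I o c', ParseState.outputOut (fun q a => out q a I) c' o = if c' = c then H I o else [])
    (h₁ : ∀ I c', out (.gateMark c') (some false) I = []) (h₂ : ∀ I c', out (.gatesEnd c') none I = [])
    (h₃ : ∀ I c', out (.outMark c') (some false) I = []) (h₄ : ∀ I c', out (.outsEnd c') none I = []) :
    FP fun I : Input => (I.circuit c).gates.flatMap (F I) ++ (I.circuit c).outputs.flatMap (H I) := by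
  refine (fp_parse ho).congr fun I => ?_
  have e : ∀ i w, ParseState.headerOut (fun q a => out q a I) i w = [] := by
    simp [ParseState.headerOut, hh]
  rw [ParseState.transduce_encode,
    ParseState.circuitOut_eq (fun g => hF I g false) (fun o => hH I o false) (h₁ I _) (h₂ I _)
      (h₃ I _) (h₄ I _),
    ParseState.circuitOut_eq (fun g => hF I g true) (fun o => hH I o true) (h₁ I _) (h₂ I _)
      (h₃ I _) (h₄ I _)]
  cases c <;> simp [e, Input.circuit, flatMap_nil_fun]

theorem fpNat_gates (c : Bool) : FPNat fun I : Input => (I.circuit c).gates.length := by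
  refine (fp_circuit c (out := fun q a _ => match q with
    | .gateMark c' => if c' = c ∧ a = some true then [some true] else []
    | _ => []) (F := fun _ _ => [some true]) (H := fun _ _ => []) (fun _ _ => FP.const _) (by simp)
    ?_ (by simp [ParseState.outputOut]) (by simp) (by simp) (by simp) (by simp)).congr fun I => ?_
  · rintro I (_ | _) c' <;> simp [ParseState.gateOut]
  · simp [unary, List.flatMap, List.map_const', List.flatten_replicate_singleton]

theorem fp_outputs (c : Bool) : FP fun I : Input => outStr (I.circuit c).outputs := by
  refine (fp_circuit c (out := fun q a _ => match q with
    | .outArg c' => if c' = c then [a] else []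
    | _ => []) (F := fun _ _ => []) (H := fun _ o => unary o ++ [none]) (fun _ _ => FP.const _)
    (by simp) ?_ ?_ (by simp) (by simp) (by simp) (by simp)).congr fun I => ?_
  · rintro I (_ | _) c' <;> simp [ParseState.gateOut]
  · intro I o c'
    by_cases h : c' = c <;> simp [ParseState.outputOut, h, unary, List.flatten_replicate_singleton]
  · simp [outStr]

theorem fpGates_boolGates (c : Bool) {B : Input → ℕ} (hB : FPNat B) :
    FPGates fun I : Input => (I.circuit c).gates.map (boolGate (B I)) := by
  -- The constant part of the description of the gate for a Boolean gate.
  let pre : ℚ → ℚ → ℚ → Str := fun p q r =>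
    encodeWords ([true] :: unaryWord 6 :: ratWords 0 ++ ratWords 1) ++ ratStr p ++ ratStr q ++ ratStr r
  refine (fp_circuit c (out := fun q a I => match q with
    | .kind c' => if c' = c then
        (if a = some false then pre (-2) 0 (3 / 2) else pre 2 2 (-5 / 2)) ++ unary (B I) else []
    | .notArg c' => if c' = c then (if a = none then [none, none] else [a]) else []
    | .andFst c' => if c' = c then (if a = none then none :: unary (B I) else [a]) else []
    | .andSnd c' => if c' = c then [a] else []
    | _ => []) (F := fun I g => gateStr (boolGate (B I) g)) (H := fun _ _ => []) ?_
    (by simp) ?_ (by simp [ParseState.outputOut]) (by simp) (by simp) (by simp) (by simp)).congr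
    fun I => ?_
  · rintro (_ | _ | _ | _ | c' | _ | c' | _ | c' | c' | _ | _ | _ | _ | _) a
    case kind =>
      by_cases h : c' = c
      · simpa [h] using (FP.const _).append hB
      · simpa [h] using FP.const []
    case andFst =>
      by_cases h : c' = c
      · by_cases ha : a = none
        · simpa [h, ha] using (FP.const [none]).append hB
        · simpa [h, ha] using FP.const [a]
      · simpa [h] using FP.const []
    all_goals exact FP.const _
  · rintro I (j | ⟨j, k⟩) c' <;> by_cases h : c' = c
    · simp [ParseState.gateOut, h, boolGate, gateStr_truncGate, pre, unary,
        List.flatten_replicate_singleton]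
    · simp [ParseState.gateOut, h]
    · simp [ParseState.gateOut, h, boolGate, gateStr_truncGate, pre, unary,
        List.flatten_replicate_singleton]
    · simp [ParseState.gateOut, h]
  · simp [List.flatMap_map]

section

variable {D₁ D₂ B A c : Input → ℕ}

theorem fpNat_m : FPNat fun I : Input => I.1.n - 1 := fpNat_n.sub (.const 1)

theorem fpGates_simulation (h₁ : FPNat D₁) (h₂ : FPNat D₂) (e₁ e₂ : Bool) (hB : FPNat B)
    (hc : FPNat c) (b : Bool) :
    FPGates fun I : Input =>
      simulation (I.1.n - 1) (D₁ I) (D₂ I) e₁ e₂ (B I) (c I) (I.circuit b).gates :=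
  (((fpGates_copyDigits fpNat_m h₁ e₁).append (fpGates_copyDigits fpNat_m h₂ e₂)).append
    (fpGates_boolGates b hB)).append
    (.cons (.const _) (.const _) (.const _) hc (.const 0) .nil)

theorem fpGates_combine {v₁ z₁ v₂ z₂ : Input → ℕ} (hA : FPNat A) (hc : FPNat c) (hv₁ : FPNat v₁)
    (hz₁ : FPNat z₁) (hv₂ : FPNat v₂) (hz₂ : FPNat z₂) :
    FPGates fun I : Input => combine (A I) (c I) (v₁ I) (z₁ I) (v₂ I) (z₂ I) := by
  have r := fun q : ℚ => FPRat.const (X := Input) q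
  have h := fun k : ℕ => hc.add (FPNat.const k)
  exact .cons (r _) (r _) (r _) hc (.const 2) <| .cons (r _) (r _) (r _) hz₂ hz₁ <|
    .cons (r _) (r _) (r _) hz₁ (h 2) <| .cons (r _) (r _) (r _) hv₁ hv₂ <|
    .cons (r _) (r _) (r _) (h 3) (h 4) <| .cons (r _) (r _) (r _) (h 1) (h 5) <|
    .cons (r _) (r _) (r _) (h 6) hA <| .cons (r _) (r _) (r _) hA (h 7) .nil

theorem fpNat_valueAcc (hA : FPNat A) : FPNat fun I : Input =>
    valueAcc (I.1.n - 1) (A I) I.1.valueCircuit.gates.length :=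
  (((hA.add (.const 17)).add (.const_mul 14 fpNat_m)).add ((FPNat.const_mul 2 fpNat_m).add
    (.const 2))).add (fpNat_gates false)

theorem fpNat_gradPos (hA : FPNat A) : FPNat fun I : Input =>
    gradPos (I.1.n - 1) (A I) I.1.valueCircuit.gates.length I.1.valueCircuit.outputs.length :=
  ((fpNat_valueAcc hA).add (.const_mul 3 (fpNat_length (fp_outputs false)))).add (.const 1)

theorem fpNat_gradAcc (hA : FPNat A) : FPNat fun I : Input =>
    gradAcc (I.1.n - 1) (A I) I.1.valueCircuit.gates.length I.1.valueCircuit.outputs.length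
      I.1.gradCircuit.gates.length :=
  ((fpNat_gradPos hA).add ((FPNat.const_mul 2 fpNat_m).add (.const 2))).add (fpNat_gates true)

theorem fpGates_block (hA : FPNat A) (e₁ e₂ : Bool) : FPGates fun I : Input =>
    block (I.1.n - 1) I.1.Γ I.1.valueCircuit I.1.gradCircuit (A I) e₁ e₂ := by
  have hm := fpNat_m
  have h7 : FPNat fun I : Input => 7 * (I.1.n - 1) := .const_mul 7 hm
  have hD₁ : FPNat fun I : Input => A I + 1 := hA.add (.const 1)
  have hD₂ : FPNat fun I : Input => A I + 9 + 7 * (I.1.n - 1) := (hA.add (.const 9)).add h7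
  have h₁ := fun k : ℕ => (hD₁.add (.const k)).add h7
  have h₂ := fun k : ℕ => (hD₂.add (.const k)).add h7
  have hB : FPNat fun I : Input => valuePos (I.1.n - 1) (A I) :=
    (hA.add (.const 17)).add (.const_mul 14 hm)
  have hov : FPNat fun I : Input => 3 * I.1.valueCircuit.outputs.length :=
    .const_mul 3 (fpNat_length (fp_outputs false))
  have hog : FPNat fun I : Input => 3 * I.1.gradCircuit.outputs.length :=
    .const_mul 3 (fpNat_length (fp_outputs true))
  have hof : FPNat fun I : Input => 3 * (firstHalf I.1.gradCircuit.outputs).length :=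
    .const_mul 3 (fpNat_length (fp_firstHalf (fp_outputs true)))
  exact ((((((FPGates.append (fpGates_extraction hm fpRat_slope hD₁ 0 e₁)
    (fpGates_extraction hm fpRat_slope hD₂ 1 e₂)).append
    (fpGates_simulation hD₁ hD₂ e₁ e₂ hB (.const 2) false)).append
    (fpGates_accumulateSigned (.const 3) hB (fpNat_valueAcc hA) (fp_outputs false))).append
    (fpGates_simulation hD₁ hD₂ e₁ e₂ (fpNat_gradPos hA) ((fpNat_valueAcc hA).add hov) true)).append
    (fpGates_accumulateSigned (h₁ 4) (fpNat_gradPos hA) (fpNat_gradAcc hA)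
      (fp_firstHalf (fp_outputs true)))).append
    (fpGates_accumulateSigned (h₂ 4) (fpNat_gradPos hA) ((fpNat_gradAcc hA).add hof)
      (fp_secondHalf (fp_outputs true)))).append
    (fpGates_combine hA ((fpNat_gradAcc hA).add hog) (h₁ 1) (h₁ 7) (h₂ 1) (h₂ 7))

end

/-- The construction runs in polynomial time. -/
theorem polyTimeConstruction_circuit :
    PolyTimeConstruction fun I => (I.1.perturbationBound, I.1.circuit) := by
  have hL : FPNat fun I : Input => blockLen (I.1.n - 1) I.1.valueCircuit I.1.gradCircuit :=
    ((fpNat_gradAcc (.const 0)).add (.const_mul 3 (fpNat_length (fp_outputs true)))).add (.const 8)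
  have hg : FPGates fun I : Input =>
      mesaGates (I.1.n - 1) I.1.Γ I.1.valueCircuit I.1.gradCircuit := by
    have r := fun q : ℚ => FPRat.const (X := Input) q
    have n := fun k : ℕ => FPNat.const (X := Input) k
    exact ((((FPGates.cons (r _) (r _) (r _) (n 0) (n 0) <| .cons (r _) (r _) (r _) (n 0) (n 0) <|
      .cons (r _) (r _) (r _) (n 0) (n 0) .nil).append
      (fpGates_block (n 4) false false)).append
      (fpGates_block ((n 4).add hL) false true)).append
      (fpGates_block ((n 4).add (.const_mul 2 hL)) true false)).append
      (fpGates_block ((n 4).add (.const_mul 3 hL)) true true)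
  have hlen : FPNat fun I : Input => I.1.descLen := FP.length (FP.of_head fun _ => rfl)
  have hδ : FPRat fun I : Input => I.1.perturbationBound :=
    .inv_two_pow ((FPNat.const_mul 3 hlen).add (.const 20))
  have h : FP fun I : Input => encodeOutput (I.1.perturbationBound, I.1.circuit) :=
    ((hδ.append hg).append (.const [some false, none])).congr fun I => by
      rw [MesaInstance.circuit, encodeOutput_eq]
  obtain ⟨p, T, ⟨c, hc⟩, hp⟩ := h [0] 1 (by simp)
  refine Prog.polyTime_of_run (p.seq (Prog.clear 0)) ((Polynomial.X + 2) ^ c + 2 * Polynomial.X + 1)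
    fun I => ?_
  obtain ⟨t, ht, hr⟩ := hp I (Function.update (fun _ => []) 0 I.1.encode) (by simp [Registers.regs])
    fun r hr => by rw [Function.update_of_ne (by omega)]
  refine ⟨_, ?_, Prog.Run.seq hr ((Prog.run_clear 0 _).congr ?_)⟩
  · have := ht.trans (hc I)
    simp [regSize, Registers.regs] at this ⊢
    omega
  · funext r
    simp only [Function.update_apply]
    split_ifs <;> first | omega | rfl

/-! ### Evaluation of truncated linear circuits -/

/-- The property `P` holds for all gates of the list, where `P v g` is about the gate `g` that computes
the variable `v`, and the first gate computes the variable `B`. -/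
def Along (P : ℕ → LinearGate → Prop) : ℕ → List LinearGate → Prop
  | _, [] => True
  | B, g :: gs => P B g ∧ Along P (B + 1) gs

section Along

variable {P : ℕ → LinearGate → Prop}

theorem along_append {B : ℕ} {l l' : List LinearGate} :
    Along P B (l ++ l') ↔ Along P B l ∧ Along P (B + l.length) l' := by
  induction l generalizing B with
  | nil => simp [Along]
  | cons g l ih => simp [Along, ih, and_assoc, Nat.add_assoc, Nat.add_comm 1]

theorem length_flatMap_range {F : ℕ → List LinearGate} {L m : ℕ} (hF : ∀ k, (F k).length = L) :
    ((List.range m).flatMap F).length = L * m := by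
  simp [List.length_flatMap, hF, Nat.mul_comm]

theorem along_flatMap_range {B m L : ℕ} {F : ℕ → List LinearGate} (hF : ∀ k, (F k).length = L) :
    Along P B ((List.range m).flatMap F) ↔ ∀ k < m, Along P (B + L * k) (F k) := by
  induction m with
  | zero => simp [Along]
  | succ m ih =>
    rw [List.range_succ, List.flatMap_append, along_append, ih, length_flatMap_range hF]
    simp only [List.flatMap_cons, List.flatMap_nil, List.append_nil]
    constructor
    · rintro ⟨h₁, h₂⟩ k hk
      rcases Nat.lt_succ_iff_lt_or_eq.1 hk with h | rfl
      · exact h₁ k h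
      · exact h₂
    · exact fun h => ⟨fun k hk => h k (by omega), h m (by omega)⟩

theorem Along.get {B : ℕ} {l : List LinearGate} (h : Along P B l) (i : ℕ) (hi : i < l.length) :
    P (B + i) l[i] := by
  induction l generalizing B i with
  | nil => simp at hi
  | cons g l ih =>
    cases i with
    | zero => exact h.1
    | succ i =>
      have := ih h.2 i (by simpa using hi)
      rwa [show B + (i + 1) = B + 1 + i by ring]

end Along

/-- The projection to the unit interval. -/
noncomputable def clamp (t : ℝ) : ℝ := max 0 (min 1 t)

/-- The value `W v` of the variable `v` is the value of the truncation gate `g`, perturbed by `E v`,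
on the values `W` of the variables. -/
def GateHolds (W E : ℕ → ℝ) (v : ℕ) : LinearGate → Prop
  | .trunc lo hi a b c j k => W v = max (lo : ℝ) (min (hi : ℝ) (a * W j + b * W k + c + E v))
  | _ => True

theorem gateHolds_truncGate {W E : ℕ → ℝ} {v : ℕ} {a b c : ℚ} {j k : ℕ} :
    GateHolds W E v (truncGate a b c j k) ↔ W v = clamp (a * W j + b * W k + c + E v) := by
  simp [GateHolds, truncGate, clamp]

theorem wellFormed_of_along {gs : List LinearGate} {k : ℕ}
    (h : Along (fun v g => g.Legal v) k gs) : LinearCircuit.WellFormed ⟨gs⟩ k :=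
  fun i => h.get i i.2

/-- The values of all variables, after the gates with perturbations `gs` on the values `v`. -/
theorem foldl_values (gs : List LinearGate) (es : List ℝ) (hl : es.length = gs.length)
    (htr : ∀ g ∈ gs, g.IsTruncatedLinear) (v : List ℝ)
    (h : Along (fun v g => g.Legal v) v.length gs) :
    ∃ w : List ℝ, (gs.zip es).foldl (fun v Ge => v ++ [Ge.1.eval Ge.2 v]) v = v ++ w ∧
      w.length = gs.length ∧
      Along (GateHolds (fun j => (v ++ w).getD j 0) (fun j => es.getD (j - v.length) 0))
        v.length gs := by
  induction gs generalizing es v with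
  | nil => exact ⟨[], by simp, rfl, trivial⟩
  | cons g gs ih =>
    obtain ⟨e, es, rfl⟩ : ∃ e es', es = e :: es' := by
      cases es with
      | nil => simp at hl
      | cons e es => exact ⟨e, es, rfl⟩
    have h2 : Along (fun v g => g.Legal v) (v ++ [g.eval e v]).length gs := by simpa using h.2
    obtain ⟨w, hw, hlen, hA⟩ := ih es (by simpa using hl) (fun g hg => htr g (by simp [hg]))
      (v ++ [g.eval e v]) h2
    refine ⟨g.eval e v :: w, by simpa using hw, by simp [hlen], ?_, ?_⟩
    · obtain ⟨a, b, c, j, k, rfl⟩ := htr g (by simp)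
      have hL := h.1
      simp only [LinearGate.Legal] at hL
      simp only [GateHolds, List.getD_append _ _ _ _ hL.2.1, List.getD_append _ _ _ _ hL.2.2,
        Nat.sub_self, List.getD_cons_zero]
      rw [List.getD_append_right _ _ _ _ le_rfl, Nat.sub_self, List.getD_cons_zero]
      rfl
    · have e1 : v ++ g.eval e v :: w = v ++ [g.eval e v] ++ w := by simp
      rw [e1]
      have key : ∀ (l : List LinearGate) (B : ℕ), v.length + 1 ≤ B →
          Along (GateHolds (fun j => (v ++ [g.eval e v] ++ w).getD j 0)
            (fun j => es.getD (j - (v ++ [g.eval e v]).length) 0)) B l →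
          Along (GateHolds (fun j => (v ++ [g.eval e v] ++ w).getD j 0)
            (fun j => (e :: es).getD (j - v.length) 0)) B l := by
        intro l
        induction l with
        | nil => intro B _ _; trivial
        | cons g' l ih' =>
          intro B hB hh
          refine ⟨?_, ih' (B + 1) (by omega) hh.2⟩
          have h3 := hh.1
          have h4 : (e :: es).getD (B - v.length) 0 = es.getD (B - (v ++ [g.eval e v]).length) 0 := by
            rw [show B - v.length = (B - (v ++ [g.eval e v]).length) + 1 by simp; omega]
            simp
          cases g' <;> simp only [GateHolds, h4] at h3 ⊢
          exact h3
      exact key gs _ le_rfl (by simpa using hA)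

/-- The output of a perturbed circuit of truncated linear gates is part of a solution `W` of the
equations for all variables, where the perturbations are `E`. -/
theorem exists_values (gs : List LinearGate) (hne : gs ≠ []) (htr : ∀ g ∈ gs, g.IsTruncatedLinear)
    (h : Along (fun v g => g.Legal v) 2 gs) (δ : ℝ) (hδ : 0 ≤ δ)
    (π : Fin (LinearCircuit.size ⟨gs⟩) → ℝ) (hπ : ∀ i, π i ∈ Set.Icc (-δ) δ) :
    ∃ E : ℕ → ℝ, (∀ v, |E v| ≤ δ) ∧ ∀ x : Fin 2 → ℝ, ∃ W : ℕ → ℝ, W 0 = x 0 ∧ W 1 = x 1 ∧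
      Along (GateHolds W E) 2 gs ∧ LinearCircuit.perturbedEval ⟨gs⟩ π x = W (gs.length + 1) := by
  refine ⟨fun j => (List.ofFn π).getD (j - 2) 0, fun v => ?_, fun x => ?_⟩
  · show |(List.ofFn π).getD (v - 2) 0| ≤ δ
    by_cases hv : v - 2 < (List.ofFn π).length
    · rw [List.getD_eq_getElem _ _ hv, List.getElem_ofFn]
      exact abs_le.2 (hπ _)
    · rw [List.getD_eq_default _ _ (by omega)]
      simpa using hδ
  · obtain ⟨w, hw, hlen, hA⟩ := foldl_values gs (List.ofFn π) (List.length_ofFn.trans rfl) htr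
      (List.ofFn x) (by simpa using h)
    rw [List.length_ofFn] at hA
    refine ⟨fun j => (List.ofFn x ++ w).getD j 0, ?_, ?_, hA, ?_⟩
    · simp [List.ofFn_succ]
    · simp [List.ofFn_succ]
    · have hwne : w ≠ [] := by
        rintro rfl
        exact hne (List.length_eq_zero_iff.1 hlen.symm)
      rw [LinearCircuit.perturbedEval, hw]
      have : gs.length + 1 = (List.ofFn x ++ w).length - 1 := by
        simp only [List.length_append, List.length_ofFn, hlen]
        omega
      simp only [this, List.getLastD_eq_getLast?, List.getLast?_eq_getElem?,
        List.getD_eq_getElem?_getD]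

/-! ### The parts of a block -/

theorem length_extraction (m : ℕ) (Γ : ℚ) (D i : ℕ) (e : Bool) :
    (extraction m Γ D i e).length = 7 * m + 8 := by
  rw [extraction, List.length_append, List.length_append, length_flatMap_range (L := 7) fun k => rfl]
  simp [digitStart, digitEnd]
  omega

theorem length_copyDigits (m D : ℕ) (e : Bool) : (copyDigits m D e).length = m + 1 := by
  rw [copyDigits, List.length_append, length_flatMap_range (L := 1) fun k => rfl]
  simp

theorem length_simulation (m D₁ D₂ : ℕ) (e₁ e₂ : Bool) (B c : ℕ) (gs : List BoolGate) :
    (simulation m D₁ D₂ e₁ e₂ B c gs).length = 2 * m + 2 + gs.length + 1 := by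
  simp [simulation, length_copyDigits]
  omega

theorem length_accumulate (neg : Bool) (Y B i c : ℕ) (os : List ℕ) :
    (accumulate neg Y B i c os).length = 3 * os.length := by
  induction os generalizing i c with
  | nil => rfl
  | cons o os ih => simp [accumulate, accumulateBit, ih]; omega

theorem length_halves {α : Type} (l : List α) :
    (firstHalf l).length + (secondHalf l).length = l.length := by
  simp [firstHalf, secondHalf]
  omega

theorem length_accumulateSigned (Y B c : ℕ) (os : List ℕ) :
    (accumulateSigned Y B c os).length = 3 * os.length := by
  have := length_halves os
  simp [accumulateSigned, length_accumulate]
  omega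

theorem length_block (m : ℕ) (Γ : ℚ) (CV CG : BoolCircuit) (A : ℕ) (e₁ e₂ : Bool) :
    (block m Γ CV CG A e₁ e₂).length = blockLen m CV CG := by
  have := length_halves CG.outputs
  simp only [block, List.length_append, length_extraction, length_simulation,
    length_accumulateSigned, combine, List.length_cons, List.length_nil, blockLen, gradAcc, gradPos,
    valueAcc, valuePos]
  omega

/-- The eight parts of a block: two extractions of digits, two simulations of Boolean circuits, three
accumulations, and the final combination. -/
theorem along_block {P : ℕ → LinearGate → Prop} {m : ℕ} {Γ : ℚ} {CV CG : BoolCircuit} {A : ℕ}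
    {e₁ e₂ : Bool} : Along P (A + 1) (block m Γ CV CG A e₁ e₂) ↔
    Along P (A + 1) (extraction m Γ (A + 1) 0 e₁) ∧
    Along P (A + 9 + 7 * m) (extraction m Γ (A + 9 + 7 * m) 1 e₂) ∧
    Along P (valuePos m A) (simulation m (A + 1) (A + 9 + 7 * m) e₁ e₂ (valuePos m A) 2 CV.gates) ∧
    Along P (valueAcc m A CV.gates.length + 1)
      (accumulateSigned 3 (valuePos m A) (valueAcc m A CV.gates.length) CV.outputs) ∧
    Along P (gradPos m A CV.gates.length CV.outputs.length)
      (simulation m (A + 1) (A + 9 + 7 * m) e₁ e₂ (gradPos m A CV.gates.length CV.outputs.length)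
        (valueAcc m A CV.gates.length + 3 * CV.outputs.length) CG.gates) ∧
    Along P (gradAcc m A CV.gates.length CV.outputs.length CG.gates.length + 1)
      (accumulateSigned (A + 1 + 4 + 7 * m) (gradPos m A CV.gates.length CV.outputs.length)
        (gradAcc m A CV.gates.length CV.outputs.length CG.gates.length) (firstHalf CG.outputs)) ∧
    Along P (gradAcc m A CV.gates.length CV.outputs.length CG.gates.length +
        3 * (firstHalf CG.outputs).length + 1)
      (accumulateSigned (A + 9 + 7 * m + 4 + 7 * m)
        (gradPos m A CV.gates.length CV.outputs.length)
        (gradAcc m A CV.gates.length CV.outputs.length CG.gates.length +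
          3 * (firstHalf CG.outputs).length) (secondHalf CG.outputs)) ∧
    Along P (gradAcc m A CV.gates.length CV.outputs.length CG.gates.length +
        3 * CG.outputs.length + 1)
      (combine A (gradAcc m A CV.gates.length CV.outputs.length CG.gates.length +
          3 * CG.outputs.length) (A + 1 + 1 + 7 * m) (A + 1 + 7 + 7 * m) (A + 9 + 7 * m + 1 + 7 * m)
        (A + 9 + 7 * m + 7 + 7 * m)) := by
  have hh := length_halves CG.outputs
  simp only [block, along_append, List.length_append, length_extraction, length_simulation,
    length_accumulateSigned, and_assoc]
  have h1 : A + 1 + (7 * m + 8) = A + 9 + 7 * m := by ring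
  have h2 : A + 1 + (7 * m + 8 + (7 * m + 8)) = valuePos m A := by unfold valuePos; ring
  have h3 : A + 1 + (7 * m + 8 + (7 * m + 8) + (2 * m + 2 + CV.gates.length + 1)) =
    valueAcc m A CV.gates.length + 1 := by unfold valueAcc valuePos; ring
  have h4 : A + 1 + (7 * m + 8 + (7 * m + 8) + (2 * m + 2 + CV.gates.length + 1) +
      3 * CV.outputs.length) = gradPos m A CV.gates.length CV.outputs.length := by
    unfold gradPos valueAcc valuePos; ring
  have h5 : A + 1 + (7 * m + 8 + (7 * m + 8) + (2 * m + 2 + CV.gates.length + 1) +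
      3 * CV.outputs.length + (2 * m + 2 + CG.gates.length + 1)) =
      gradAcc m A CV.gates.length CV.outputs.length CG.gates.length + 1 := by
    unfold gradAcc gradPos valueAcc valuePos; ring
  have h6 : A + 1 + (7 * m + 8 + (7 * m + 8) + (2 * m + 2 + CV.gates.length + 1) +
      3 * CV.outputs.length + (2 * m + 2 + CG.gates.length + 1) +
      3 * (firstHalf CG.outputs).length) =
      gradAcc m A CV.gates.length CV.outputs.length CG.gates.length +
        3 * (firstHalf CG.outputs).length + 1 := by
    unfold gradAcc gradPos valueAcc valuePos; ring
  have h7 : A + 1 + (7 * m + 8 + (7 * m + 8) + (2 * m + 2 + CV.gates.length + 1) +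
      3 * CV.outputs.length + (2 * m + 2 + CG.gates.length + 1) +
      3 * (firstHalf CG.outputs).length + 3 * (secondHalf CG.outputs).length) =
      gradAcc m A CV.gates.length CV.outputs.length CG.gates.length + 3 * CG.outputs.length + 1 := by
    unfold gradAcc gradPos valueAcc valuePos; omega
  rw [h1, h2, h3, h4, h5, h6, h7]

/-! ### Legality of the circuit -/

theorem legal_truncGate {a b c : ℚ} {j k v : ℕ} :
    (truncGate a b c j k).Legal v ↔ j < v ∧ k < v := by
  simp [truncGate, LinearGate.Legal]

theorem legal_extraction {m : ℕ} {Γ : ℚ} {D i : ℕ} {e : Bool} (hD : 3 ≤ D) (hi : i < 3) :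
    Along (fun v g => g.Legal v) D (extraction m Γ D i e) := by
  rw [extraction, along_append, along_append, List.length_append,
    length_flatMap_range (L := 7) fun k => rfl, along_flatMap_range (L := 7) fun k => rfl]
  simp only [digitStart, digitStage, digitEnd, Along, legal_truncGate, List.length_cons,
    List.length_nil, and_true]
  refine ⟨⟨by omega, fun k hk => ?_⟩, by omega⟩
  omega

theorem legal_simulation {m D₁ D₂ : ℕ} {e₁ e₂ : Bool} {B c : ℕ} {C : BoolCircuit}
    (hC : C.WellFormed (2 * (m + 1))) (h₁ : D₁ + 4 + 7 * m ≤ B) (h₂ : D₂ + 4 + 7 * m ≤ B)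
    (hc : c < B) : Along (fun v g => g.Legal v) B (simulation m D₁ D₂ e₁ e₂ B c C.gates) := by
  have key : ∀ (gs : List BoolGate) (i : ℕ), (∀ j (hj : j < gs.length), gs[j].ReadsBelow (i + j)) →
      Along (fun v g => g.Legal v) (B + i) (gs.map (boolGate B)) := by
    intro gs
    induction gs with
    | nil => intro i _; trivial
    | cons g gs ih =>
      intro i h
      refine ⟨?_, ih (i + 1) fun j hj => ?_⟩
      · have := h 0 (by simp)
        cases g <;> simp [BoolGate.ReadsBelow] at this <;> simp [boolGate, legal_truncGate] <;> omega
      · have := h (j + 1) (by simpa using hj)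
        simpa [Nat.add_assoc, Nat.add_comm 1] using this
  have copy : ∀ (D' B' : ℕ) (e : Bool), D' + 4 + 7 * m ≤ B' →
      Along (fun v g => g.Legal v) B' (copyDigits m D' e) := by
    intro D' B' e h
    rw [copyDigits, along_append, along_flatMap_range (L := 1) fun k => rfl]
    simp only [Along, legal_truncGate, and_true]
    exact ⟨fun k hk => by omega, by omega⟩
  rw [simulation, along_append, along_append, along_append]
  simp only [List.length_append, length_copyDigits, List.length_map, Along, legal_truncGate,
    and_true]
  refine ⟨⟨⟨copy _ _ _ h₁, copy _ _ _ (by omega)⟩, ?_⟩, by omega⟩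
  have := key C.gates (2 * (m + 1)) fun j hj => hC.1 ⟨j, hj⟩
  convert this using 1
  ring

theorem legal_accumulate {neg : Bool} {Y B i c : ℕ} {os : List ℕ} (hY : Y ≤ c)
    (ho : ∀ o ∈ os, B + o ≤ c) :
    Along (fun v g => g.Legal v) (c + 1) (accumulate neg Y B i c os) := by
  induction os generalizing i c with
  | nil => trivial
  | cons o os ih =>
    have h1 := ho o (by simp)
    rw [accumulate, along_append]
    refine ⟨?_, ih (c := c + 3) (by omega) fun o ho' => ?_⟩
    · simp only [accumulateBit, Along, legal_truncGate, and_true]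
      omega
    · have := ho o (by simp [ho']); omega

theorem legal_accumulateSigned {Y B c : ℕ} {os : List ℕ} (hY : Y ≤ c)
    (ho : ∀ o ∈ os, B + o ≤ c) :
    Along (fun v g => g.Legal v) (c + 1) (accumulateSigned Y B c os) := by
  rw [accumulateSigned, along_append]
  refine ⟨legal_accumulate hY fun o h => ho o (List.mem_of_mem_take h), ?_⟩
  rw [length_accumulate, show c + 1 + 3 * (firstHalf os).length =
    c + 3 * (firstHalf os).length + 1 by ring]
  exact legal_accumulate (by omega) fun o h => (ho o (List.mem_of_mem_drop h)).trans (by omega)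

theorem legal_block {m : ℕ} {Γ : ℚ} {CV CG : BoolCircuit} {A : ℕ} {e₁ e₂ : Bool}
    (hA : 4 ≤ A) (hV : CV.WellFormed (2 * (m + 1))) (hG : CG.WellFormed (2 * (m + 1))) :
    Along (fun v g => g.Legal v) (A + 1) (block m Γ CV CG A e₁ e₂) := by
  refine along_block.2 ⟨legal_extraction (by omega) (by omega), legal_extraction (by omega) (by omega),
    legal_simulation hV ?_ ?_ ?_, legal_accumulateSigned ?_ fun o ho => ?_,
    legal_simulation hG ?_ ?_ ?_, legal_accumulateSigned ?_ fun o ho => ?_,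
    legal_accumulateSigned ?_ fun o ho => ?_, ?_⟩
  case refine_5 =>
    have := hV.2 o ho
    simp only [valueAcc]
    omega
  case refine_10 =>
    have := hG.2 o (List.mem_of_mem_take ho)
    simp only [gradAcc]
    omega
  case refine_12 =>
    have := hG.2 o (List.mem_of_mem_drop ho)
    simp only [gradAcc]
    omega
  case refine_13 =>
    simp only [combine, Along, legal_truncGate, gradAcc, gradPos, valueAcc, valuePos, and_true]
    omega
  all_goals simp only [gradAcc, gradPos, valueAcc, valuePos]; omega

theorem length_mesaGates (m : ℕ) (Γ : ℚ) (CV CG : BoolCircuit) :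
    (mesaGates m Γ CV CG).length = 3 + 4 * blockLen m CV CG := by
  simp [mesaGates, length_block]
  omega

theorem along_mesaGates {P : ℕ → LinearGate → Prop} {m : ℕ} {Γ : ℚ} {CV CG : BoolCircuit} :
    Along P 2 (mesaGates m Γ CV CG) ↔
    (P 2 (truncGate 0 0 (1 / 2) 0 0) ∧ P 3 (truncGate 0 0 (3 / 4) 0 0) ∧
      P 4 (truncGate 0 0 0 0 0)) ∧
    Along P (4 + 1) (block m Γ CV CG 4 false false) ∧
    Along P (4 + blockLen m CV CG + 1) (block m Γ CV CG (4 + blockLen m CV CG) false true) ∧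
    Along P (4 + 2 * blockLen m CV CG + 1)
      (block m Γ CV CG (4 + 2 * blockLen m CV CG) true false) ∧
    Along P (4 + 3 * blockLen m CV CG + 1)
      (block m Γ CV CG (4 + 3 * blockLen m CV CG) true true) := by
  simp only [mesaGates, along_append, List.length_append, length_block, List.length_cons,
    List.length_nil, Along, and_assoc, and_true]
  have h1 : 2 + (0 + 1 + 1 + 1 + blockLen m CV CG) = 4 + blockLen m CV CG + 1 := by ring
  have h2 : 2 + (0 + 1 + 1 + 1 + blockLen m CV CG + blockLen m CV CG) =
    4 + 2 * blockLen m CV CG + 1 := by ring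
  have h3 : 2 + (0 + 1 + 1 + 1 + blockLen m CV CG + blockLen m CV CG + blockLen m CV CG) =
    4 + 3 * blockLen m CV CG + 1 := by ring
  rw [h1, h2, h3]

theorem isTruncatedLinear_truncGate (a b c : ℚ) (j k : ℕ) :
    (truncGate a b c j k).IsTruncatedLinear :=
  ⟨a, b, c, j, k, rfl⟩

theorem isTruncatedLinear_accumulate (neg : Bool) (Y B i c : ℕ) (os : List ℕ) :
    ∀ g ∈ accumulate neg Y B i c os, g.IsTruncatedLinear := by
  induction os generalizing i c with
  | nil => simp [accumulate]
  | cons o os ih =>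
    simp only [accumulate, accumulateBit, List.forall_mem_append, List.forall_mem_cons,
      isTruncatedLinear_truncGate, true_and]
    exact ⟨by simp, ih _ _⟩

theorem isTruncatedLinear_block (m : ℕ) (Γ : ℚ) (CV CG : BoolCircuit) (A : ℕ) (e₁ e₂ : Bool) :
    ∀ g ∈ block m Γ CV CG A e₁ e₂, g.IsTruncatedLinear := by
  have hb : ∀ B g, (boolGate B g).IsTruncatedLinear := by
    rintro B (_ | _) <;> exact isTruncatedLinear_truncGate _ _ _ _ _
  have hf : ∀ (k : ℕ) (F : ℕ → List LinearGate), (∀ k, ∀ g ∈ F k, g.IsTruncatedLinear) →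
      ∀ g ∈ (List.range k).flatMap F, g.IsTruncatedLinear := by
    intro k F h g hg
    obtain ⟨k, -, hk⟩ := List.mem_flatMap.1 hg
    exact h k g hk
  have he : ∀ D i e, ∀ g ∈ extraction m Γ D i e, g.IsTruncatedLinear := by
    intro D i e
    simp only [extraction, digitStart, digitEnd, List.forall_mem_append, List.forall_mem_cons,
      isTruncatedLinear_truncGate, true_and]
    exact ⟨⟨by simp, hf _ _ fun k => by simp [digitStage, isTruncatedLinear_truncGate]⟩, by simp⟩
  have hc : ∀ D e, ∀ g ∈ copyDigits m D e, g.IsTruncatedLinear := by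
    intro D e
    rw [copyDigits, List.forall_mem_append]
    exact ⟨hf _ _ fun k => by simp [isTruncatedLinear_truncGate],
      by simp [isTruncatedLinear_truncGate]⟩
  have hs : ∀ D₁ D₂ B c gs, ∀ g ∈ simulation m D₁ D₂ e₁ e₂ B c gs, g.IsTruncatedLinear := by
    intro D₁ D₂ B c gs
    simp only [simulation, List.forall_mem_append]
    exact ⟨⟨⟨hc _ _, hc _ _⟩, by simp [hb]⟩, by simp [isTruncatedLinear_truncGate]⟩
  have ha : ∀ Y B c os, ∀ g ∈ accumulateSigned Y B c os, g.IsTruncatedLinear := by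
    intro Y B c os
    rw [accumulateSigned, List.forall_mem_append]
    exact ⟨isTruncatedLinear_accumulate _ _ _ _ _ _, isTruncatedLinear_accumulate _ _ _ _ _ _⟩
  simp only [block, List.forall_mem_append]
  exact ⟨⟨⟨⟨⟨⟨⟨he _ _ _, he _ _ _⟩, hs _ _ _ _ _⟩, ha _ _ _ _⟩, hs _ _ _ _ _⟩, ha _ _ _ _⟩,
    ha _ _ _ _⟩, by simp [combine, isTruncatedLinear_truncGate]⟩

theorem isTruncatedLinear_mesaGates (m : ℕ) (Γ : ℚ) (CV CG : BoolCircuit) :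
    ∀ g ∈ mesaGates m Γ CV CG, g.IsTruncatedLinear := by
  simp only [mesaGates, List.forall_mem_append]
  exact ⟨⟨⟨⟨by simp [isTruncatedLinear_truncGate], isTruncatedLinear_block _ _ _ _ _ _ _⟩,
    isTruncatedLinear_block _ _ _ _ _ _ _⟩, isTruncatedLinear_block _ _ _ _ _ _ _⟩,
    isTruncatedLinear_block _ _ _ _ _ _ _⟩

theorem wellFormed_mesaGates {m : ℕ} {Γ : ℚ} {CV CG : BoolCircuit}
    (hV : CV.WellFormed (2 * (m + 1))) (hG : CG.WellFormed (2 * (m + 1))) :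
    Along (fun v g => g.Legal v) 2 (mesaGates m Γ CV CG) :=
  along_mesaGates.2 ⟨by simp [legal_truncGate], legal_block (by omega) hV hG,
    legal_block (by omega) hV hG, legal_block (by omega) hV hG, legal_block (by omega) hV hG⟩

/-! ### The extraction of digits -/

theorem clamp_of_mem {t : ℝ} (h₀ : 0 ≤ t) (h₁ : t ≤ 1) : clamp t = t := by
  rw [clamp, min_eq_right h₁, max_eq_right h₀]

theorem clamp_of_nonpos {t : ℝ} (h : t ≤ 0) : clamp t = 0 :=
  max_eq_left ((min_le_right _ _).trans h)

theorem clamp_of_one_le {t : ℝ} (h : 1 ≤ t) : clamp t = 1 := by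
  rw [clamp, min_eq_left h, max_eq_right zero_le_one]

theorem clamp_nonneg (t : ℝ) : 0 ≤ clamp t := le_max_left _ _

theorem clamp_le_one (t : ℝ) : clamp t ≤ 1 := max_le zero_le_one (min_le_left _ _)

theorem clamp_mono {s t : ℝ} (h : s ≤ t) : clamp s ≤ clamp t :=
  max_le_max le_rfl (min_le_min le_rfl h)

/-- One stage of the extraction on a remainder `r` with the threshold `θ`: the alarm `V'` is `1`, or
the digit `b` is correct up to the tolerance `1 / Γ`; and no new alarm is raised if the remainder is
not close to the threshold. -/
theorem digitStage_spec {Γ θ r κ κH δ ε R h V d b p q v V' R' e₀ e₁ e₂ e₃ e₄ e₅ e₆ : ℝ}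
    (hR : R = 1 / 2 + r / 4 + κ) (hh : h = 1 / 2 + κH) (hκ : |κ| ≤ ε) (hκH : |κH| ≤ δ)
    (hΓ : 12 ≤ Γ) (hθ : θ ≤ 1 / 2) (hr₀ : 0 ≤ r) (hr₁ : r ≤ 2 * θ + 1 / Γ)
    (hε : Γ * (8 * ε + 9 * δ) ≤ 1 / 100) (hV₀ : 0 ≤ V)
    (he₀ : |e₀| ≤ δ) (he₁ : |e₁| ≤ δ) (he₂ : |e₂| ≤ δ) (he₃ : |e₃| ≤ δ) (he₄ : |e₄| ≤ δ)
    (he₅ : |e₅| ≤ δ) (he₆ : |e₆| ≤ δ)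
    (hd : d = clamp (8 * R + -8 * h + -(2 * θ) + e₀))
    (hb : b = clamp (Γ * d + -3 / 2 + e₁)) (hp : p = clamp (Γ * d + -1 / 4 + e₂))
    (hq : q = clamp (Γ * d + -3 + e₃)) (hv : v = clamp (2 * p + -2 * q + -1 / 2 + e₄))
    (hV' : V' = clamp (2 * V + 2 * v + -1 / 2 + e₅))
    (hR' : R' = clamp (R + -(θ / 4) * b + e₆)) :
    (V' = 1 ∨ b = 0 ∧ r ≤ θ + 1 / Γ ∧ R' = 1 / 2 + r / 4 + (κ + e₆) ∨
      b = 1 ∧ 0 ≤ r - θ ∧ R' = 1 / 2 + (r - θ) / 4 + (κ + e₆)) ∧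
    (V = 0 → 22 / 10 ≤ Γ * |r - θ| → V' = 0) := by
  rw [abs_le] at hκ hκH he₀ he₁ he₂ he₃ he₄ he₅ he₆
  have hΓ0 : 0 < Γ := by linarith
  have hΓi : 1 / Γ ≤ 1 / 12 := one_div_le_one_div_of_le (by norm_num) hΓ
  have hΓi0 : 0 < 1 / Γ := by positivity
  have hδ0 : 0 ≤ δ := by linarith
  have hε0 : 0 ≤ ε := by linarith
  have hsm : 8 * ε + 9 * δ ≤ 1 / 1200 := by
    have := mul_le_mul_of_nonneg_right hΓ (by positivity : 0 ≤ 8 * ε + 9 * δ)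
    linarith
  -- `d` is the truncation of `2 * (r - θ) + η`
  set η : ℝ := 8 * κ - 8 * κH + e₀ with hη
  have hη₁ : |η| ≤ 8 * ε + 9 * δ := by rw [abs_le]; constructor <;> linarith
  have hη₂ : |Γ * η| ≤ 1 / 100 := by
    rw [abs_mul, abs_of_pos hΓ0]
    exact (mul_le_mul_of_nonneg_left hη₁ hΓ0.le).trans hε
  rw [abs_le] at hη₁ hη₂
  have hexp : Γ * (2 * (r - θ) + η) = 2 * (Γ * (r - θ)) + Γ * η := by ring
  have hd' : d = clamp (2 * (r - θ) + η) := by rw [hd, hR, hh, hη]; congr 1; ring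
  have hv0 : 0 ≤ v := hv ▸ clamp_nonneg _
  have hp0 : 0 ≤ p := hp ▸ clamp_nonneg _
  have hp1 : p ≤ 1 := hp ▸ clamp_le_one _
  have hq0 : 0 ≤ q := hq ▸ clamp_nonneg _
  refine ⟨?_, ?_⟩
  · rcases le_or_gt (Γ * d) (3 / 2 - δ) with hG | hG
    · refine .inr (.inl ?_)
      have hb0 : b = 0 := by rw [hb]; exact clamp_of_nonpos (by linarith)
      have hr : r ≤ θ + 1 / Γ := by
        have : Γ * (2 * (r - θ) + η) ≤ 3 / 2 := by
          by_contra! hc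
          have h1 : 0 < 2 * (r - θ) + η := pos_of_mul_pos_right (by linarith) hΓ0.le
          rcases le_or_gt (2 * (r - θ) + η) 1 with h2 | h2
          · rw [hd', clamp_of_mem h1.le h2] at hG; linarith
          · rw [hd', clamp_of_one_le h2.le] at hG; linarith
        have h3 : Γ * (r - θ) ≤ 1 := by linarith
        have h4 : r - θ ≤ 1 / Γ := by rw [le_div_iff₀ hΓ0]; linarith
        linarith
      refine ⟨hb0, hr, ?_⟩
      rw [hR', hb0, hR, clamp_of_mem (by linarith) (by linarith)]
      ring
    · rcases le_or_gt (5 / 2 + δ) (Γ * d) with hG' | hG'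
      · refine .inr (.inr ?_)
        have hb1 : b = 1 := by rw [hb]; exact clamp_of_one_le (by linarith)
        have hr : 0 ≤ r - θ := by
          by_contra! hc
          rcases le_or_gt (2 * (r - θ) + η) 0 with h2 | h2
          · rw [hd', clamp_of_nonpos h2] at hG'
            linarith
          · have := mul_nonpos_of_nonneg_of_nonpos hΓ0.le hc.le
            rw [hd', clamp_of_mem h2.le (by linarith)] at hG'
            linarith
        refine ⟨hb1, hr, ?_⟩
        rw [hR', hb1, hR, clamp_of_mem (by linarith) (by linarith)]
        ring
      · left
        have hp' : p = 1 := by rw [hp]; exact clamp_of_one_le (by linarith)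
        have hq' : q = 0 := by rw [hq]; exact clamp_of_nonpos (by linarith)
        have hv' : v = 1 := by rw [hv, hp', hq']; exact clamp_of_one_le (by linarith)
        rw [hV', hv']
        exact clamp_of_one_le (by linarith)
  · rintro rfl hf
    have hv' : v = 0 := by
      rw [hv]
      refine clamp_of_nonpos ?_
      rcases abs_cases (r - θ) with ⟨h1, h2⟩ | ⟨h1, h2⟩
      · have : 4 + δ ≤ Γ * d := by
          rw [h1] at hf
          rcases le_or_gt (2 * (r - θ) + η) 1 with h3 | h3
          · have h4 : 0 < 2 * (r - θ) + η := pos_of_mul_pos_right (by linarith) hΓ0.le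
            rw [hd', clamp_of_mem h4.le h3]
            linarith
          · rw [hd', clamp_of_one_le h3.le]; linarith
        have hq' : q = 1 := by rw [hq]; exact clamp_of_one_le (by linarith)
        linarith
      · have : d = 0 := by
          rw [hd']
          refine clamp_of_nonpos ?_
          rw [h1] at hf
          by_contra! h3
          have := mul_pos hΓ0 h3
          linarith
        have hp' : p = 0 := by rw [hp, this]; exact clamp_of_nonpos (by linarith)
        linarith
    rw [hV', hv']
    exact clamp_of_nonpos (by linarith)

theorem along_extraction {P : ℕ → LinearGate → Prop} {m : ℕ} {Γ : ℚ} {D i : ℕ} {e : Bool} :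
    Along P D (extraction m Γ D i e) ↔ Along P D (digitStart m D i e) ∧
      (∀ k < m, Along P (D + 3 + 7 * k) (digitStage Γ k (D + 1 + 7 * k))) ∧
      Along P (D + 3 + 7 * m) (digitEnd m Γ (D + 1 + 7 * m)) := by
  rw [extraction, along_append, along_append, List.length_append,
    length_flatMap_range (L := 7) fun k => rfl, along_flatMap_range (L := 7) fun k => rfl, and_assoc,
    show (digitStart m D i e).length = 3 from rfl, ← Nat.add_assoc]

/-- The digits of `u` are extracted one after the other.  After the stage `k`, either the alarm is
raised, or the first `k` digits form a number `q` and the remainder is `u - q / 2 ^ k`, up to an error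
that is independent of `u`.  If `u` is not close to a multiple of `1 / 2 ^ m`, then the alarm is
not raised. -/
theorem digits_spec {m D : ℕ} {Γ : ℚ} {W E : ℕ → ℝ} {δ u κ₀ : ℝ} (hE : ∀ v, |E v| ≤ δ)
    (hΓ : 12 * ((2 : ℝ) ^ (m + 1) - 1) ≤ Γ) (hsmall : Γ * ((m + 10) * δ) ≤ 1 / 2000)
    (hH : W 2 = 1 / 2 + E 2) (hκ₀ : |κ₀| ≤ 2 * δ) (hu₀ : 0 ≤ u) (hu₁ : u ≤ 1)
    (hV : W (D + 1) = 0) (hR : W (D + 2) = 1 / 2 + u / 4 + κ₀)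
    (hW : ∀ k < m, Along (GateHolds W E) (D + 3 + 7 * k) (digitStage Γ k (D + 1 + 7 * k)))
    (k : ℕ) (hk : k ≤ m) :
    (W (D + 1 + 7 * k) = 1 ∨ ∃ q : ℕ, q < 2 ^ k ∧
      (∀ j < k, W (D + 4 + 7 * j) = if q.testBit (k - 1 - j) then 1 else 0) ∧
      W (D + 2 + 7 * k) = 1 / 2 + (u - q / 2 ^ k) / 4 +
        (κ₀ + ∑ j ∈ Finset.range k, E (D + 9 + 7 * j)) ∧
      0 ≤ u - q / 2 ^ k ∧ u - q / 2 ^ k ≤ 1 / 2 ^ k + 1 / Γ) ∧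
    ((∀ j : ℕ, 1 / (4 * 2 ^ (m + 1)) ≤ |u - j / 2 ^ m|) → W (D + 1 + 7 * k) = 0) ∧
    0 ≤ W (D + 1 + 7 * k) := by
  have hδ0 : 0 ≤ δ := (abs_nonneg _).trans (hE 0)
  have hN : (2 : ℝ) ≤ 2 ^ (m + 1) := by
    rw [pow_succ]
    have : (1 : ℝ) ≤ 2 ^ m := one_le_pow₀ (by norm_num)
    linarith
  have hΓ12 : (12 : ℝ) ≤ Γ := by linarith
  have hΓ0 : (0 : ℝ) < Γ := by linarith
  induction k with
  | zero =>
    refine ⟨.inr ⟨0, by simp, by simp, by simpa using hR, by simpa using hu₀, ?_⟩, fun _ => hV,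
      hV.ge⟩
    simpa using hu₁.trans (le_add_of_nonneg_right (by positivity))
  | succ k ih =>
    obtain ⟨ih₁, ih₂, ih₃⟩ := ih (by omega)
    have hs := hW k (by omega)
    obtain ⟨t, ht⟩ : ∃ t, t = D + 1 + 7 * k := ⟨_, rfl⟩
    have t3 : D + 4 + 7 * k = t + 3 := by omega
    have t1 : D + 2 + 7 * k = t + 1 := by omega
    have t7 : D + 1 + 7 * (k + 1) = t + 7 := by omega
    have t8 : D + 2 + 7 * (k + 1) = t + 8 := by omega
    have t8' : D + 9 + 7 * k = t + 8 := by omega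
    rw [show D + 3 + 7 * k = t + 2 by omega, ← ht] at hs
    rw [← ht] at ih₁ ih₂ ih₃
    rw [t1] at ih₁
    rw [t7, t8]
    simp only [digitStage, Along, gateHolds_truncGate, and_true, Nat.add_assoc, Nat.reduceAdd] at hs
    obtain ⟨g0, g1, g2, g3, g4, g5, g6⟩ := hs
    push_cast at g0 g1 g2 g3 g4 g5 g6
    have hθ : (1 : ℝ) / 2 ^ (k + 1) ≤ 1 / 2 := by
      rw [pow_succ]
      exact one_div_le_one_div_of_le (by norm_num) (by linarith [one_le_pow₀ (M₀ := ℝ) (a := 2) (n := k) (by norm_num)])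
    have hθ₂ : (1 : ℝ) / 2 ^ k = 2 * (1 / 2 ^ (k + 1)) := by rw [pow_succ]; field_simp
    have hθ₈ : (1 : ℝ) / 2 ^ (k + 3) = 1 / 2 ^ (k + 1) / 4 := by
      rw [pow_add, pow_add]; field_simp; norm_num
    have hk' : ((k : ℝ) + 1) ≤ m := by exact_mod_cast hk
    have hκ : |κ₀ + ∑ j ∈ Finset.range k, E (D + 9 + 7 * j)| ≤ (m + 2) * δ := by
      have h1 : |∑ j ∈ Finset.range k, E (D + 9 + 7 * j)| ≤ ∑ j ∈ Finset.range k, δ :=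
        (Finset.abs_sum_le_sum_abs _ _).trans (Finset.sum_le_sum fun _ _ => hE _)
      rw [Finset.sum_const, Finset.card_range, nsmul_eq_mul] at h1
      have h2 : (k : ℝ) * δ ≤ m * δ := mul_le_mul_of_nonneg_right (by linarith) hδ0
      linarith [abs_add_le κ₀ (∑ j ∈ Finset.range k, E (D + 9 + 7 * j))]
    have hε : (Γ : ℝ) * (8 * ((m + 2) * δ) + 9 * δ) ≤ 1 / 100 := by
      have : (Γ : ℝ) * (8 * ((m + 2) * δ) + 9 * δ) = 8 * (Γ * ((m + 10) * δ)) - Γ * (55 * δ) := by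
        ring
      have h3 : 0 ≤ (Γ : ℝ) * (55 * δ) := by positivity
      linarith
    have hδ₁ : δ ≤ 1 / 100 := by
      have h1 := mul_le_mul_of_nonneg_right hΓ12 hδ0
      have h2 : 0 ≤ (Γ : ℝ) * (m * δ) := by positivity
      linarith
    rw [hθ₂] at g0
    simp only [zero_mul, add_zero, one_mul, hθ₈] at g1 g2 g3 g6
    rcases ih₁ with hV1 | ⟨q, hq, hdig, hRq, hr₀, hr₁⟩
    · refine ⟨.inl ?_, fun hf => ?_, g5 ▸ clamp_nonneg _⟩
      · have h6 : 0 ≤ W (t + 6) := g4 ▸ clamp_nonneg _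
        rw [g5, hV1]
        exact clamp_of_one_le (by linarith [abs_le.1 (hE (t + 7))])
      · exact absurd (hV1.symm.trans (ih₂ hf)) one_ne_zero
    · obtain ⟨h1, h2⟩ := digitStage_spec (θ := 1 / 2 ^ (k + 1)) hRq hH hκ (hE 2) hΓ12 hθ hr₀
        (by rw [← hθ₂]; exact hr₁) hε ih₃ (hE (t + 2)) (hE (t + 3)) (hE (t + 4)) (hE (t + 5))
        (hE (t + 6)) (hE (t + 7)) (hE (t + 8)) g0 g1 g2 g3 g4 g5 g6
      refine ⟨?_, fun hf => h2 (ih₂ hf) ?_, g5 ▸ clamp_nonneg _⟩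
      · -- the digit `b` is appended to `q`
        have key : ∀ b : ℕ, b ≤ 1 → W (t + 3) = (if b = 1 then 1 else 0) → 
            ∀ j < k + 1, W (D + 4 + 7 * j) =
              if (2 * q + b).testBit (k + 1 - 1 - j) then 1 else 0 := by
          intro b hb hbW j hj
          rcases Nat.lt_succ_iff_lt_or_eq.1 hj with h | rfl
          · rw [hdig j h, show k + 1 - 1 - j = k - 1 - j + 1 by omega, Nat.testBit_succ,
              show (2 * q + b) / 2 = q by omega]
          · rw [t3, hbW, show j + 1 - 1 - j = 0 by omega, Nat.testBit_zero]
            simp only [show (2 * q + b) % 2 = b by omega, decide_eq_true_eq]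
        have hsum : κ₀ + ∑ j ∈ Finset.range (k + 1), E (D + 9 + 7 * j) =
            κ₀ + ∑ j ∈ Finset.range k, E (D + 9 + 7 * j) + E (t + 8) := by
          rw [Finset.sum_range_succ, t8', add_assoc]
        have hu0 : u - (2 * q + 0 : ℕ) / 2 ^ (k + 1) = u - q / 2 ^ k := by
          push_cast; rw [pow_succ]; field_simp; ring
        have hu1 : u - (2 * q + 1 : ℕ) / 2 ^ (k + 1) = u - q / 2 ^ k - 1 / 2 ^ (k + 1) := by
          push_cast; rw [pow_succ]; field_simp; ring
        rcases h1 with h | ⟨hb, hr, hR'⟩ | ⟨hb, hr, hR'⟩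
        · exact .inl h
        · refine .inr ⟨2 * q + 0, by rw [pow_succ]; omega, key 0 (by omega) (by simpa using hb), ?_⟩
          rw [hsum, hu0]
          exact ⟨hR', hr₀, hr⟩
        · refine .inr ⟨2 * q + 1, by rw [pow_succ]; omega, key 1 le_rfl (by simpa using hb), ?_⟩
          rw [hsum, hu1]
          exact ⟨hR', hr, by linarith⟩
      · obtain ⟨l, rfl⟩ : ∃ l, m = k + 1 + l := ⟨m - (k + 1), by omega⟩
        have h4 : (4 : ℝ) ≤ 2 ^ (k + 1 + l + 1) := by
          have : (2 : ℝ) ^ 2 ≤ 2 ^ (k + 1 + l + 1) := pow_le_pow_right₀ (by norm_num) (by omega)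
          linarith
        have h5 := hf ((2 * q + 1) * 2 ^ l)
        have h6 : u - ((2 * q + 1) * 2 ^ l : ℕ) / 2 ^ (k + 1 + l) =
            u - q / 2 ^ k - 1 / 2 ^ (k + 1) := by
          push_cast; rw [pow_add, pow_succ]; field_simp; ring
        rw [h6] at h5
        refine le_trans ?_ (mul_le_mul_of_nonneg_left h5 hΓ0.le)
        rw [mul_one_div, le_div_iff₀ (by positivity)]
        linarith

/-- The displacement of `ξ` from the coordinate `(2 * q + e) * ℓ` of a grid point, for the grid with
`2 ^ (m + 1)` points in each direction. -/
noncomputable def gridOffset (m : ℕ) (e : Bool) (ξ : ℝ) (q : ℕ) : ℝ :=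
  ξ - (2 * q + if e then 1 else 0) / (2 ^ (m + 1) - 1)

/-- The variables of the extraction at `D` describe the position of the coordinate `ξ` relative to the
grid coordinate with the digits of `q` and the last digit `e`.  The numbers `κY`, `κr`, `κl`, `c₀` are
the errors caused by the perturbations. -/
structure Located (m D : ℕ) (e : Bool) (Γ κY κr κl c₀ : ℝ) (W : ℕ → ℝ) (ξ : ℝ) (q : ℕ) : Prop where
  lt : q < 2 ^ m
  digit : ∀ k < m, W (D + 4 + 7 * k) = if q.testBit (m - 1 - k) then 1 else 0
  offset : W (D + 4 + 7 * m) = 1 / 2 + gridOffset m e ξ q / 4 + κY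
  abs_offset_le : |gridOffset m e ξ q| ≤ 6 / 5 * (1 / (2 ^ (m + 1) - 1))
  excess : W (D + 7 + 7 * m) = min 1 (max c₀
    (max (Γ * (gridOffset m e ξ q - 1 / (2 ^ (m + 1) - 1) / 2) + κr)
      (Γ * (-gridOffset m e ξ q - 1 / (2 ^ (m + 1) - 1) / 2) + κl)))

/-- The values of the last gates of an extraction. -/
theorem digitEnd_spec {N Γ a κ κH e₂ e₃ e₄ e₅ e₆ δ R' Y yr yl Z R H : ℝ} (hN : 2 ≤ N)
    (hΓ : 12 * (N - 1) ≤ Γ) (ha : |a| ≤ 7 / 6) (hκ : |κ| ≤ 1 / 1000) (hκH : |κH| ≤ δ)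
    (hδ : δ ≤ 1 / 1000)
    (he₂ : |e₂| ≤ δ) (he₃ : |e₃| ≤ δ) (he₄ : |e₄| ≤ δ) (he₅ : |e₅| ≤ δ)
    (hsmall : (N - 1) * δ ≤ 1 / 1000)
    (hR : R = 1 / 2 + (a + 1) / N / 4 + κ) (hH : H = 1 / 2 + κH)
    (hR' : R' = clamp (R + -(1 / (4 * N)) + e₂))
    (hY : Y = clamp (N / (N - 1) * R' + -(N / (N - 1)) * H + 1 / 2 + e₃))
    (hyr : yr = clamp (4 * Y + -4 * H + -(1 / (2 * (N - 1))) + e₄))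
    (hyl : yl = clamp (-4 * Y + 4 * H + -(1 / (2 * (N - 1))) + e₅))
    (hZ : Z = clamp (Γ * yr + Γ * yl + e₆)) :
    Y = 1 / 2 + a / (N - 1) / 4 + (N / (N - 1) * (κ + e₂ - κH) + e₃) ∧
    Z = min 1 (max (max 0 e₆) (max
      (Γ * (a / (N - 1) - 1 / (N - 1) / 2) +
        (Γ * (4 * (N / (N - 1) * (κ + e₂ - κH) + e₃) - 4 * κH + e₄) + e₆))
      (Γ * (-(a / (N - 1)) - 1 / (N - 1) / 2) +
        (Γ * (-4 * (N / (N - 1) * (κ + e₂ - κH) + e₃) + 4 * κH + e₅) + e₆)))) := by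
  rw [abs_le] at hκ hκH he₂ he₃ he₄ he₅ ha
  have hN1 : 0 < N - 1 := by linarith
  have hN0 : 0 < N := by linarith
  have hΓ0 : 0 < Γ := by linarith
  obtain ⟨β, hβ⟩ : ∃ β, β = N / (N - 1) := ⟨_, rfl⟩
  obtain ⟨ℓ, hℓ⟩ : ∃ ℓ, ℓ = 1 / (N - 1) := ⟨_, rfl⟩
  obtain ⟨y, hy⟩ : ∃ y, y = a / (N - 1) := ⟨_, rfl⟩
  have hβ1 : β = 1 + ℓ := by rw [hβ, hℓ]; field_simp; ring
  have hℓ0 : 0 < ℓ := by rw [hℓ]; positivity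
  have hℓ1 : ℓ ≤ 1 := by rw [hℓ, div_le_one hN1]; linarith
  have hδℓ : δ ≤ ℓ / 1000 := by
    rw [hℓ, div_div, le_div_iff₀ (by positivity)]
    linarith
  have hyℓ : y = a * ℓ := by rw [hy, hℓ]; ring
  have hy1 : |y| ≤ 7 / 6 * ℓ := by
    rw [hyℓ, abs_mul, abs_of_pos hℓ0]
    exact mul_le_mul_of_nonneg_right (abs_le.2 ha) hℓ0.le
  rw [abs_le] at hy1
  rw [← hy, ← hβ, ← hℓ]
  rw [← hβ] at hY
  rw [show 1 / (2 * (N - 1)) = ℓ / 2 by rw [hℓ]; field_simp] at hyr hyl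
  have hβa : β * (a / N) = y := by rw [hβ, hy]; field_simp
  have haN : a / N ≤ 7 / 12 ∧ -(7 / 12) ≤ a / N := by
    rw [div_le_iff₀ hN0, le_div_iff₀ hN0]; constructor <;> linarith
  have hR'' : R' = 1 / 2 + a / N / 4 + (κ + e₂) := by
    have : R + -(1 / (4 * N)) + e₂ = 1 / 2 + a / N / 4 + (κ + e₂) := by
      rw [hR]; field_simp; ring
    rw [hR', this, clamp_of_mem (by linarith) (by linarith)]
  obtain ⟨κY, hκY⟩ : ∃ κY, κY = β * (κ + e₂ - κH) + e₃ := ⟨_, rfl⟩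
  rw [← hκY]
  have hκY' : |κY| ≤ 7 / 1000 := by
    have : |β * (κ + e₂ - κH)| ≤ 2 * (3 / 1000) := by
      rw [abs_mul]
      refine mul_le_mul ?_ ?_ (abs_nonneg _) (by norm_num)
      · rw [abs_le]; constructor <;> linarith
      · rw [abs_le]; constructor <;> linarith
    rw [abs_le] at this ⊢
    constructor <;> linarith
  rw [abs_le] at hκY'
  have hY' : Y = 1 / 2 + y / 4 + κY := by
    have : β * R' + -β * H + 1 / 2 + e₃ = 1 / 2 + y / 4 + κY := by
      rw [hR'', hH, hκY, ← hβa]; ring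
    rw [hY, this, clamp_of_mem (by linarith) (by linarith)]
  refine ⟨hY', ?_⟩
  obtain ⟨κr, hκr⟩ : ∃ κr, κr = 4 * κY - 4 * κH + e₄ := ⟨_, rfl⟩
  obtain ⟨κl, hκl⟩ : ∃ κl, κl = -4 * κY + 4 * κH + e₅ := ⟨_, rfl⟩
  rw [← hκr, ← hκl]
  rw [show 4 * Y + -4 * H + -(ℓ / 2) + e₄ = y - ℓ / 2 + κr by rw [hY', hH, hκr]; ring] at hyr
  rw [show -4 * Y + 4 * H + -(ℓ / 2) + e₅ = -y - ℓ / 2 + κl by rw [hY', hH, hκl]; ring] at hyl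
  -- at most one of the two truncated excesses is positive
  have hsum : yr + yl = max 0 (max (y - ℓ / 2 + κr) (-y - ℓ / 2 + κl)) := by
    rcases le_or_gt (y - ℓ / 2 + κr) 0 with h1 | h1
    · rcases le_or_gt (-y - ℓ / 2 + κl) 0 with h2 | h2
      · rw [hyr, hyl, clamp_of_nonpos h1, clamp_of_nonpos h2, max_eq_left (max_le h1 h2), add_zero]
      · rw [hyr, hyl, clamp_of_nonpos h1, clamp_of_mem h2.le (by linarith),
          max_eq_right (h1.trans h2.le), max_eq_right h2.le, zero_add]
    · have h2 : -y - ℓ / 2 + κl ≤ 0 := by linarith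
      rw [hyr, hyl, clamp_of_nonpos h2, clamp_of_mem h1.le (by linarith),
        max_eq_left (h2.trans h1.le), max_eq_right h1.le, add_zero]
  rw [hZ, show Γ * yr + Γ * yl + e₆ = Γ * (yr + yl) + e₆ by ring, hsum, clamp,
    mul_max_of_nonneg _ _ hΓ0.le, mul_max_of_nonneg _ _ hΓ0.le, mul_zero, ← max_add_add_right,
    ← max_add_add_right, zero_add, max_assoc,
    show Γ * (y - ℓ / 2 + κr) + e₆ = Γ * (y - ℓ / 2) + (Γ * κr + e₆) by ring,
    show Γ * (-y - ℓ / 2 + κl) + e₆ = Γ * (-y - ℓ / 2) + (Γ * κl + e₆) by ring]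
  rw [max_min_distrib_left, max_eq_right zero_le_one]

/-- The extraction locates every coordinate or raises an alarm; no alarm is raised near the grid
coordinates with the given last digit.  The errors depend on the perturbations only. -/
theorem extraction_spec {m D i : ℕ} {e : Bool} {Γ : ℚ} {E : ℕ → ℝ} {δ : ℝ} (hE : ∀ v, |E v| ≤ δ)
    (hΓ : 12 * ((2 : ℝ) ^ (m + 1) - 1) ≤ Γ) (hsmall : Γ * ((m + 10) * δ) ≤ 1 / 2000) :
    ∃ κY κr κl c₀ : ℝ, |κY| ≤ 2 * ((m + 10) * δ) ∧ |κr| ≤ 9 * (Γ * ((m + 10) * δ)) ∧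
      |κl| ≤ 9 * (Γ * ((m + 10) * δ)) ∧ 0 ≤ c₀ ∧ c₀ ≤ δ ∧
      ∀ (W : ℕ → ℝ), W 2 = 1 / 2 + E 2 → 0 ≤ W i → W i ≤ 1 →
        Along (GateHolds W E) D (extraction m Γ D i e) →
        0 ≤ W (D + 1 + 7 * m) ∧
        (W (D + 1 + 7 * m) = 1 ∨ ∃ q, Located m D e Γ κY κr κl c₀ W (W i) q) ∧
        ∀ q < 2 ^ m, |gridOffset m e (W i) q| ≤ 3 / 4 * (1 / (2 ^ (m + 1) - 1)) →
          W (D + 1 + 7 * m) = 0 ∧ Located m D e Γ κY κr κl c₀ W (W i) q := by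
  have hδ0 : 0 ≤ δ := (abs_nonneg _).trans (hE 0)
  have hM1 : (1 : ℝ) ≤ 2 ^ m := one_le_pow₀ (by norm_num)
  obtain ⟨N, hN⟩ : ∃ N : ℝ, N = 2 ^ (m + 1) := ⟨_, rfl⟩
  have hNM : (2 : ℝ) ^ m = N / 2 := by rw [hN, pow_succ]; ring
  have hN3 : (2 : ℝ) ^ (m + 3) = 4 * N := by rw [hN, pow_add, pow_add]; norm_num; ring
  have hN2 : 2 ≤ N := by linarith
  have hN1 : 0 < N - 1 := by linarith
  have hN0 : 0 < N := by linarith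
  have hcast : (((2 ^ (m + 1) - 1 : ℕ) : ℚ) : ℝ) = N - 1 := by
    rw [Rat.cast_natCast, Nat.cast_pred (by positivity), hN]; push_cast; rfl
  rw [← hN] at hΓ
  have hΓ12 : (12 : ℝ) ≤ Γ := by linarith
  have hΓ0 : (0 : ℝ) < Γ := by linarith
  have hmδ : 0 ≤ (m : ℝ) * δ := by positivity
  have hsm : (m + 10) * δ ≤ 1 / 24000 := by
    have := mul_le_mul_of_nonneg_right hΓ12 (by positivity : 0 ≤ (m + 10) * δ)
    linarith
  have hδ1 : δ ≤ 1 / 240000 := by linarith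
  have hNδ : (N - 1) * δ ≤ 1 / 1000 := by
    have h1 := mul_le_mul_of_nonneg_right hΓ hδ0
    have h2 : 0 ≤ (Γ : ℝ) * (m * δ) := by positivity
    linarith
  obtain ⟨κ, hκdef⟩ : ∃ κ, κ = E D + E (D + 2) + ∑ j ∈ Finset.range m, E (D + 9 + 7 * j) := ⟨_, rfl⟩
  have hκ0 : |E D + E (D + 2)| ≤ 2 * δ := by
    linarith [abs_add_le (E D) (E (D + 2)), hE D, hE (D + 2)]
  have hκ : |κ| ≤ (m + 2) * δ := by
    have h1 : |∑ j ∈ Finset.range m, E (D + 9 + 7 * j)| ≤ ∑ j ∈ Finset.range m, δ :=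
      (Finset.abs_sum_le_sum_abs _ _).trans (Finset.sum_le_sum fun _ _ => hE _)
    rw [Finset.sum_const, Finset.card_range, nsmul_eq_mul] at h1
    rw [hκdef]
    linarith [abs_add_le (E D + E (D + 2)) (∑ j ∈ Finset.range m, E (D + 9 + 7 * j))]
  have hEa := fun v => abs_le.1 (hE v)
  obtain ⟨t, ht⟩ : ∃ t, t = D + 1 + 7 * m := ⟨_, rfl⟩
  obtain ⟨κY, hκY⟩ : ∃ κY, κY = N / (N - 1) * (κ + E (t + 2) - E 2) + E (t + 3) := ⟨_, rfl⟩
  have hκYb : |κY| ≤ (2 * m + 9) * δ := by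
    have hβ : N / (N - 1) ≤ 2 := by rw [div_le_iff₀ hN1]; linarith
    have h1 : |κ + E (t + 2) - E 2| ≤ (m + 4) * δ := by
      rw [abs_le] at hκ ⊢
      constructor <;> linarith [hEa (t + 2), hEa 2]
    have h2 : |N / (N - 1) * (κ + E (t + 2) - E 2)| ≤ 2 * ((m + 4) * δ) := by
      rw [abs_mul, abs_of_pos (by positivity : 0 < N / (N - 1))]
      exact mul_le_mul hβ h1 (abs_nonneg _) (by norm_num)
    rw [hκY]
    linarith [abs_add_le (N / (N - 1) * (κ + E (t + 2) - E 2)) (E (t + 3)), hE (t + 3)]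
  have hb : ∀ s v : ℝ, |s| ≤ (8 * m + 41) * δ → |v| ≤ δ →
      |Γ * s + v| ≤ 9 * (Γ * ((m + 10) * δ)) := by
    intro s v hs hv
    have h1 := abs_add_le (Γ * s) v
    rw [abs_mul, abs_of_pos hΓ0] at h1
    have h2 := mul_le_mul_of_nonneg_left hs hΓ0.le
    have h3 := mul_le_mul_of_nonneg_right hΓ12 hδ0
    have h4 : 0 ≤ (Γ : ℝ) * (m * δ) := by positivity
    linarith
  refine ⟨κY, Γ * (4 * κY - 4 * E 2 + E (t + 4)) + E (t + 6),
    Γ * (-4 * κY + 4 * E 2 + E (t + 5)) + E (t + 6), max 0 (E (t + 6)), by linarith, ?_, ?_,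
    le_max_left _ _, max_le hδ0 (hEa _).2, ?_⟩
  · refine hb _ _ ?_ (hE _)
    rw [abs_le] at hκYb ⊢
    constructor <;> linarith [hEa (t + 4), hEa 2]
  · refine hb _ _ ?_ (hE _)
    rw [abs_le] at hκYb ⊢
    constructor <;> linarith [hEa (t + 5), hEa 2]
  intro W hH hξ₀ hξ₁ hW
  obtain ⟨hstart, hstages, hend⟩ := along_extraction.1 hW
  simp only [digitStart, Along, gateHolds_truncGate, and_true, Nat.add_assoc, Nat.reduceAdd] at hstart
  obtain ⟨s0, s1, s2⟩ := hstart
  rw [show D + 3 + 7 * m = t + 2 by omega, ← ht] at hend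
  simp only [digitEnd, Along, gateHolds_truncGate, and_true, Nat.add_assoc, Nat.reduceAdd] at hend
  obtain ⟨g2, g3, g4, g5, g6⟩ := hend
  obtain ⟨ε, hε⟩ : ∃ ε : ℝ, ε = if e then 1 else 0 := ⟨_, rfl⟩
  have hε01 : 0 ≤ ε ∧ ε ≤ 1 := by rw [hε]; split_ifs <;> norm_num
  have c1 : ((((2 ^ (m + 1) - 1 : ℕ) : ℚ) / (2 ^ (m + 3) : ℕ) : ℚ) : ℝ) = (N - 1) / (4 * N) := by
    rw [Rat.cast_div, hcast, Rat.cast_natCast, ← hN3]; push_cast; rfl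
  have c2 : ((((2 ^ (m + 1) : ℕ) : ℚ) / (2 ^ (m + 1) - 1 : ℕ) : ℚ) : ℝ) = N / (N - 1) := by
    rw [Rat.cast_div, hcast, Rat.cast_natCast, hN]; push_cast; rfl
  have c3 : ((((1 : ℕ) : ℚ) / (2 * (2 ^ (m + 1) - 1) : ℕ) : ℚ) : ℝ) = 1 / (2 * (N - 1)) := by
    rw [Rat.cast_div, Nat.cast_mul, Rat.cast_mul, hcast]; push_cast; rfl
  have c4 : ((1 / 2 ^ (m + 3) : ℚ) : ℝ) = 1 / (4 * N) := by rw [← hN3]; push_cast; rfl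
  have c5 : (((if e then 0 else 1 / 2 ^ (m + 3) : ℚ)) : ℝ) = (1 - ε) / (4 * N) := by
    rw [hε]; cases e <;> simp [hN3]
  simp only [Rat.cast_neg, c1, c5] at s0 s1 s2
  simp only [Rat.cast_neg, c2, c3, c4] at g2 g3 g4 g5 g6
  simp only [Rat.cast_zero, Rat.cast_one, Rat.cast_ofNat, Rat.cast_div, zero_mul, one_mul,
    add_zero] at s0 s1 s2 g2 g3 g4 g5 g6
  obtain ⟨ξ, hξ⟩ : ∃ ξ, ξ = W i := ⟨_, rfl⟩
  rw [← hξ] at hξ₀ hξ₁ s0 ⊢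
  obtain ⟨a, ha⟩ : ∃ a : ℕ → ℝ, a = fun q : ℕ => ξ * (N - 1) - (2 * q + ε) := ⟨_, rfl⟩
  have hoff : ∀ q, gridOffset m e ξ q = a q / (N - 1) := by
    intro q
    rw [gridOffset, ← hN, ← hε, ha]
    field_simp
  obtain ⟨u, hu⟩ : ∃ u, u = (ξ * (N - 1) + (1 - ε)) / N := ⟨_, rfl⟩
  have hξN : ξ * (N - 1) ≤ N - 1 := mul_le_of_le_one_left hN1.le hξ₁
  have hξN0 : 0 ≤ ξ * (N - 1) := by positivity
  have hu₀ : 0 ≤ u := by rw [hu]; exact div_nonneg (by linarith) hN0.le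
  have hu₁ : u ≤ 1 := by rw [hu, div_le_one hN0]; linarith
  have hX0 : 0 ≤ ξ * (N - 1) / N := by positivity
  have hX1 : ξ * (N - 1) / N ≤ 1 := by rw [div_le_one hN0]; linarith
  have hD : W D = 1 / 2 + ξ * (N - 1) / N / 4 + E D := by
    have : (N - 1) / (4 * N) * ξ + 1 / 2 + E D = 1 / 2 + ξ * (N - 1) / N / 4 + E D := by
      field_simp; ring
    rw [s0, this, clamp_of_mem (by linarith [hEa D]) (by linarith [hEa D])]
  have hV : W (D + 1) = 0 := by rw [s1]; exact clamp_of_nonpos (by linarith [hEa (D + 1)])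
  have hR : W (D + 2) = 1 / 2 + u / 4 + (E D + E (D + 2)) := by
    have : W D + (1 - ε) / (4 * N) + E (D + 2) = 1 / 2 + u / 4 + (E D + E (D + 2)) := by
      rw [hD, hu]; field_simp; ring
    rw [s2, this, clamp_of_mem (by linarith [hEa D, hEa (D + 2)])
      (by linarith [hEa D, hEa (D + 2)])]
  obtain ⟨h1, h2, h3⟩ := digits_spec hE (by rw [← hN]; exact hΓ) hsmall hH hκ0 hu₀ hu₁ hV hR hstages m le_rfl
  rw [← hκdef, ← ht, hNM] at h1
  rw [← ht, hNM, ← hN] at h2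
  rw [← ht] at h3
  have hua : ∀ q : ℕ, u - q / (N / 2) = (a q + 1) / N := by
    intro q; rw [hu, ha]; field_simp; ring
  have hΓi : 1 / (Γ : ℝ) ≤ 1 / (12 * (N - 1)) := one_div_le_one_div_of_le (by positivity) hΓ
  have hNi : N * (1 / (12 * (N - 1))) ≤ 1 / 6 := by
    rw [mul_one_div, div_le_div_iff₀ (by positivity) (by norm_num)]; linarith
  -- the range of the offset that is implied by the range of the last remainder
  have hrange : ∀ q : ℕ, 0 ≤ u - q / (N / 2) → u - q / (N / 2) ≤ 1 / (N / 2) + 1 / Γ →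
      -1 ≤ a q ∧ a q ≤ 7 / 6 := by
    intro q h h'
    rw [hua] at h h'
    constructor
    · have := mul_nonneg h hN0.le
      rw [div_mul_cancel₀ _ hN0.ne'] at this
      linarith
    · have h4 : (a q + 1) / N ≤ 1 / (N / 2) + 1 / (12 * (N - 1)) := h'.trans (by linarith)
      rw [div_le_iff₀ hN0, add_mul, show 1 / (N / 2) * N = 2 by field_simp] at h4
      linarith
  have hloc : ∀ q : ℕ, q < 2 ^ m →
      (∀ j < m, W (D + 4 + 7 * j) = if q.testBit (m - 1 - j) then 1 else 0) →
      W (D + 2 + 7 * m) = 1 / 2 + (u - q / (N / 2)) / 4 + κ → 0 ≤ u - q / (N / 2) →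
      u - q / (N / 2) ≤ 1 / (N / 2) + 1 / Γ →
      Located m D e Γ κY (Γ * (4 * κY - 4 * E 2 + E (t + 4)) + E (t + 6))
        (Γ * (-4 * κY + 4 * E 2 + E (t + 5)) + E (t + 6)) (max 0 (E (t + 6))) W ξ q := by
    intro q hq hdig hRm hr₀ hr₁
    obtain ⟨ha₀, ha₁⟩ := hrange q hr₀ hr₁
    rw [hua, show D + 2 + 7 * m = t + 1 by omega] at hRm
    obtain ⟨hY, hZ⟩ := digitEnd_spec hN2 hΓ (abs_le.2 ⟨by linarith, ha₁⟩) (hκ.trans (by linarith))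
      (hE 2) (hδ1.trans (by norm_num)) (hE (t + 2)) (hE (t + 3)) (hE (t + 4)) (hE (t + 5)) hNδ hRm
      hH g2 g3 g4 g5 g6
    refine ⟨hq, hdig, ?_, ?_, ?_⟩
    · rw [show D + 4 + 7 * m = t + 3 by omega, hY, hoff, hκY]
    · rw [hoff, ← hN, abs_div, abs_of_pos hN1, mul_one_div]
      exact div_le_div_of_nonneg_right (abs_le.2 ⟨by linarith, by linarith⟩) hN1.le
    · rw [show D + 7 + 7 * m = t + 6 by omega, hZ, hoff, ← hN, hκY]
  rw [← ht]
  refine ⟨h3, h1.imp_right fun ⟨q, hq, hdig, hRm, hr₀, hr₁⟩ => ⟨q, hloc q hq hdig hRm hr₀ hr₁⟩,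
    fun p hp hnear => ?_⟩
  rw [hoff, ← hN, abs_div, abs_of_pos hN1, mul_one_div, div_le_div_iff_of_pos_right hN1] at hnear
  have hne := abs_le.1 hnear
  have hV0 : W t = 0 := by
    refine h2 fun j => ?_
    have : u - j / (N / 2) = (a p + (2 * ((p : ℤ) - (j : ℤ)) + 1 : ℤ)) / N := by
      rw [hua, ha]; push_cast; ring
    rw [this, abs_div, abs_of_pos hN0, div_le_div_iff₀ (by positivity) hN0]
    have h5 : 1 / 4 ≤ |a p + (2 * ((p : ℤ) - (j : ℤ)) + 1 : ℤ)| := by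
      rcases le_or_gt 0 ((p : ℤ) - j) with h | h
      · have : ((1 : ℤ) : ℝ) ≤ (2 * ((p : ℤ) - (j : ℤ)) + 1 : ℤ) := by exact Int.cast_le.2 (by omega)
        push_cast at this ⊢
        exact le_trans (by linarith) (le_abs_self _)
      · have : ((2 * ((p : ℤ) - (j : ℤ)) + 1 : ℤ) : ℝ) ≤ (-1 : ℤ) := by exact Int.cast_le.2 (by omega)
        push_cast at this ⊢
        exact le_trans (by linarith) (neg_le_abs _)
    have := mul_le_mul_of_nonneg_right h5 hN0.le
    linarith
  refine ⟨hV0, ?_⟩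
  rcases h1 with h | ⟨q, hq, hdig, hRm, hr₀, hr₁⟩
  · exact absurd (hV0.symm.trans h) zero_ne_one
  · obtain ⟨h6, h7⟩ := hrange q hr₀ hr₁
    have hpq : p = q := by
      have h8 : a q = a p + 2 * ((p : ℤ) - (q : ℤ) : ℤ) := by rw [ha]; push_cast; ring
      rcases lt_trichotomy p q with h | h | h
      · have : (((p : ℤ) - (q : ℤ) : ℤ) : ℝ) ≤ (-1 : ℤ) := by exact Int.cast_le.2 (by omega)
        push_cast at this h8
        linarith
      · exact h
      · have : ((1 : ℤ) : ℝ) ≤ ((p : ℤ) - (q : ℤ) : ℤ) := by exact Int.cast_le.2 (by omega)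
        push_cast at this h8
        linarith
    rw [hpq]
    exact hloc q hq hdig hRm hr₀ hr₁

/-! ### Boolean gates and accumulators -/

/-- A truth value as a real number. -/
def bitValue (b : Bool) : ℝ := if b then 1 else 0

/-- Truncated linear gates simulate Boolean gates without error: perturbations are truncated away. -/
theorem boolGates_spec {B : ℕ} {W E : ℕ → ℝ} (hE : ∀ v, |E v| ≤ 1 / 2) (gs : List BoolGate)
    (v : List Bool) (hr : ∀ j (hj : j < gs.length), gs[j].ReadsBelow (v.length + j))
    (hv : ∀ j < v.length, W (B + j) = bitValue (v.getD j false))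
    (hA : Along (GateHolds W E) (B + v.length) (gs.map (boolGate B))) :
    ∀ j < v.length + gs.length,
      W (B + j) = bitValue ((gs.foldl (fun v G => v ++ [G.eval v]) v).getD j false) := by
  induction gs generalizing v with
  | nil => simpa using hv
  | cons g gs ih =>
    have hg : W (B + v.length) = bitValue (g.eval v) := by
      have h0 := hA.1
      have h1 := hr 0 (by simp)
      have hEb := abs_le.1 (hE (B + v.length))
      cases g with
      | not j =>
        simp only [boolGate, gateHolds_truncGate] at h0
        rw [h0, hv j (by simpa [BoolGate.ReadsBelow] using h1), BoolGate.eval]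
        push_cast
        cases v.getD j false
        · simp only [bitValue, Bool.not_false, if_true, Bool.false_eq_true, if_false]
          exact clamp_of_one_le (by linarith)
        · simp only [bitValue, Bool.not_true, if_true, Bool.false_eq_true, if_false]
          exact clamp_of_nonpos (by linarith)
      | and j k =>
        simp only [boolGate, gateHolds_truncGate] at h0
        simp only [BoolGate.ReadsBelow, List.getElem_cons_zero, Nat.add_zero] at h1
        rw [h0, hv j h1.1, hv k h1.2, BoolGate.eval]
        push_cast
        cases v.getD j false <;> cases v.getD k false <;>
          simp only [bitValue, Bool.and_true, Bool.and_false, if_true, Bool.false_eq_true, if_false]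
        · exact clamp_of_nonpos (by linarith)
        · exact clamp_of_nonpos (by linarith)
        · exact clamp_of_nonpos (by linarith)
        · exact clamp_of_one_le (by linarith)
    have := ih (v ++ [g.eval v]) (fun j hj => ?_) (fun j hj => ?_) ?_
    · intro j hj
      exact this j (by simpa [Nat.add_assoc, Nat.add_comm 1] using hj)
    · have := hr (j + 1) (by simpa using hj)
      simpa [Nat.add_assoc, Nat.add_comm 1] using this
    · rw [List.length_append, List.length_singleton] at hj
      rcases Nat.lt_succ_iff_lt_or_eq.1 hj with h | rfl
      · rw [hv j h, List.getD_append _ _ _ _ h]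
      · rw [hg, List.getD_append_right _ _ _ _ le_rfl, Nat.sub_self, List.getD_cons_zero]
    · simpa [Nat.add_assoc] using hA.2

theorem getD_bitsMSB {n i k : ℕ} (hk : k < n) :
    (bitsMSB n i).getD k false = i.testBit (n - 1 - k) := by
  rw [List.getD_eq_getElem _ _ (by simpa [bitsMSB] using hk)]
  simp [bitsMSB]

/-- Copies of exact bits are exact, and so the input bits of the Boolean circuits occupy consecutive
variables. -/
theorem copyDigits_spec {m D B q : ℕ} {e : Bool} {W E : ℕ → ℝ} (hE : ∀ v, |E v| ≤ 1 / 2)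
    (hd : ∀ k < m, W (D + 4 + 7 * k) = if q.testBit (m - 1 - k) then 1 else 0)
    (hA : Along (GateHolds W E) B (copyDigits m D e)) :
    ∀ j < m + 1, W (B + j) = bitValue ((bitsMSB (m + 1) (2 * q + e.toNat)).getD j false) := by
  rw [copyDigits, along_append, along_flatMap_range (L := 1) fun k => rfl,
    length_flatMap_range (L := 1) fun k => rfl] at hA
  simp only [Along, gateHolds_truncGate, and_true, one_mul] at hA
  have he : e.toNat ≤ 1 := Bool.toNat_le e
  intro j hj
  rw [getD_bitsMSB hj]
  rcases Nat.lt_succ_iff_lt_or_eq.1 hj with h | rfl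
  · rw [show m + 1 - 1 - j = m - 1 - j + 1 by omega, Nat.testBit_succ,
      show (2 * q + e.toNat) / 2 = q by omega, hA.1 j h, hd j h, bitValue]
    have := abs_le.1 (hE (B + j))
    push_cast
    split_ifs
    · exact clamp_of_one_le (by linarith)
    · exact clamp_of_nonpos (by linarith)
  · rw [hA.2, Nat.add_sub_cancel, Nat.sub_self, Nat.testBit_zero]
    have := abs_le.1 (hE (B + j))
    cases e
    · simp only [bitValue, Bool.toNat_false, add_zero, Nat.mul_mod_right, Bool.false_eq_true,
        if_false, zero_ne_one, decide_false]
      push_cast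
      exact clamp_of_nonpos (by linarith)
    · simp only [bitValue, Bool.toNat_true, if_true, show (2 * q + 1) % 2 = 1 by omega, decide_true]
      push_cast
      exact clamp_of_one_le (by linarith)

theorem length_bitsMSB (n i : ℕ) : (bitsMSB n i).length = n := by simp [bitsMSB]

/-- If the digits are exact, then so are all bits of the Boolean circuit; the last gate copies the
accumulator behind them. -/
theorem simulation_spec {m D₁ D₂ B c q₁ q₂ : ℕ} {e₁ e₂ : Bool} {C : BoolCircuit} {W E : ℕ → ℝ}
    (hE : ∀ v, |E v| ≤ 1 / 2) (hC : C.WellFormed (2 * (m + 1)))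
    (h₁ : ∀ k < m, W (D₁ + 4 + 7 * k) = if q₁.testBit (m - 1 - k) then 1 else 0)
    (h₂ : ∀ k < m, W (D₂ + 4 + 7 * k) = if q₂.testBit (m - 1 - k) then 1 else 0)
    (hA : Along (GateHolds W E) B (simulation m D₁ D₂ e₁ e₂ B c C.gates)) :
    (∀ o ∈ C.outputs, W (B + o) = bitValue ((C.values
      (bitsMSB (m + 1) (2 * q₁ + e₁.toNat) ++ bitsMSB (m + 1) (2 * q₂ + e₂.toNat))).getD o false)) ∧
    W (B + (2 * m + 2) + C.gates.length) = clamp (W c + E (B + (2 * m + 2) + C.gates.length)) := by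
  rw [simulation, along_append, along_append, along_append] at hA
  simp only [List.length_append, length_copyDigits, List.length_map, Along, gateHolds_truncGate,
    and_true] at hA
  obtain ⟨⟨⟨hA₁, hA₂⟩, hA₃⟩, hA₄⟩ := hA
  refine ⟨fun o ho => ?_, ?_⟩
  · have hl : (bitsMSB (m + 1) (2 * q₁ + e₁.toNat) ++
        bitsMSB (m + 1) (2 * q₂ + e₂.toNat)).length = 2 * (m + 1) := by
      rw [List.length_append, length_bitsMSB, length_bitsMSB]; ring
    refine boolGates_spec hE C.gates _ (fun j hj => ?_) (fun j hj => ?_) ?_ o ?_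
    · rw [hl]
      exact hC.1 ⟨j, hj⟩
    · rcases lt_or_ge j (m + 1) with h | h
      · rw [List.getD_append _ _ _ _ (by rwa [length_bitsMSB])]
        exact copyDigits_spec hE h₁ hA₁ j h
      · rw [List.getD_append_right _ _ _ _ (by rwa [length_bitsMSB]), length_bitsMSB,
          ← copyDigits_spec hE h₂ hA₂ (j - (m + 1)) (by omega)]
        congr 1
        omega
    · rw [hl]
      convert hA₃ using 1
      ring
    · rw [hl]
      exact hC.2 o ho
  · rw [show B + (2 * m + 2) + C.gates.length = B + (m + 1 + (m + 1) + C.gates.length) by ring, hA₄]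
    simp

theorem binaryFraction_cons (b : Bool) (bs : List Bool) :
    binaryFraction (b :: bs) = ((if b then 1 else 0) + binaryFraction bs) / 2 := by
  simp only [binaryFraction, List.length_cons, Fin.sum_univ_succ, List.get_cons_zero,
    Fin.val_zero, Fin.val_succ, add_div, Finset.sum_div]
  congr 1
  · cases b <;> simp
  · refine Finset.sum_congr rfl fun i _ => ?_
    change (if bs.get i then _ else _) = _
    split_ifs
    · rw [pow_succ _ ((i : ℕ) + 1)]; field_simp
    · simp

theorem binaryFraction_mem (b : List Bool) : 0 ≤ binaryFraction b ∧ binaryFraction b ≤ 1 := by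
  induction b with
  | nil => simp [binaryFraction]
  | cons b bs ih =>
    rw [binaryFraction_cons]
    cases b <;> simp <;> constructor <;> linarith

/-- The value added by an accumulator is exact up to an error that depends on the perturbations and on
the bits, but not on the offset `y`. -/
theorem accumulate_spec {neg : Bool} {Y B : ℕ} {E : ℕ → ℝ} {δ κY μ : ℝ} (hE : ∀ v, |E v| ≤ δ)
    (hκY : |κY| + 2 * δ ≤ μ) (bit : ℕ → Bool) (os : List ℕ) (i c : ℕ) (κ : ℝ)
    (hκ : |κ| + os.length * μ ≤ 1 / 100) :
    ∃ κ' : ℝ, |κ'| ≤ |κ| + os.length * μ ∧ ∀ (W : ℕ → ℝ) (s y : ℝ), |y| ≤ 6 / 5 →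
      |s| + 6 / 5 / 2 ^ i ≤ 15 / 2 → W c = 1 / 2 + s / 16 + κ → W Y = 1 / 2 + y / 4 + κY →
      (∀ o ∈ os, W (B + o) = bitValue (bit o)) →
      Along (GateHolds W E) (c + 1) (accumulate neg Y B i c os) →
      W (c + 3 * os.length) = 1 / 2 + (s + (if neg then -1 else 1) *
        (y * binaryFraction (os.map bit) / 2 ^ i)) / 16 + κ' := by
  have hδ0 : 0 ≤ δ := (abs_nonneg _).trans (hE 0)
  have hμ0 : 0 ≤ μ := le_trans (by positivity) hκY
  induction os generalizing i c κ with
  | nil =>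
    refine ⟨κ, by simp, fun W s y _ _ hc _ _ _ => ?_⟩
    have h0 : binaryFraction [] = 0 := by simp [binaryFraction]
    simpa [h0] using hc
  | cons o os ih =>
    rw [List.length_cons, Nat.cast_succ, add_mul, one_mul] at hκ
    have hlen : 0 ≤ (os.length : ℝ) * μ := by positivity
    have h2i : (1 : ℝ) ≤ 2 ^ i := one_le_pow₀ (by norm_num)
    obtain ⟨σ, hσ⟩ : ∃ σ : ℝ, σ = if neg then -1 else 1 := ⟨_, rfl⟩
    have hσ1 : |σ| = 1 := by rw [hσ]; cases neg <;> simp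
    -- the error of the product of `y` and the bit
    obtain ⟨ζ, hζ⟩ : ∃ ζ, ζ = (if bit o then κY + E (c + 1) else 0) + E (c + 2) := ⟨_, rfl⟩
    have hEa := fun v => abs_le.1 (hE v)
    have hκYa := abs_le.1 (show |κY| ≤ μ - 2 * δ by linarith)
    have hζμ : |ζ| ≤ μ := by
      rw [hζ, abs_le]
      split_ifs <;> constructor <;> linarith [hEa (c + 1), hEa (c + 2)]
    have h8 : (8 : ℝ) ≤ 2 ^ (i + 3) := by rw [pow_add]; norm_num; linarith
    have hζ8 : |σ * ζ / 2 ^ (i + 3)| ≤ μ / 8 := by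
      rw [abs_div, abs_mul, hσ1, one_mul, abs_of_pos (by positivity : (0 : ℝ) < 2 ^ (i + 3))]
      exact div_le_div₀ hμ0 hζμ (by norm_num) h8
    have hδμ : δ ≤ μ / 2 := by linarith [abs_nonneg κY]
    have hμ1 : μ ≤ 1 / 100 := by linarith [abs_nonneg κ]
    have hstep : |κ + σ * ζ / 2 ^ (i + 3) + E (c + 3)| ≤ |κ| + μ := by
      have h1 := abs_add_le (κ + σ * ζ / 2 ^ (i + 3)) (E (c + 3))
      have h2 := abs_add_le κ (σ * ζ / 2 ^ (i + 3))
      linarith [hE (c + 3)]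
    obtain ⟨κ', hκ', h⟩ := ih (i + 1) (c + 3) (κ + σ * ζ / 2 ^ (i + 3) + E (c + 3)) (by linarith)
    refine ⟨κ', ?_, fun W s y hy hs hc hY hbit hA => ?_⟩
    · rw [List.length_cons, Nat.cast_succ, add_mul, one_mul]; linarith
    rw [accumulate, along_append] at hA
    obtain ⟨hA, hA'⟩ := hA
    simp only [accumulateBit, Along, gateHolds_truncGate, and_true, Nat.add_assoc,
      Nat.reduceAdd] at hA
    obtain ⟨g1, g2, g3⟩ := hA
    obtain ⟨b, hb⟩ : ∃ b, b = bitValue (bit o) := ⟨_, rfl⟩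
    have hbo : W (B + o) = b := hb ▸ hbit o (by simp)
    rw [hbo] at g1 g2
    push_cast at g1 g2
    have hya := abs_le.1 hy
    have hκa := abs_le.1 (show |κ| ≤ 1 / 100 by linarith)
    have hz : W (c + 2) = 1 / 2 + b * y / 4 + ζ := by
      rw [bitValue] at hb
      split_ifs at hb hζ with hbit
      · have h1 : W (c + 1) = 1 / 2 + y / 4 + κY + E (c + 1) := by
          rw [g1, hY, hb, show 1 * (1 / 2 + y / 4 + κY) + 1 * 1 + -1 + E (c + 1) =
            1 / 2 + y / 4 + κY + E (c + 1) by ring]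
          exact clamp_of_mem (by linarith [hEa (c + 1)]) (by linarith [hEa (c + 1)])
        rw [g2, h1, hb, hζ, show 1 * (1 / 2 + y / 4 + κY + E (c + 1)) + -1 / 2 * 1 + 1 / 2 +
          E (c + 2) = 1 / 2 + 1 * y / 4 + (κY + E (c + 1) + E (c + 2)) by ring]
        exact clamp_of_mem (by linarith [hEa (c + 1), hEa (c + 2)])
          (by linarith [hEa (c + 1), hEa (c + 2)])
      · have h1 : W (c + 1) = 0 := by
          rw [g1, hY, hb]
          exact clamp_of_nonpos (by linarith [hEa (c + 1)])
        rw [g2, h1, hb, hζ, show 1 * 0 + -1 / 2 * 0 + 1 / 2 + E (c + 2) =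
          1 / 2 + 0 * y / 4 + (0 + E (c + 2)) by ring]
        exact clamp_of_mem (by linarith [hEa (c + 2)]) (by linarith [hEa (c + 2)])
    have hb01 : 0 ≤ b ∧ b ≤ 1 := by rw [hb, bitValue]; split_ifs <;> norm_num
    have hs' : |s + σ * (b * y / 2 ^ (i + 1))| + 6 / 5 / 2 ^ (i + 1) ≤ 15 / 2 := by
      have h1 := abs_add_le s (σ * (b * y / 2 ^ (i + 1)))
      have h2 : |σ * (b * y / 2 ^ (i + 1))| ≤ 6 / 5 / 2 ^ (i + 1) := by
        rw [abs_mul, hσ1, one_mul, abs_div, abs_of_pos (by positivity : (0 : ℝ) < 2 ^ (i + 1)),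
          abs_mul, abs_of_nonneg hb01.1]
        refine div_le_div_of_nonneg_right ?_ (by positivity)
        exact (mul_le_of_le_one_left (abs_nonneg _) hb01.2).trans hy
      have h3 : (6 : ℝ) / 5 / 2 ^ i = 6 / 5 / 2 ^ (i + 1) + 6 / 5 / 2 ^ (i + 1) := by
        rw [pow_succ]; field_simp; norm_num
      linarith
    have hacc : W (c + 3) = 1 / 2 + (s + σ * (b * y / 2 ^ (i + 1))) / 16 +
        (κ + σ * ζ / 2 ^ (i + 3) + E (c + 3)) := by
      have h1 : W c + σ * (W (c + 2) - 1 / 2) / 2 ^ (i + 3) + E (c + 3) =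
          1 / 2 + (s + σ * (b * y / 2 ^ (i + 1))) / 16 +
            (κ + σ * ζ / 2 ^ (i + 3) + E (c + 3)) := by
        rw [hc, hz, pow_add 2 i 3, pow_succ 2 i]; field_simp; ring
      have h2 : W (c + 3) = clamp (W c + σ * (W (c + 2) - 1 / 2) / 2 ^ (i + 3) + E (c + 3)) := by
        rw [g3, hσ]
        congr 1
        cases neg <;> simp <;> rw [pow_add 2 i 4, pow_add 2 i 3] <;> field_simp <;> ring
      have h3 := abs_le.1 (show |s + σ * (b * y / 2 ^ (i + 1))| ≤ 15 / 2 from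
        le_trans (le_add_of_nonneg_right (by positivity)) hs')
      have h4 := abs_le.1 (hstep.trans (show |κ| + μ ≤ 1 / 100 by linarith))
      rw [h2, h1, clamp_of_mem (by linarith) (by linarith)]
    have hfin := h W _ y hy hs' hacc hY (fun o' ho' => hbit o' (by simp [ho'])) hA'
    rw [List.length_cons, show c + 3 * (os.length + 1) = c + 3 + 3 * os.length by ring, hfin,
      List.map_cons, binaryFraction_cons, ← hσ]
    congr 2
    rw [hb, bitValue, pow_succ]
    cases bit o <;> simp only [Bool.false_eq_true, if_false, if_true] <;>
      push_cast <;> field_simp <;> ring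

/-- The product of `y` and a number given by its signed binary digits is accumulated; the error `κ'`
does not depend on `y`. -/
theorem accumulateSigned_spec {Y B : ℕ} {E : ℕ → ℝ} {δ κY μ : ℝ} (hE : ∀ v, |E v| ≤ δ)
    (hκY : |κY| + 2 * δ ≤ μ) (bit : ℕ → Bool) (os : List ℕ) (c : ℕ) (κ : ℝ)
    (hκ : |κ| + os.length * μ ≤ 1 / 100) :
    ∃ κ' : ℝ, |κ'| ≤ |κ| + os.length * μ ∧ ∀ (W : ℕ → ℝ) (s y : ℝ), |y| ≤ 6 / 5 →
      |s| ≤ 5 → W c = 1 / 2 + s / 16 + κ → W Y = 1 / 2 + y / 4 + κY →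
      (∀ o ∈ os, W (B + o) = bitValue (bit o)) →
      Along (GateHolds W E) (c + 1) (accumulateSigned Y B c os) →
      W (c + 3 * os.length) = 1 / 2 + (s + y * signedFraction (os.map bit)) / 16 + κ' ∧
      |s + y * signedFraction (os.map bit)| ≤ |s| + 6 / 5 := by
  have hδ0 : 0 ≤ δ := (abs_nonneg _).trans (hE 0)
  have hμ0 : 0 ≤ μ := le_trans (by positivity) hκY
  have hh := length_halves os
  have hlen : (os.length : ℝ) * μ = (firstHalf os).length * μ + (secondHalf os).length * μ := by
    rw [← hh]; push_cast; ring
  have h2 : 0 ≤ ((secondHalf os).length : ℝ) * μ := by positivity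
  rw [hlen] at hκ ⊢
  obtain ⟨κ₁, hκ₁, h₁⟩ := accumulate_spec (neg := false) (Y := Y) (B := B) hE hκY bit (firstHalf os)
    0 c κ (by linarith)
  obtain ⟨κ₂, hκ₂, h₂⟩ := accumulate_spec (neg := true) (Y := Y) (B := B) hE hκY bit (secondHalf os)
    0 (c + 3 * (firstHalf os).length) κ₁ (by linarith)
  refine ⟨κ₂, by linarith, fun W s y hy hs hc hY hbit hA => ?_⟩
  rw [accumulateSigned, along_append, length_accumulate] at hA
  have hbf : ∀ l : List Bool, 0 ≤ (binaryFraction l : ℝ) ∧ (binaryFraction l : ℝ) ≤ 1 := fun l =>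
    ⟨by exact_mod_cast (binaryFraction_mem l).1, by exact_mod_cast (binaryFraction_mem l).2⟩
  have e1 := h₁ W s y hy (by norm_num; linarith) hc hY
    (fun o ho => hbit o (List.mem_of_mem_take ho)) hA.1
  have hb1 : |s + (if false = true then -1 else 1) *
      (y * binaryFraction ((firstHalf os).map bit) / 2 ^ 0)| ≤ |s| + 6 / 5 := by
    refine (abs_add_le _ _).trans (add_le_add_right ?_ _)
    simp only [Bool.false_eq_true, if_false, one_mul, pow_zero, div_one]
    rw [abs_mul, abs_of_nonneg (hbf _).1]
    exact (mul_le_of_le_one_right (abs_nonneg _) (hbf _).2).trans hy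
  have e2 := h₂ W _ y hy (by norm_num at hb1 ⊢; linarith) e1 hY
    (fun o ho => hbit o (List.mem_of_mem_drop ho))
    (by rw [show c + 1 + 3 * (firstHalf os).length = c + 3 * (firstHalf os).length + 1 by ring] at hA
        exact hA.2)
  have hsf : (signedFraction (os.map bit) : ℝ) = binaryFraction ((firstHalf os).map bit) -
      binaryFraction ((secondHalf os).map bit) := by
    rw [signedFraction, firstHalf, secondHalf, List.map_take, List.map_drop, List.length_map]
    push_cast
    rfl
  constructor
  · rw [show c + 3 * os.length = c + 3 * (firstHalf os).length + 3 * (secondHalf os).length by omega,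
      e2, hsf]
    simp
    ring
  · refine (abs_add_le _ _).trans (add_le_add_right ?_ _)
    rw [abs_mul, hsf]
    refine (mul_le_of_le_one_right (abs_nonneg _) (abs_le.2 ?_)).trans hy
    constructor <;> linarith [hbf ((firstHalf os).map bit), hbf ((secondHalf os).map bit)]

/-! ### The blocks -/

/-- The excess variables of both coordinates are combined to their maximum, up to constants. -/
theorem excess_spec {z₁ z₂ V m₁ zm zs e₂ e₃ e₅ δ : ℝ} (hz₁ : 0 ≤ z₁)
    (hδ : δ ≤ 1 / 1000) (he₂ : |e₂| ≤ δ) (he₃ : |e₃| ≤ δ) (he₅ : |e₅| ≤ δ)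
    (hm : m₁ = clamp (min 1 z₂ - min 1 z₁ + e₂)) (hzm : zm = clamp (min 1 z₁ + m₁ + e₃))
    (hV : 0 ≤ V) (hzs : zs = clamp (zm + V + e₅)) :
    min (4 / 5) (max (max 0 e₅) (max (z₁ + (e₃ + e₅)) (z₂ + (e₂ + e₃ + e₅)))) ≤ zs ∧
    (V = 0 → max (max 0 e₅) (max (z₁ + (e₃ + e₅)) (z₂ + (e₂ + e₃ + e₅))) ≤ 4 / 5 →
      zs = max (max 0 e₅) (max (z₁ + (e₃ + e₅)) (z₂ + (e₂ + e₃ + e₅)))) := by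
  rw [abs_le] at he₂ he₃ he₅
  -- below the saturation, the truncations at `1` have no effect
  have key : max (max 0 e₅) (max (z₁ + (e₃ + e₅)) (z₂ + (e₂ + e₃ + e₅))) ≤ 4 / 5 →
      clamp (zm + 0 + e₅) = max (max 0 e₅) (max (z₁ + (e₃ + e₅)) (z₂ + (e₂ + e₃ + e₅))) := by
    intro h
    have h1 : z₁ + (e₃ + e₅) ≤ 4 / 5 := ((le_max_left _ _).trans (le_max_right _ _)).trans h
    have h2 : z₂ + (e₂ + e₃ + e₅) ≤ 4 / 5 := ((le_max_right _ _).trans (le_max_right _ _)).trans h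
    rw [min_eq_right (by linarith), min_eq_right (by linarith)] at hm
    rw [min_eq_right (by linarith)] at hzm
    have hm' : m₁ = max 0 (z₂ - z₁ + e₂) := by rw [hm, clamp, min_eq_right (by linarith)]
    have hm₁ : z₁ + m₁ + e₃ = max (z₁ + e₃) (z₂ + e₂ + e₃) := by
      rw [hm', ← max_add_add_left, ← max_add_add_right]
      congr 1 <;> ring
    have hzm' : zm = max 0 (max (z₁ + e₃) (z₂ + e₂ + e₃)) := by
      rw [hzm, hm₁, clamp, min_eq_right (max_le (by linarith) (by linarith))]
    rw [hzm', add_zero, clamp, min_eq_right, ← max_add_add_right, ← max_add_add_right, zero_add,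
      max_assoc]
    · congr 3 <;> ring
    · rw [← max_add_add_right, ← max_add_add_right]
      exact max_le (by linarith) (max_le (by linarith) (by linarith))
  have hm0 : 0 ≤ m₁ := hm ▸ clamp_nonneg _
  refine ⟨?_, fun h0 h => by rw [hzs, h0, key h]⟩
  rcases le_or_gt (max (max 0 e₅) (max (z₁ + (e₃ + e₅)) (z₂ + (e₂ + e₃ + e₅)))) (4 / 5) with h | h
  · rw [hzs, ← key h]
    exact (min_le_right _ _).trans (clamp_mono (by linarith))
  · refine (min_le_left _ _).trans ?_
    have hz₁' : 0 ≤ min 1 z₁ := le_min zero_le_one hz₁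
    have hle : ∀ t : ℝ, t ≤ 1 → t ≤ min 1 z₁ + m₁ + e₃ → t ≤ zm := fun t ht h' =>
      hzm ▸ (le_min ht h').trans (le_max_right _ _)
    have hm₁ : min 1 (min 1 z₂ - min 1 z₁ + e₂) ≤ m₁ := hm ▸ le_max_right _ _
    have h9 : 4 / 5 ≤ zm + V + e₅ := by
      rcases lt_max_iff.1 h with h | h
      · exact absurd h (not_lt.2 (max_le (by norm_num) (by linarith)))
      rcases lt_max_iff.1 h with h | h
      · have : 4 / 5 - e₅ ≤ min 1 z₁ + e₃ := by
          rcases min_cases 1 z₁ with ⟨h', -⟩ | ⟨h', -⟩ <;> rw [h'] <;> linarith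
        linarith [hle (4 / 5 - e₅) (by linarith) (by linarith)]
      · have h2 : 4 / 5 - e₅ ≤ min 1 z₂ + e₂ + e₃ := by
          rcases min_cases 1 z₂ with ⟨h', -⟩ | ⟨h', -⟩ <;> rw [h'] <;> linarith
        have h3 : 4 / 5 - e₅ ≤ min 1 z₁ + m₁ + e₃ := by
          rcases min_cases 1 (min 1 z₂ - min 1 z₁ + e₂) with ⟨h', -⟩ | ⟨h', -⟩ <;>
            rw [h'] at hm₁ <;> linarith
        linarith [hle (4 / 5 - e₅) (by linarith) h3]
    rw [hzs]
    exact (le_min (by norm_num) h9).trans (le_max_right _ _)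

/-- The last gates of a block before the maximum with the previous blocks: without alarms the result
is the positive part of a mesa, with arbitrary alarms it is at most that. -/
theorem combine_spec {acc H s κ κH z₁ z₂ V₁ V₂ P m₁ zm VV zs M e₁ e₂ e₃ e₄ e₅ e₆ δ : ℝ}
    (hacc : acc = 1 / 2 + s / 16 + κ) (hH : H = 1 / 2 + κH) (hs : 2 / 5 ≤ s) (hs' : s ≤ 3 / 5)
    (hκ : |κ| ≤ 1 / 1000) (hκH : |κH| ≤ δ) (hz₁ : 0 ≤ z₁) (hδ : δ ≤ 1 / 1000)
    (he₁ : |e₁| ≤ δ) (he₂ : |e₂| ≤ δ) (he₃ : |e₃| ≤ δ) (he₄ : |e₄| ≤ δ) (he₅ : |e₅| ≤ δ)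
    (he₆ : |e₆| ≤ δ) (hP : P = clamp (16 * acc + -16 * H + e₁))
    (hm : m₁ = clamp (min 1 z₂ - min 1 z₁ + e₂)) (hzm : zm = clamp (min 1 z₁ + m₁ + e₃))
    (hVV : VV = clamp (2 * V₁ + 2 * V₂ + -1 / 2 + e₄)) (hzs : zs = clamp (zm + VV + e₅))
    (hM : M = clamp (P - zs + e₆)) :
    M ≤ max 0 (s + (16 * κ - 16 * κH + e₁ + e₆) -
      max (max 0 e₅) (max (z₁ + (e₃ + e₅)) (z₂ + (e₂ + e₃ + e₅)))) ∧
    (V₁ = 0 → V₂ = 0 → M = max 0 (s + (16 * κ - 16 * κH + e₁ + e₆) -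
      max (max 0 e₅) (max (z₁ + (e₃ + e₅)) (z₂ + (e₂ + e₃ + e₅))))) := by
  obtain ⟨h1, h2⟩ := excess_spec hz₁ hδ he₂ he₃ he₅ hm hzm (hVV ▸ clamp_nonneg _) hzs
  obtain ⟨Q, hQ⟩ : ∃ Q, Q = max (max 0 e₅) (max (z₁ + (e₃ + e₅)) (z₂ + (e₂ + e₃ + e₅))) := ⟨_, rfl⟩
  rw [← hQ] at h1 h2 ⊢
  have hQ0 : 0 ≤ Q := hQ ▸ (le_max_left _ _).trans (le_max_left _ _)
  rw [abs_le] at hκ hκH he₁ he₄ he₆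
  have hP' : P = s + (16 * κ - 16 * κH + e₁) := by
    rw [hP, hacc, hH, show 16 * (1 / 2 + s / 16 + κ) + -16 * (1 / 2 + κH) + e₁ =
      s + (16 * κ - 16 * κH + e₁) by ring]
    exact clamp_of_mem (by linarith) (by linarith)
  have hM' : M = clamp (s + (16 * κ - 16 * κH + e₁ + e₆) - zs) := by
    rw [hM, hP']; congr 1; ring
  have hs1 : s + (16 * κ - 16 * κH + e₁ + e₆) ≤ 7 / 10 := by linarith
  have hzs0 : 0 ≤ zs := hzs ▸ clamp_nonneg _
  constructor
  · rw [hM', clamp]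
    rcases le_or_gt Q (4 / 5) with h | h
    · rw [min_eq_right h] at h1
      exact max_le_max le_rfl ((min_le_right _ _).trans (by linarith))
    · rw [min_eq_left h.le] at h1
      exact max_le (le_max_left _ _) ((min_le_right _ _).trans ((by linarith : _ ≤ (0 : ℝ)).trans
        (le_max_left _ _)))
  · rintro rfl rfl
    have hVV0 : VV = 0 := by rw [hVV]; exact clamp_of_nonpos (by linarith)
    rcases le_or_gt Q (4 / 5) with h | h
    · rw [hM', h2 hVV0 h, clamp, min_eq_right (by linarith)]
    · rw [min_eq_left h.le] at h1
      rw [hM', clamp_of_nonpos (by linarith), max_eq_left (by linarith)]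

/-- With an alarm, the result of a block is negligible. -/
theorem combine_alarm {V₁ V₂ P zm VV zs M e₄ e₅ e₆ δ : ℝ} (hP : P ≤ 1) (hzm : 0 ≤ zm)
    (h₁ : 0 ≤ V₁) (h₂ : 0 ≤ V₂) (hV : V₁ = 1 ∨ V₂ = 1) (hδ : δ ≤ 1 / 1000) (he₄ : |e₄| ≤ δ)
    (he₅ : |e₅| ≤ δ) (he₆ : |e₆| ≤ δ) (hVV : VV = clamp (2 * V₁ + 2 * V₂ + -1 / 2 + e₄))
    (hzs : zs = clamp (zm + VV + e₅)) (hM : M = clamp (P - zs + e₆)) : M ≤ 2 * δ := by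
  have hδ0 : 0 ≤ δ := (abs_nonneg _).trans he₄
  rw [abs_le] at he₄ he₅ he₆
  have hVV1 : VV = 1 := by
    rw [hVV]
    exact clamp_of_one_le (by rcases hV with h | h <;> linarith)
  have hzs1 : 1 - δ ≤ zs := by
    rw [hzs, hVV1]
    exact (le_min (by linarith) (by linarith)).trans (le_max_right _ _)
  rw [hM]
  exact max_le (by linarith) ((min_le_right _ _).trans (by linarith))

/-- The mesa as the difference of its central piece and the excesses. -/
theorem mesa_eq_sub {ℓ Γ : ℝ} {x p g : Fin 2 → ℝ} {a κ C c₁ c₂ r t l b d₁ d₂ : ℝ}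
    {A : MesaPiece → ℝ} (hc : A .c = a + (κ - max C (max (c₁ + d₁) (c₂ + d₂))))
    (hr : A .r = a + (κ - r - d₁)) (ht : A .t = a + (κ - t - d₂)) (hl : A .l = a + (κ - l - d₁))
    (hb : A .b = a + (κ - b - d₂)) :
    mesa ℓ Γ x p A g = (a + (x 0 - p 0) * g 0 + (x 1 - p 1) * g 1) + κ -
      max C (max
        (max c₁ (max (Γ * (x 0 - p 0 - ℓ / 2) + r) (Γ * (-(x 0 - p 0) - ℓ / 2) + l)) + d₁)
        (max c₂ (max (Γ * (x 1 - p 1 - ℓ / 2) + t) (Γ * (-(x 1 - p 1) - ℓ / 2) + b)) + d₂)) := by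
  refine eq_of_forall_le_iff fun w => ?_
  simp only [mesa, mesaPiece, le_min_iff, hc, hr, ht, hl, hb, ← max_add_add_right, ← add_sub_assoc,
    le_sub_comm (a := w), max_le_iff]
  constructor
  · rintro ⟨⟨h1, h2, h3⟩, h4, h5, h6, h7⟩
    refine ⟨?_, ⟨?_, ?_, ?_⟩, ?_, ?_, ?_⟩ <;> linarith
  · rintro ⟨h1, ⟨h2, h3, h4⟩, h5, h6, h7⟩
    refine ⟨⟨?_, ?_, ?_⟩, ?_, ?_, ?_, ?_⟩ <;> linarith

theorem combine_values {W E : ℕ → ℝ} {A c v₁ z₁ v₂ z₂ : ℕ}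
    (h : Along (GateHolds W E) (c + 1) (combine A c v₁ z₁ v₂ z₂)) :
    W (c + 1) = clamp (16 * W c + -16 * W 2 + E (c + 1)) ∧
    W (c + 2) = clamp (W z₂ - W z₁ + E (c + 2)) ∧
    W (c + 3) = clamp (W z₁ + W (c + 2) + E (c + 3)) ∧
    W (c + 4) = clamp (2 * W v₁ + 2 * W v₂ + -1 / 2 + E (c + 4)) ∧
    W (c + 5) = clamp (W (c + 3) + W (c + 4) + E (c + 5)) ∧
    W (c + 6) = clamp (W (c + 1) - W (c + 5) + E (c + 6)) ∧
    W (c + 7) = clamp (W (c + 6) - W A + E (c + 7)) ∧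
    W (c + 8) = clamp (W A + W (c + 7) + E (c + 8)) := by
  simp only [combine, Along, gateHolds_truncGate, and_true, Nat.add_assoc, Nat.reduceAdd] at h
  push_cast at h
  simpa only [one_mul, add_zero, neg_mul, sub_eq_add_neg] using h

/-- The input of the Boolean circuits for the grid point `(i ℓ, j ℓ)`, on the grid with `2 ^ (m + 1)`
points in each direction. -/
def gridBits (m i j : ℕ) : List Bool := bitsMSB (m + 1) i ++ bitsMSB (m + 1) j

/-- The value of a mesa that is computed by a Boolean circuit. -/
def gridValue (m : ℕ) (C : BoolCircuit) (i j : ℕ) : ℚ := signedFraction (C.eval (gridBits m i j))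

/-- The gradient of a mesa that is computed by a Boolean circuit. -/
def gridGrad (m : ℕ) (C : BoolCircuit) (i j : ℕ) : Fin 2 → ℚ :=
  ![signedFraction (firstHalf (C.eval (gridBits m i j))),
    signedFraction (secondHalf (C.eval (gridBits m i j)))]

/-- The mesa at the grid point `(i ℓ, j ℓ)`, with the values of its pieces shifted by `τ`. -/
noncomputable def gridMesa (m : ℕ) (Γ : ℚ) (CV CG : BoolCircuit) (τ : MesaPiece → ℝ)
    (x : Fin 2 → ℝ) (i j : ℕ) : ℝ :=
  mesa (1 / (2 ^ (m + 1) - 1)) Γ x ![i / (2 ^ (m + 1) - 1), j / (2 ^ (m + 1) - 1)]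
    (fun d => gridValue m CV i j + τ d) fun k => gridGrad m CG i j k

theorem gridOffset_eq (m : ℕ) (e : Bool) (ξ : ℝ) (q : ℕ) :
    gridOffset m e ξ q = ξ - ((2 * q + e.toNat : ℕ) : ℝ) / (2 ^ (m + 1) - 1) := by
  cases e <;> simp [gridOffset]

/-- The variable before the last gates of a block. -/
def lastAcc (m A : ℕ) (CV CG : BoolCircuit) : ℕ :=
  gradAcc m A CV.gates.length CV.outputs.length CG.gates.length + 3 * CG.outputs.length

/-- At the located grid point, the block computes the positive part of the mesa, with shifts that
depend on the perturbations and the grid point only. -/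
theorem block_located {m : ℕ} {Γ : ℚ} {CV CG : BoolCircuit} {A : ℕ} {e₁ e₂ : Bool} {E : ℕ → ℝ}
    {δ T : ℝ} (hE : ∀ v, |E v| ≤ δ) (hη : Γ * ((m + 10) * δ) ≤ T / 40)
    (hlen : (CV.outputs.length + CG.outputs.length + 1) * ((m + 10) * δ) ≤ T / 200)
    (hT : T ≤ 1 / 1000) (hCV : CV.WellFormed (2 * (m + 1))) (hCG : CG.WellFormed (2 * (m + 1)))
    {q₁ q₂ : ℕ} {κY₁ κr₁ κl₁ c₁ κY₂ κr₂ κl₂ c₂ : ℝ}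
    (hκY₁ : |κY₁| ≤ 2 * ((m + 10) * δ)) (hκr₁ : |κr₁| ≤ 9 * (Γ * ((m + 10) * δ)))
    (hκl₁ : |κl₁| ≤ 9 * (Γ * ((m + 10) * δ))) (hc₁ : 0 ≤ c₁) (hc₁' : c₁ ≤ δ)
    (hκY₂ : |κY₂| ≤ 2 * ((m + 10) * δ)) (hκr₂ : |κr₂| ≤ 9 * (Γ * ((m + 10) * δ)))
    (hκl₂ : |κl₂| ≤ 9 * (Γ * ((m + 10) * δ))) (hc₂' : c₂ ≤ δ)
    (hval : gridValue m CV (2 * q₁ + e₁.toNat) (2 * q₂ + e₂.toNat) ∈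
      Set.Icc (45 / 100 : ℚ) (55 / 100))
    (hgrad : ∀ k, gridGrad m CG (2 * q₁ + e₁.toNat) (2 * q₂ + e₂.toNat) k ∈
      Set.Icc (-(1 / 100) : ℚ) (1 / 100)) :
    ∃ τ : MesaPiece → ℝ, (∀ d, |τ d| ≤ T) ∧ ∀ W : ℕ → ℝ, W 2 = 1 / 2 + E 2 → W 3 = 3 / 4 + E 3 →
      Along (GateHolds W E) (A + 1) (block m Γ CV CG A e₁ e₂) →
      Located m (A + 1) e₁ Γ κY₁ κr₁ κl₁ c₁ W (W 0) q₁ →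
      Located m (A + 9 + 7 * m) e₂ Γ κY₂ κr₂ κl₂ c₂ W (W 1) q₂ →
      W (lastAcc m A CV CG + 6) ≤ max 0 (gridMesa m Γ CV CG τ (fun k => W k)
        (2 * q₁ + e₁.toNat) (2 * q₂ + e₂.toNat)) ∧
      (W (A + 1 + 1 + 7 * m) = 0 → W (A + 9 + 7 * m + 1 + 7 * m) = 0 →
        W (lastAcc m A CV CG + 6) = max 0 (gridMesa m Γ CV CG τ (fun k => W k)
          (2 * q₁ + e₁.toNat) (2 * q₂ + e₂.toNat))) := by
  have hδ0 : 0 ≤ δ := (abs_nonneg _).trans (hE 0)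
  have hmδ : 0 ≤ (m : ℝ) * δ := by positivity
  obtain ⟨X, hX⟩ : ∃ X, X = (m + 10) * δ := ⟨_, rfl⟩
  have hXδ : 10 * δ ≤ X := by rw [hX]; linarith
  have hX0 : 0 ≤ X := by linarith
  rw [← hX] at hη hlen hκY₁ hκr₁ hκl₁ hκY₂ hκr₂ hκl₂
  have hEa := fun v => abs_le.1 (hE v)
  obtain ⟨bits, hbits⟩ : ∃ bits, bits = gridBits m (2 * q₁ + e₁.toNat) (2 * q₂ + e₂.toNat) := ⟨_, rfl⟩
  obtain ⟨va, hva⟩ : ∃ va, va = valueAcc m A CV.gates.length := ⟨_, rfl⟩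
  obtain ⟨ga, hga⟩ : ∃ ga, ga = gradAcc m A CV.gates.length CV.outputs.length CG.gates.length :=
    ⟨_, rfl⟩
  obtain ⟨gp, hgp⟩ : ∃ gp, gp = gradPos m A CV.gates.length CV.outputs.length := ⟨_, rfl⟩
  obtain ⟨c, hc⟩ : ∃ c, c = lastAcc m A CV CG := ⟨_, rfl⟩
  have hh := length_halves CG.outputs
  have hlenX : (CV.outputs.length : ℝ) * (3 * X) + (firstHalf CG.outputs).length * (3 * X) +
      (secondHalf CG.outputs).length * (3 * X) + 3 * X ≤ 3 * (T / 200) := by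
    have : (CG.outputs.length : ℝ) = (firstHalf CG.outputs).length + (secondHalf CG.outputs).length := by
      exact_mod_cast hh.symm
    rw [this] at hlen
    linarith
  have hp₁ : 0 ≤ (CV.outputs.length : ℝ) * (3 * X) := by positivity
  have hp₂ : 0 ≤ ((firstHalf CG.outputs).length : ℝ) * (3 * X) := by positivity
  have hp₃ : 0 ≤ ((secondHalf CG.outputs).length : ℝ) * (3 * X) := by positivity
  have hκ₀ : |E 2 + E va| ≤ 2 * δ := by linarith [abs_add_le (E 2) (E va), hE 2, hE va]
  obtain ⟨κ₁, hκ₁, h₁⟩ := accumulateSigned_spec (Y := 3) (B := valuePos m A) (κY := E 3) (μ := 3 * X)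
    hE (by linarith [hE 3]) (fun o => (CV.values bits).getD o false) CV.outputs va (E 2 + E va)
    (by linarith)
  have hκ₁' : |κ₁ + E ga| ≤ 3 * δ + CV.outputs.length * (3 * X) := by
    linarith [abs_add_le κ₁ (E ga), hE ga]
  obtain ⟨κ₂, hκ₂, h₂⟩ := accumulateSigned_spec (Y := A + 1 + 4 + 7 * m) (B := gp) (κY := κY₁)
    (μ := 3 * X) hE (by linarith) (fun o => (CG.values bits).getD o false) (firstHalf CG.outputs)
    ga (κ₁ + E ga) (by linarith)
  obtain ⟨κ₃, hκ₃, h₃⟩ := accumulateSigned_spec (Y := A + 9 + 7 * m + 4 + 7 * m) (B := gp)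
    (κY := κY₂) (μ := 3 * X) hE (by linarith) (fun o => (CG.values bits).getD o false)
    (secondHalf CG.outputs) (ga + 3 * (firstHalf CG.outputs).length) κ₂ (by linarith)
  have hκ₃' : |κ₃| ≤ 3 * (T / 200) := by linarith
  obtain ⟨κ, hκ⟩ : ∃ κ, κ = 16 * κ₃ - 16 * E 2 + E (c + 1) + E (c + 6) := ⟨_, rfl⟩
  obtain ⟨d₁, hd₁⟩ : ∃ d, d = E (c + 3) + E (c + 5) := ⟨_, rfl⟩
  obtain ⟨d₂, hd₂⟩ : ∃ d, d = E (c + 2) + E (c + 3) + E (c + 5) := ⟨_, rfl⟩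
  obtain ⟨C, hC⟩ : ∃ C, C = max 0 (E (c + 5)) := ⟨_, rfl⟩
  refine ⟨fun d => match d with
    | .c => κ - max C (max (c₁ + d₁) (c₂ + d₂))
    | .r => κ - κr₁ - d₁
    | .t => κ - κr₂ - d₂
    | .l => κ - κl₁ - d₁
    | .b => κ - κl₂ - d₂, ?_, ?_⟩
  · have hCm : 0 ≤ max C (max (c₁ + d₁) (c₂ + d₂)) := by
      rw [hC]; exact (le_max_left _ _).trans (le_max_left _ _)
    have hCm' : max C (max (c₁ + d₁) (c₂ + d₂)) ≤ 4 * δ := by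
      rw [hC, hd₁, hd₂]
      refine max_le (max_le ?_ ?_) (max_le ?_ ?_) <;>
        linarith [hEa (c + 5), hEa (c + 3), hEa (c + 2)]
    rw [abs_le] at hκ₃' hκr₁ hκl₁ hκr₂ hκl₂
    intro d
    rw [abs_le]
    cases d <;> simp only [hκ, hd₁, hd₂] at hCm hCm' ⊢ <;> constructor <;>
      linarith [hEa 2, hEa (c + 1), hEa (c + 2), hEa (c + 3), hEa (c + 5), hEa (c + 6)]
  · intro W hW2 hW3 hA hL₁ hL₂
    obtain ⟨-, -, hA₃, hA₄, hA₅, hA₆, hA₇, hA₈⟩ := along_block.1 hA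
    have hE' : ∀ v, |E v| ≤ 1 / 2 := fun v => (hE v).trans (by linarith)
    obtain ⟨sV, sV'⟩ := simulation_spec hE' hCV hL₁.digit hL₂.digit hA₃
    obtain ⟨sG, sG'⟩ := simulation_spec hE' hCG hL₁.digit hL₂.digit hA₅
    change ∀ o ∈ _, _ = bitValue ((CV.values (gridBits m _ _)).getD o false) at sV
    change ∀ o ∈ _, _ = bitValue ((CG.values (gridBits m _ _)).getD o false) at sG
    change W (valueAcc m A CV.gates.length) = clamp (W 2 + E (valueAcc m A CV.gates.length)) at sV'
    change W (gradAcc m A CV.gates.length CV.outputs.length CG.gates.length) =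
      clamp (_ + E (gradAcc m A CV.gates.length CV.outputs.length CG.gates.length)) at sG'
    change Along _ (lastAcc m A CV CG + 1) (combine A (lastAcc m A CV CG) _ _ _ _) at hA₈
    rw [← hva] at hA₄ sV' sG'
    rw [← hga] at hA₆ hA₇ sG'
    rw [← hgp] at hA₆ hA₇ sG
    rw [← hbits] at sV sG
    rw [← hc] at hA₈ ⊢
    obtain ⟨y₁, hy₁⟩ : ∃ y, y = gridOffset m e₁ (W 0) q₁ := ⟨_, rfl⟩
    obtain ⟨y₂, hy₂⟩ : ∃ y, y = gridOffset m e₂ (W 1) q₂ := ⟨_, rfl⟩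
    have hℓ : (1 : ℝ) / (2 ^ (m + 1) - 1) ≤ 1 := by
      have : (1 : ℝ) ≤ 2 ^ m := one_le_pow₀ (by norm_num)
      rw [pow_succ, div_le_one (by linarith)]
      linarith
    have hy₁' : |y₁| ≤ 6 / 5 := by rw [hy₁]; linarith [hL₁.abs_offset_le]
    have hy₂' : |y₂| ≤ 6 / 5 := by rw [hy₂]; linarith [hL₂.abs_offset_le]
    -- the value of the accumulator after the value of the mesa has been added
    obtain ⟨a, ha⟩ : ∃ a : ℝ, a = gridValue m CV (2 * q₁ + e₁.toNat) (2 * q₂ + e₂.toNat) := ⟨_, rfl⟩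
    have ha₀ : 45 / 100 ≤ a := by
      have := (Rat.cast_le (K := ℝ)).2 hval.1
      push_cast at this
      rwa [ha]
    have ha₁ : a ≤ 55 / 100 := by
      have := (Rat.cast_le (K := ℝ)).2 hval.2
      push_cast at this
      rwa [ha]
    have hsa : ((signedFraction (CV.outputs.map fun o => (CV.values bits).getD o false) : ℚ) : ℝ) =
        a := by rw [ha, hbits]; rfl
    have r₀ : W va = 1 / 2 + 0 / 16 + (E 2 + E va) := by
      rw [sV', hW2, clamp_of_mem (by linarith [hEa 2, hEa va]) (by linarith [hEa 2, hEa va])]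
      ring
    obtain ⟨r₁, -⟩ := h₁ W 0 1 (by norm_num) (by norm_num) r₀ (by rw [hW3]; ring) sV hA₄
    rw [hsa, zero_add, one_mul] at r₁
    have r₁' : W ga = 1 / 2 + a / 16 + (κ₁ + E ga) := by
      have := abs_le.1 hκ₁'
      rw [sG', r₁, show 1 / 2 + a / 16 + κ₁ + E ga = 1 / 2 + a / 16 + (κ₁ + E ga) by ring]
      exact clamp_of_mem (by linarith) (by linarith)
    -- the accumulator after the gradient has been added
    obtain ⟨g, hg⟩ : ∃ g : Fin 2 → ℝ, g = fun k =>
      ((gridGrad m CG (2 * q₁ + e₁.toNat) (2 * q₂ + e₂.toNat) k : ℚ) : ℝ) := ⟨_, rfl⟩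
    have hg' : ∀ k, |g k| ≤ 1 / 100 := by
      intro k
      have h := hgrad k
      rw [hg, abs_le]
      constructor
      · have := (Rat.cast_le (K := ℝ)).2 h.1
        push_cast at this ⊢
        linarith
      · have := (Rat.cast_le (K := ℝ)).2 h.2
        push_cast at this ⊢
        linarith
    have hsg₀ : ((signedFraction ((firstHalf CG.outputs).map
        fun o => (CG.values bits).getD o false) : ℚ) : ℝ) = g 0 := by
      rw [hg, hbits, firstHalf, List.map_take]
      simp [gridGrad, firstHalf, BoolCircuit.eval]
    have hsg₁ : ((signedFraction ((secondHalf CG.outputs).map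
        fun o => (CG.values bits).getD o false) : ℚ) : ℝ) = g 1 := by
      rw [hg, hbits, secondHalf, List.map_drop]
      simp [gridGrad, secondHalf, BoolCircuit.eval]
    have hyg : ∀ (y : ℝ) k, |y| ≤ 6 / 5 → |y * g k| ≤ 12 / 1000 := by
      intro y k hy
      rw [abs_mul]
      exact (mul_le_mul hy (hg' k) (abs_nonneg _) (by norm_num)).trans (by norm_num)
    have hyg₁ := abs_le.1 (hyg y₁ 0 hy₁')
    have hyg₂ := abs_le.1 (hyg y₂ 1 hy₂')
    obtain ⟨r₂, -⟩ := h₂ W a y₁ hy₁' (abs_le.2 ⟨by linarith, by linarith⟩) r₁'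
      (by rw [hy₁]; exact hL₁.offset) (fun o ho => sG o (List.mem_of_mem_take ho)) hA₆
    rw [hsg₀] at r₂
    obtain ⟨r₃, -⟩ := h₃ W (a + y₁ * g 0) y₂ hy₂' (abs_le.2 ⟨by linarith, by linarith⟩) r₂
      (by rw [hy₂]; exact hL₂.offset) (fun o ho => sG o (List.mem_of_mem_drop ho)) hA₇
    rw [hsg₁, show ga + 3 * (firstHalf CG.outputs).length + 3 * (secondHalf CG.outputs).length = c by
      rw [hc, hga, lastAcc]; omega] at r₃
    obtain ⟨g₁, g₂, g₃, g₄, g₅, g₆, -, -⟩ := combine_values hA₈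
    have hZ₁ := hL₁.excess
    have hZ₂ := hL₂.excess
    rw [← hy₁] at hZ₁
    rw [← hy₂] at hZ₂
    rw [hZ₁, hZ₂] at g₂
    rw [hZ₁] at g₃
    obtain ⟨hle, heq⟩ := combine_spec r₃ hW2 (by linarith) (by linarith) (hκ₃'.trans (by linarith))
      (hE 2) (hc₁.trans (le_max_left _ _)) (by linarith) (hE (c + 1)) (hE (c + 2)) (hE (c + 3))
      (hE (c + 4)) (hE (c + 5)) (hE (c + 6)) g₁ g₂ g₃ g₄ g₅ g₆
    have hx₁ : W 0 - ((2 * q₁ + e₁.toNat : ℕ) : ℝ) / (2 ^ (m + 1) - 1) = y₁ := by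
      rw [hy₁, gridOffset_eq]
    have hx₂ : W 1 - ((2 * q₂ + e₂.toNat : ℕ) : ℝ) / (2 ^ (m + 1) - 1) = y₂ := by
      rw [hy₂, gridOffset_eq]
    rw [gridMesa, mesa_eq_sub (a := a) (κ := κ) (C := C) (c₁ := c₁) (c₂ := c₂) (r := κr₁) (t := κr₂)
      (l := κl₁) (b := κl₂) (d₁ := d₁) (d₂ := d₂) (by rw [ha]) (by rw [ha]) (by rw [ha])
      (by rw [ha]) (by rw [ha])]
    simp only [Matrix.cons_val_zero, Matrix.cons_val_one, Fin.val_zero, Fin.val_one]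
    rw [hx₁, hx₂]
    rw [← hC, ← hd₁, ← hd₂, ← hκ] at hle heq
    rw [hg] at hle heq
    exact ⟨hle, heq⟩

/-- A block takes the maximum of the previous variable and a number `M`.  Here `M` is the positive part
of the mesa if a grid point with the parities of the block is near, and otherwise it is at most the
positive part of some mesa, or negligible. -/
theorem block_spec {m : ℕ} {Γ : ℚ} {CV CG : BoolCircuit} {A : ℕ} {e₁ e₂ : Bool} {E : ℕ → ℝ}
    {δ T : ℝ} (hE : ∀ v, |E v| ≤ δ) (hΓ : 12 * ((2 : ℝ) ^ (m + 1) - 1) ≤ Γ)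
    (hη : Γ * ((m + 10) * δ) ≤ T / 40)
    (hlen : (CV.outputs.length + CG.outputs.length + 1) * ((m + 10) * δ) ≤ T / 200)
    (hT : T ≤ 1 / 1000) (hCV : CV.WellFormed (2 * (m + 1))) (hCG : CG.WellFormed (2 * (m + 1)))
    (hval : ∀ i < 2 ^ (m + 1), ∀ j < 2 ^ (m + 1),
      gridValue m CV i j ∈ Set.Icc (45 / 100 : ℚ) (55 / 100))
    (hgrad : ∀ i < 2 ^ (m + 1), ∀ j < 2 ^ (m + 1), ∀ k,
      gridGrad m CG i j k ∈ Set.Icc (-(1 / 100) : ℚ) (1 / 100)) :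
    ∃ τ : ℕ → ℕ → MesaPiece → ℝ, (∀ q₁ < 2 ^ m, ∀ q₂ < 2 ^ m, ∀ d, |τ q₁ q₂ d| ≤ T) ∧
      ∀ W : ℕ → ℝ, W 2 = 1 / 2 + E 2 → W 3 = 3 / 4 + E 3 → 0 ≤ W 0 → W 0 ≤ 1 → 0 ≤ W 1 → W 1 ≤ 1 →
      Along (GateHolds W E) (A + 1) (block m Γ CV CG A e₁ e₂) →
      ∃ M : ℝ, 0 ≤ M ∧
        W (A + blockLen m CV CG) = clamp (W A + clamp (M - W A +
          E (A + blockLen m CV CG - 1)) + E (A + blockLen m CV CG)) ∧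
        (M ≤ 2 * δ ∨ ∃ q₁ < 2 ^ m, ∃ q₂ < 2 ^ m, M ≤ max 0 (gridMesa m Γ CV CG (τ q₁ q₂)
          (fun k => W k) (2 * q₁ + e₁.toNat) (2 * q₂ + e₂.toNat))) ∧
        ∀ q₁ < 2 ^ m, ∀ q₂ < 2 ^ m,
          |gridOffset m e₁ (W 0) q₁| ≤ 3 / 4 * (1 / (2 ^ (m + 1) - 1)) →
          |gridOffset m e₂ (W 1) q₂| ≤ 3 / 4 * (1 / (2 ^ (m + 1) - 1)) →
          M = max 0 (gridMesa m Γ CV CG (τ q₁ q₂)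
            (fun k => W k) (2 * q₁ + e₁.toNat) (2 * q₂ + e₂.toNat)) := by
  have hδ0 : 0 ≤ δ := (abs_nonneg _).trans (hE 0)
  have hmδ : 0 ≤ (m : ℝ) * δ := by positivity
  have hδ1 : δ ≤ 1 / 1000 := by
    have : 0 ≤ ((CV.outputs.length : ℝ) + CG.outputs.length) * ((m + 10) * δ) := by positivity
    linarith
  have hsmall : Γ * ((m + 10) * δ) ≤ 1 / 2000 := by linarith
  obtain ⟨κY₁, κr₁, κl₁, c₁, hκY₁, hκr₁, hκl₁, hc₁, hc₁', h₁⟩ :=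
    extraction_spec (D := A + 1) (i := 0) (e := e₁) hE hΓ hsmall
  obtain ⟨κY₂, κr₂, κl₂, c₂, hκY₂, hκr₂, hκl₂, -, hc₂', h₂⟩ :=
    extraction_spec (D := A + 9 + 7 * m) (i := 1) (e := e₂) hE hΓ hsmall
  have hb : ∀ (q : ℕ) (e : Bool), q < 2 ^ m → 2 * q + e.toNat < 2 ^ (m + 1) := by
    intro q e hq
    have := Bool.toNat_le e
    rw [pow_succ]
    omega
  have key : ∀ q₁ q₂ : ℕ, ∃ τ : MesaPiece → ℝ, q₁ < 2 ^ m → q₂ < 2 ^ m → (∀ d, |τ d| ≤ T) ∧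
      ∀ W : ℕ → ℝ, W 2 = 1 / 2 + E 2 → W 3 = 3 / 4 + E 3 →
      Along (GateHolds W E) (A + 1) (block m Γ CV CG A e₁ e₂) →
      Located m (A + 1) e₁ Γ κY₁ κr₁ κl₁ c₁ W (W 0) q₁ →
      Located m (A + 9 + 7 * m) e₂ Γ κY₂ κr₂ κl₂ c₂ W (W 1) q₂ →
      W (lastAcc m A CV CG + 6) ≤ max 0 (gridMesa m Γ CV CG τ (fun k => W k)
        (2 * q₁ + e₁.toNat) (2 * q₂ + e₂.toNat)) ∧
      (W (A + 1 + 1 + 7 * m) = 0 → W (A + 9 + 7 * m + 1 + 7 * m) = 0 →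
        W (lastAcc m A CV CG + 6) = max 0 (gridMesa m Γ CV CG τ (fun k => W k)
          (2 * q₁ + e₁.toNat) (2 * q₂ + e₂.toNat))) := by
    intro q₁ q₂
    by_cases hq : q₁ < 2 ^ m ∧ q₂ < 2 ^ m
    · obtain ⟨τ, h⟩ := block_located (A := A) hE hη hlen hT hCV hCG hκY₁ hκr₁ hκl₁ hc₁ hc₁' hκY₂ hκr₂
        hκl₂ hc₂' (hval _ (hb q₁ e₁ hq.1) _ (hb q₂ e₂ hq.2))
        (hgrad _ (hb q₁ e₁ hq.1) _ (hb q₂ e₂ hq.2))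
      exact ⟨τ, fun _ _ => h⟩
    · exact ⟨0, fun h h' => absurd ⟨h, h'⟩ hq⟩
  choose τ hτ using key
  refine ⟨τ, fun q₁ hq₁ q₂ hq₂ => (hτ q₁ q₂ hq₁ hq₂).1, fun W hW2 hW3 hx₀ hx₁ hy₀ hy₁ hA => ?_⟩
  obtain ⟨hA₁, hA₂, -, -, -, -, -, hA₈⟩ := along_block.1 hA
  obtain ⟨v₁, l₁, n₁⟩ := h₁ W hW2 hx₀ hx₁ hA₁
  obtain ⟨v₂, l₂, n₂⟩ := h₂ W hW2 hy₀ hy₁ hA₂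
  have hc : A + blockLen m CV CG = lastAcc m A CV CG + 8 := by
    simp only [blockLen, lastAcc, gradAcc, gradPos, valueAcc, valuePos]
    ring
  change Along _ (lastAcc m A CV CG + 1) (combine A (lastAcc m A CV CG) _ _ _ _) at hA₈
  obtain ⟨g₁, g₂, g₃, g₄, g₅, g₆, g₇, g₈⟩ := combine_values hA₈
  refine ⟨W (lastAcc m A CV CG + 6), g₆ ▸ clamp_nonneg _, ?_, ?_, ?_⟩
  · rw [hc, g₈, g₇]
    rfl
  · rcases l₁ with l₁ | ⟨q₁, l₁⟩
    · exact .inl (combine_alarm (g₁ ▸ clamp_le_one _) (g₃ ▸ clamp_nonneg _) v₁ v₂ (.inl l₁) hδ1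
        (hE _) (hE _) (hE _) g₄ g₅ g₆)
    · rcases l₂ with l₂ | ⟨q₂, l₂⟩
      · exact .inl (combine_alarm (g₁ ▸ clamp_le_one _) (g₃ ▸ clamp_nonneg _) v₁ v₂ (.inr l₂) hδ1
          (hE _) (hE _) (hE _) g₄ g₅ g₆)
      · exact .inr ⟨q₁, l₁.lt, q₂, l₂.lt, ((hτ q₁ q₂ l₁.lt l₂.lt).2 W hW2 hW3 hA l₁ l₂).1⟩
  · intro q₁ hq₁ q₂ hq₂ hn₁ hn₂
    obtain ⟨a₁, b₁⟩ := n₁ q₁ hq₁ hn₁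
    obtain ⟨a₂, b₂⟩ := n₂ q₂ hq₂ hn₂
    exact ((hτ q₁ q₂ hq₁ hq₂).2 W hW2 hW3 hA b₁ b₂).2 a₁ a₂

/-! ### The maximum of the blocks -/

/-- An iterated maximum with perturbations. -/
theorem iterated_max_spec {o M e e' : ℕ → ℝ} {δ : ℝ} {n : ℕ} (hδ : δ ≤ 1 / 1000) (hn : n ≤ 4)
    (ho : o 0 ≤ δ) (ho' : 0 ≤ o 0) (hM : ∀ k < n, M k ≤ 7 / 10) (he : ∀ k, |e k| ≤ δ)
    (he' : ∀ k, |e' k| ≤ δ) (h : ∀ k < n, o (k + 1) = clamp (o k + clamp (M k - o k + e k) + e' k)) :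
    (∀ k < n, M k + (e k + ∑ j ∈ Finset.Ico k n, e' j) ≤ o n) ∧
    (o n ≤ (n + 1) * δ ∨ ∃ k < n, o n = M k + (e k + ∑ j ∈ Finset.Ico k n, e' j)) ∧
    0 ≤ o n ∧ o n ≤ 7 / 10 + (2 * n + 1) * δ := by
  have hδ0 : 0 ≤ δ := (abs_nonneg _).trans (he 0)
  induction n with
  | zero => simpa [ho, ho'] using ho.trans (by linarith)
  | succ n ih =>
    obtain ⟨h1, h2, h3, h4⟩ := ih (by omega) (fun k hk => hM k (by omega)) (fun k hk => h k (by omega))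
    have ha := abs_le.1 (he n)
    have ha' := abs_le.1 (he' n)
    have hn' : (n : ℝ) ≤ 3 := by exact_mod_cast (by omega : n ≤ 3)
    have hnδ : (n : ℝ) * δ ≤ 3 * δ := mul_le_mul_of_nonneg_right hn' hδ0
    have hMn := hM n (by omega)
    have hstep : o (n + 1) = max 0 (max (o n + e' n) (M n + e n + e' n)) := by
      have : o n + max 0 (M n - o n + e n) + e' n = max (o n + e' n) (M n + e n + e' n) := by
        rw [← max_add_add_left, ← max_add_add_right]; congr 1 <;> ring
      rw [h n (by omega), clamp, clamp, min_eq_right (by linarith : M n - o n + e n ≤ 1), this,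
        min_eq_right (max_le (by linarith) (by linarith))]
    have hsum : ∀ k < n + 1, e k + ∑ j ∈ Finset.Ico k (n + 1), e' j =
        e k + ∑ j ∈ Finset.Ico k n, e' j + e' n := by
      intro k hk
      rw [Finset.sum_Ico_succ_top (by omega), add_assoc]
    have hnn : M n + (e n + ∑ j ∈ Finset.Ico n (n + 1), e' j) = M n + e n + e' n := by
      rw [hsum n (by omega)]; simp [add_assoc]
    refine ⟨fun k hk => ?_, ?_, hstep ▸ le_max_left _ _, ?_⟩
    · rw [hstep]
      refine le_trans ?_ (le_max_right _ _)
      rcases Nat.lt_succ_iff_lt_or_eq.1 hk with hk' | rfl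
      · rw [hsum k hk]
        exact le_trans (by linarith [h1 k hk']) (le_max_left _ _)
      · rw [hnn]
        exact le_max_right _ _
    · rcases max_choice 0 (max (o n + e' n) (M n + e n + e' n)) with h5 | h5
      · left
        rw [hstep, h5]
        positivity
      · rcases max_choice (o n + e' n) (M n + e n + e' n) with h6 | h6
        · rcases h2 with h2 | ⟨k, hk, h2⟩
          · left
            rw [hstep, h5, h6]
            push_cast
            linarith
          · right
            refine ⟨k, by omega, ?_⟩
            rw [hstep, h5, h6, h2, hsum k (by omega)]
            ring
        · right
          exact ⟨n, by omega, by rw [hstep, h5, h6, hnn]⟩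
    · rw [hstep]
      push_cast
      refine max_le (by positivity) (max_le (by linarith) ?_)
      have : 0 ≤ (n : ℝ) * δ := by positivity
      linarith

/-- A common shift of the five pieces shifts the mesa; this absorbs the errors of the final maxima. -/
theorem gridMesa_add (m : ℕ) (Γ : ℚ) (CV CG : BoolCircuit) (τ : MesaPiece → ℝ) (σ : ℝ)
    (x : Fin 2 → ℝ) (i j : ℕ) :
    gridMesa m Γ CV CG (fun d => τ d + σ) x i j = gridMesa m Γ CV CG τ x i j + σ := by
  simp only [gridMesa, mesa, mesaPiece, ← min_add_add_right]
  congr 1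
  · ring
  congr 1
  · ring
  congr 1
  · ring
  congr 1 <;> ring

section gridMesa

variable {m : ℕ} {Γ : ℚ} {CV CG : BoolCircuit} {τ : MesaPiece → ℝ} {x : Fin 2 → ℝ} {i j : ℕ}

/-- The values of a mesa: at most `6 / 10` everywhere, negative away from its center, and at least
`4 / 10` if its center is the nearest grid point. -/
theorem gridMesa_bounds (hΓ : 12 * ((2 : ℝ) ^ (m + 1) - 1) ≤ Γ)
    (hval : gridValue m CV i j ∈ Set.Icc (45 / 100 : ℚ) (55 / 100))
    (hgrad : ∀ k, gridGrad m CG i j k ∈ Set.Icc (-(1 / 100) : ℚ) (1 / 100))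
    (hτ : ∀ d, |τ d| ≤ 1 / 100) (h₀ : |x 0 - i / (2 ^ (m + 1) - 1)| ≤ 1)
    (h₁ : |x 1 - j / (2 ^ (m + 1) - 1)| ≤ 1) :
    gridMesa m Γ CV CG τ x i j ≤ 6 / 10 ∧
    (3 / 4 * (1 / (2 ^ (m + 1) - 1)) < |x 0 - i / (2 ^ (m + 1) - 1)| ∨
      3 / 4 * (1 / (2 ^ (m + 1) - 1)) < |x 1 - j / (2 ^ (m + 1) - 1)| →
      gridMesa m Γ CV CG τ x i j ≤ -1) ∧
    (|x 0 - i / (2 ^ (m + 1) - 1)| ≤ 1 / (2 ^ (m + 1) - 1) / 2 →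
      |x 1 - j / (2 ^ (m + 1) - 1)| ≤ 1 / (2 ^ (m + 1) - 1) / 2 →
      4 / 10 ≤ gridMesa m Γ CV CG τ x i j) := by
  obtain ⟨N, hN⟩ : ∃ N : ℝ, N = 2 ^ (m + 1) - 1 := ⟨_, rfl⟩
  have hN1 : 1 ≤ N := by
    have : (1 : ℝ) ≤ 2 ^ m := one_le_pow₀ (by norm_num)
    rw [hN, pow_succ]
    linarith
  obtain ⟨ℓ, hℓ⟩ : ∃ ℓ : ℝ, ℓ = 1 / N := ⟨_, rfl⟩
  have hΓℓ : 12 ≤ Γ * ℓ := by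
    rw [hℓ, mul_one_div, le_div_iff₀ (by linarith), hN]
    exact hΓ
  have hΓ0 : (0 : ℝ) < Γ := by rw [← hN] at hΓ; linarith
  obtain ⟨y₀, hy₀⟩ : ∃ y, y = x 0 - i / (2 ^ (m + 1) - 1) := ⟨_, rfl⟩
  obtain ⟨y₁, hy₁⟩ : ∃ y, y = x 1 - j / (2 ^ (m + 1) - 1) := ⟨_, rfl⟩
  obtain ⟨a, ha⟩ : ∃ a : ℝ, a = gridValue m CV i j := ⟨_, rfl⟩
  obtain ⟨g, hg⟩ : ∃ g : Fin 2 → ℝ, g = fun k => ((gridGrad m CG i j k : ℚ) : ℝ) := ⟨_, rfl⟩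
  have ha₀ : 45 / 100 ≤ a := by
    have := (Rat.cast_le (K := ℝ)).2 hval.1
    push_cast at this
    rwa [ha]
  have ha₁ : a ≤ 55 / 100 := by
    have := (Rat.cast_le (K := ℝ)).2 hval.2
    push_cast at this
    rwa [ha]
  have hg' : ∀ k, |g k| ≤ 1 / 100 := by
    intro k
    have h := hgrad k
    rw [hg, abs_le]
    constructor
    · have := (Rat.cast_le (K := ℝ)).2 h.1
      push_cast at this ⊢
      linarith
    · have := (Rat.cast_le (K := ℝ)).2 h.2
      push_cast at this ⊢
      linarith
  rw [← hy₀] at h₀ ⊢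
  rw [← hy₁] at h₁ ⊢
  rw [← hN, ← hℓ]
  rw [← hN] at hy₀ hy₁
  have hyg : ∀ (y : ℝ) k, |y| ≤ 1 → |y * g k| ≤ 1 / 100 := by
    intro y k hy
    rw [abs_mul]
    exact (mul_le_mul hy (hg' k) (abs_nonneg _) (by norm_num)).trans (by norm_num)
  have hyg₀ := abs_le.1 (hyg y₀ 0 h₀)
  have hyg₁ := abs_le.1 (hyg y₁ 1 h₁)
  have hτ' := fun d => abs_le.1 (hτ d)
  have hform : gridMesa m Γ CV CG τ x i j =
      min (y₀ * g 0 + y₁ * g 1 + (a + τ .c)) (min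
        (y₀ * g 0 + y₁ * g 1 + (a + τ .r) - (Γ * y₀ - Γ * ℓ / 2)) (min
        (y₀ * g 0 + y₁ * g 1 + (a + τ .t) - (Γ * y₁ - Γ * ℓ / 2)) (min
        (y₀ * g 0 + y₁ * g 1 + (a + τ .l) - (Γ * (-y₀) - Γ * ℓ / 2))
        (y₀ * g 0 + y₁ * g 1 + (a + τ .b) - (Γ * (-y₁) - Γ * ℓ / 2))))) := by
    simp only [gridMesa, mesa, mesaPiece, Matrix.cons_val_zero, Matrix.cons_val_one, ← hN, ← hℓ,
      ← hy₀, ← hy₁, ← ha, hg]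
    congr 1
    congr 1
    · ring
    congr 1
    · ring
    congr 1 <;> ring
  rw [hform]
  refine ⟨(min_le_left _ _).trans (by linarith [hτ' .c]), ?_, ?_⟩
  · intro h
    rcases h with h | h
    · have h2 := mul_lt_mul_of_pos_left h hΓ0
      rcases abs_cases y₀ with ⟨h3, -⟩ | ⟨h3, -⟩ <;> rw [h3] at h2
      · exact ((min_le_right _ _).trans (min_le_left _ _)).trans (by linarith [hτ' .r])
      · exact ((min_le_right _ _).trans ((min_le_right _ _).trans ((min_le_right _ _).trans
          (min_le_left _ _)))).trans (by linarith [hτ' .l])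
    · have h2 := mul_lt_mul_of_pos_left h hΓ0
      rcases abs_cases y₁ with ⟨h3, -⟩ | ⟨h3, -⟩ <;> rw [h3] at h2
      · exact ((min_le_right _ _).trans ((min_le_right _ _).trans (min_le_left _ _))).trans
          (by linarith [hτ' .t])
      · exact ((min_le_right _ _).trans ((min_le_right _ _).trans ((min_le_right _ _).trans
          (min_le_right _ _)))).trans (by linarith [hτ' .b])
  · intro h h'
    have k₁ := mul_le_mul_of_nonneg_left ((le_abs_self _).trans h) hΓ0.le
    have k₂ := mul_le_mul_of_nonneg_left ((neg_le_abs _).trans h) hΓ0.le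
    have k₃ := mul_le_mul_of_nonneg_left ((le_abs_self _).trans h') hΓ0.le
    have k₄ := mul_le_mul_of_nonneg_left ((neg_le_abs _).trans h') hΓ0.le
    refine le_min ?_ (le_min ?_ (le_min ?_ (le_min ?_ ?_)))
    · linarith [hτ' .c]
    · linarith [hτ' .r]
    · linarith [hτ' .t]
    · linarith [hτ' .l]
    · linarith [hτ' .b]

end gridMesa

/-- Every number in the unit interval is near a grid coordinate. -/
theorem exists_near {N : ℕ} (hN : 2 ≤ N) {ξ : ℝ} (h₀ : 0 ≤ ξ) (h₁ : ξ ≤ 1) :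
    ∃ i < N, |ξ - i / ((N : ℝ) - 1)| ≤ 1 / ((N : ℝ) - 1) / 2 := by
  have hN' : (2 : ℝ) ≤ N := by exact_mod_cast hN
  have hN1 : 0 < (N : ℝ) - 1 := by linarith
  refine ⟨⌊ξ * ((N : ℝ) - 1) + 1 / 2⌋₊, ?_, ?_⟩
  · rw [Nat.floor_lt (by positivity)]
    have := mul_le_of_le_one_left hN1.le h₁
    linarith
  · have h2 := Nat.floor_le (show 0 ≤ ξ * ((N : ℝ) - 1) + 1 / 2 by positivity)
    have h3 := Nat.lt_floor_add_one (ξ * ((N : ℝ) - 1) + 1 / 2)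
    rw [show ξ - (⌊ξ * ((N : ℝ) - 1) + 1 / 2⌋₊ : ℝ) / ((N : ℝ) - 1) =
      (ξ * ((N : ℝ) - 1) - ⌊ξ * ((N : ℝ) - 1) + 1 / 2⌋₊) / ((N : ℝ) - 1) by field_simp,
      abs_div, abs_of_pos hN1, div_right_comm, div_le_div_iff_of_pos_right hN1, abs_le]
    constructor <;> linarith

/-- The circuit computes the maximum of mesas with shifted values, where the shifts depend on the
perturbations only. -/
theorem mesaGates_spec {m : ℕ} {Γ : ℚ} {CV CG : BoolCircuit} {E : ℕ → ℝ}
    {δ T : ℝ} (hE : ∀ v, |E v| ≤ δ) (hΓ : 12 * ((2 : ℝ) ^ (m + 1) - 1) ≤ Γ)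
    (hη : Γ * ((m + 10) * δ) ≤ T / 40)
    (hlen : (CV.outputs.length + CG.outputs.length + 1) * ((m + 10) * δ) ≤ T / 200)
    (hT : T ≤ 1 / 1000) (hCV : CV.WellFormed (2 * (m + 1))) (hCG : CG.WellFormed (2 * (m + 1)))
    (hval : ∀ i < 2 ^ (m + 1), ∀ j < 2 ^ (m + 1),
      gridValue m CV i j ∈ Set.Icc (45 / 100 : ℚ) (55 / 100))
    (hgrad : ∀ i < 2 ^ (m + 1), ∀ j < 2 ^ (m + 1), ∀ k,
      gridGrad m CG i j k ∈ Set.Icc (-(1 / 100) : ℚ) (1 / 100)) :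
    ∃ τ : ℕ → ℕ → MesaPiece → ℝ,
      (∀ i < 2 ^ (m + 1), ∀ j < 2 ^ (m + 1), ∀ d, |τ i j d| ≤ 2 * T) ∧
      ∀ W : ℕ → ℝ, 0 ≤ W 0 → W 0 ≤ 1 → 0 ≤ W 1 → W 1 ≤ 1 →
      Along (GateHolds W E) 2 (mesaGates m Γ CV CG) →
      (∀ i < 2 ^ (m + 1), ∀ j < 2 ^ (m + 1), gridMesa m Γ CV CG (τ i j) (fun k => W k) i j ≤
        W ((mesaGates m Γ CV CG).length + 1)) ∧
      ∃ i < 2 ^ (m + 1), ∃ j < 2 ^ (m + 1), W ((mesaGates m Γ CV CG).length + 1) ≤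
        gridMesa m Γ CV CG (τ i j) (fun k => W k) i j := by
  have hδ0 : 0 ≤ δ := (abs_nonneg _).trans (hE 0)
  have hmδ : 0 ≤ (m : ℝ) * δ := by positivity
  have hδT : 2000 * δ ≤ T := by
    have : 0 ≤ ((CV.outputs.length : ℝ) + CG.outputs.length) * ((m + 10) * δ) := by positivity
    linarith
  obtain ⟨L, hL⟩ : ∃ L, L = blockLen m CV CG := ⟨_, rfl⟩
  have hb := fun k : ℕ => block_spec (A := 4 + k * L) (e₁ := k.testBit 1) (e₂ := k.testBit 0) hE hΓ hη
    hlen hT hCV hCG hval hgrad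
  choose τ hτ hW using hb
  obtain ⟨σ, hσ⟩ : ∃ σ : ℕ → ℝ, σ = fun k => E (4 + k * L + L - 1) +
    ∑ l ∈ Finset.Ico k 4, E (4 + l * L + L) := ⟨_, rfl⟩
  have hσ5 : ∀ k < 4, |σ k| ≤ 5 * δ := by
    intro k hk
    have h1 : |∑ l ∈ Finset.Ico k 4, E (4 + l * L + L)| ≤ ∑ l ∈ Finset.Ico k 4, δ :=
      (Finset.abs_sum_le_sum_abs _ _).trans (Finset.sum_le_sum fun _ _ => hE _)
    rw [Finset.sum_const, Nat.card_Ico, nsmul_eq_mul] at h1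
    have h2 : ((4 - k : ℕ) : ℝ) * δ ≤ 4 * δ :=
      mul_le_mul_of_nonneg_right (by exact_mod_cast (by omega : 4 - k ≤ 4)) hδ0
    rw [hσ]
    linarith [abs_add_le (E (4 + k * L + L - 1)) (∑ l ∈ Finset.Ico k 4, E (4 + l * L + L)),
      hE (4 + k * L + L - 1)]
  -- the block that is responsible for a grid point, and the index of the point within its class
  have hcls : ∀ i j : ℕ, 2 * (i % 2) + j % 2 < 4 ∧ (2 * (i % 2) + j % 2).testBit 1 = (i % 2 == 1) ∧
      (2 * (i % 2) + j % 2).testBit 0 = (j % 2 == 1) := by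
    intro i j
    rcases Nat.mod_two_eq_zero_or_one i with hi | hi <;>
      rcases Nat.mod_two_eq_zero_or_one j with hj | hj <;> rw [hi, hj] <;> decide
  have hpar : ∀ i : ℕ, 2 * (i / 2) + (i % 2 == 1).toNat = i := by
    intro i
    rcases Nat.mod_two_eq_zero_or_one i with hi | hi <;> rw [hi] <;> simp <;> omega
  have hhalf : ∀ i < 2 ^ (m + 1), i / 2 < 2 ^ m := by
    intro i hi
    rw [pow_succ] at hi
    omega
  refine ⟨fun i j d => τ (2 * (i % 2) + j % 2) (i / 2) (j / 2) d + σ (2 * (i % 2) + j % 2), ?_, ?_⟩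
  · intro i hi j hj d
    have h1 := hτ (2 * (i % 2) + j % 2) _ (hhalf i hi) _ (hhalf j hj) d
    linarith [abs_add_le (τ (2 * (i % 2) + j % 2) (i / 2) (j / 2) d) (σ (2 * (i % 2) + j % 2)),
      hσ5 _ (hcls i j).1]
  intro W hx₀ hx₁ hy₀ hy₁ hA
  obtain ⟨⟨a₂, a₃, a₄⟩, b₀, b₁, b₂, b₃⟩ := along_mesaGates.1 hA
  rw [gateHolds_truncGate] at a₂ a₃ a₄
  push_cast at a₂ a₃ a₄
  simp only [zero_mul, zero_add] at a₂ a₃ a₄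
  rw [← hL] at b₁ b₂ b₃
  have hEa := fun v => abs_le.1 (hE v)
  rw [clamp_of_mem (by linarith [hEa 2]) (by linarith [hEa 2])] at a₂
  rw [clamp_of_mem (by linarith [hEa 3]) (by linarith [hEa 3])] at a₃
  have hblocks : ∀ k < 4, Along (GateHolds W E) (4 + k * L + 1)
      (block m Γ CV CG (4 + k * L) (k.testBit 1) (k.testBit 0)) := by
    intro k hk
    interval_cases k
    · simpa using b₀
    · simpa [show Nat.testBit 1 1 = false by decide] using b₁
    · simpa [show Nat.testBit 2 1 = true by decide] using b₂
    · simpa [show Nat.testBit 3 1 = true by decide] using b₃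
  have hout : (mesaGates m Γ CV CG).length + 1 = 4 + 4 * L := by rw [length_mesaGates, hL]; ring
  rw [hout]
  obtain ⟨x, hx⟩ : ∃ x : Fin 2 → ℝ, x = fun k : Fin 2 => W k := ⟨_, rfl⟩
  have hM : ∀ k, ∃ M : ℝ, k < 4 → _ := fun k => by
    by_cases hk : k < 4
    · obtain ⟨M, h⟩ := hW k W a₂ a₃ hx₀ hx₁ hy₀ hy₁ (hblocks k hk)
      exact ⟨M, fun _ => h⟩
    · exact ⟨0, fun h => absurd h hk⟩
  choose M hM using hM
  rw [← hL, ← hx] at hM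
  rw [← hx]
  have hx0 : W 0 = x 0 := by rw [hx]; rfl
  have hx1 : W 1 = x 1 := by rw [hx]; rfl
  rw [hx0] at hx₀ hx₁
  rw [hx1] at hy₀ hy₁
  rw [hx0, hx1] at hM
  have hM1 : (1 : ℝ) ≤ 2 ^ m := one_le_pow₀ (by norm_num)
  have hN1 : (1 : ℝ) ≤ 2 ^ (m + 1) - 1 := by rw [pow_succ]; linarith
  have hdist : ∀ ξ : ℝ, 0 ≤ ξ → ξ ≤ 1 → ∀ i < 2 ^ (m + 1), |ξ - (i : ℕ) / (2 ^ (m + 1) - 1)| ≤ 1 := by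
    intro ξ h0 h1 i hi
    have h2 : (i : ℝ) + 1 ≤ 2 ^ (m + 1) := by exact_mod_cast hi
    have h3 : (i : ℝ) / (2 ^ (m + 1) - 1) ≤ 1 := by rw [div_le_one (by linarith)]; linarith
    have h4 : 0 ≤ (i : ℝ) / (2 ^ (m + 1) - 1) := by positivity
    rw [abs_le]
    constructor <;> linarith
  have hbd : ∀ k, ∀ i < 2 ^ (m + 1), ∀ j < 2 ^ (m + 1), _ := fun k i hi j hj =>
    gridMesa_bounds (x := x) hΓ (hval i hi j hj) (hgrad i hi j hj)
      (fun d => (hτ k _ (hhalf i hi) _ (hhalf j hj) d).trans (by linarith))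
      (hdist _ hx₀ hx₁ i hi) (hdist _ hy₀ hy₁ j hj)
  have hidx : ∀ (q : ℕ) (e : Bool), q < 2 ^ m → 2 * q + e.toNat < 2 ^ (m + 1) ∧
      (2 * q + e.toNat) / 2 = q ∧ (2 * q + e.toNat) % 2 = e.toNat := by
    intro q e hq
    have := Bool.toNat_le e
    rw [pow_succ]
    omega
  have hMle : ∀ k < 4, M k ≤ 7 / 10 := by
    intro k hk
    rcases (hM k hk).2.2.1 with h | ⟨q₁, hq₁, q₂, hq₂, h⟩
    · linarith
    · have := (hbd k _ (hidx q₁ (k.testBit 1) hq₁).1 _ (hidx q₂ (k.testBit 0) hq₂).1).1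
      rw [(hidx q₁ (k.testBit 1) hq₁).2.1, (hidx q₂ (k.testBit 0) hq₂).2.1] at this
      exact h.trans (max_le (by norm_num) (by linarith))
  obtain ⟨hlow, hup, hpos, -⟩ := iterated_max_spec (o := fun k => W (4 + k * L)) (M := M)
    (e := fun k => E (4 + k * L + L - 1)) (e' := fun k => E (4 + k * L + L)) (δ := δ) (n := 4)
    (by linarith) le_rfl
    (by
      simp only [zero_mul, add_zero]
      rw [a₄]
      exact max_le hδ0 ((min_le_right _ _).trans (hEa 4).2))
    (by simp only [zero_mul, add_zero]; exact a₄ ▸ clamp_nonneg _)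
    hMle (fun k => hE _) (fun k => hE _) (fun k hk => by
      have := (hM k hk).2.1
      rwa [show 4 + (k + 1) * L = 4 + k * L + L by ring])
  have hlow' : ∀ k < 4, M k + σ k ≤ W (4 + 4 * L) := fun k hk => by rw [hσ]; exact hlow k hk
  have hup' : W (4 + 4 * L) ≤ 5 * δ ∨ ∃ k < 4, W (4 + 4 * L) = M k + σ k := by
    rw [hσ]
    refine hup.imp_left fun h => h.trans ?_
    norm_num
  constructor
  · intro i hi j hj
    rw [gridMesa_add]
    obtain ⟨hk, h1, h0⟩ := hcls i j
    have hσk := abs_le.1 (hσ5 _ hk)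
    by_cases hfar : 3 / 4 * (1 / (2 ^ (m + 1) - 1)) < |x 0 - i / (2 ^ (m + 1) - 1)| ∨
        3 / 4 * (1 / (2 ^ (m + 1) - 1)) < |x 1 - j / (2 ^ (m + 1) - 1)|
    · have := (hbd (2 * (i % 2) + j % 2) i hi j hj).2.1 hfar
      have hpos' : 0 ≤ W (4 + 4 * L) := hpos
      linarith
    · rw [not_or, not_lt, not_lt] at hfar
      have hnear := (hM _ hk).2.2.2 (i / 2) (hhalf i hi) (j / 2) (hhalf j hj)
      rw [h1, h0, gridOffset_eq, gridOffset_eq, hpar, hpar] at hnear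
      refine le_trans (add_le_add_left ?_ _) (hlow' _ hk)
      rw [hnear hfar.1 hfar.2]
      exact le_max_right _ _
  · have hN2 : 2 ≤ 2 ^ (m + 1) := by rw [pow_succ]; have := Nat.one_le_two_pow (n := m); omega
    obtain ⟨i, hi, hi'⟩ := exists_near hN2 hx₀ hx₁
    obtain ⟨j, hj, hj'⟩ := exists_near hN2 hy₀ hy₁
    push_cast at hi' hj'
    have hij := (hbd (2 * (i % 2) + j % 2) i hi j hj).2.2 hi' hj'
    have hσij := abs_le.1 (hσ5 _ (hcls i j).1)
    -- a small output is below the mesa of the nearest grid point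
    rcases le_or_gt (W (4 + 4 * L)) (7 * δ) with hsmall | hlarge
    · refine ⟨i, hi, j, hj, ?_⟩
      rw [gridMesa_add]
      linarith
    rcases hup' with h | ⟨k, hk, h⟩
    · linarith
    have hσk := abs_le.1 (hσ5 k hk)
    rcases (hM k hk).2.2.1 with h' | ⟨q₁, hq₁, q₂, hq₂, h'⟩
    · linarith
    rcases le_max_iff.1 h' with h' | h'
    · linarith
    · obtain ⟨i₁, i₂, i₃⟩ := hidx q₁ (k.testBit 1) hq₁
      obtain ⟨j₁, j₂, j₃⟩ := hidx q₂ (k.testBit 0) hq₂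
      refine ⟨_, i₁, _, j₁, ?_⟩
      have hkk : 2 * (k.testBit 1).toNat + (k.testBit 0).toNat = k := by
        interval_cases k <;> decide
      rw [gridMesa_add, i₂, i₃, j₂, j₃, hkk, h]
      exact add_le_add_left h' _

/-! ### The size of the perturbations -/

theorem length_encodeWords (ws : List (List Bool)) :
    (encodeWords ws).length = (ws.map fun w => w.length + 1).sum := by
  simp [encodeWords, List.length_flatMap]

theorem length_le_length_encodeWords {ws : List (List Bool)} {w : List Bool} (h : w ∈ ws) :
    w.length ≤ (encodeWords ws).length := by
  rw [length_encodeWords]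
  exact (Nat.le_succ _).trans (List.le_sum_of_mem (List.mem_map_of_mem h))

theorem card_le_length_encodeWords (ws : List (List Bool)) :
    ws.length ≤ (encodeWords ws).length := by
  rw [length_encodeWords]
  induction ws with
  | nil => simp
  | cons w ws ih => simp; omega

theorem lt_two_pow_length_bits (k : ℕ) : k < 2 ^ k.bits.length := by
  rw [Nat.size_eq_bits_len]
  exact Nat.lt_size_self k

theorem length_listWords {α : Type} (f : α → List (List Bool)) (xs : List α) :
    xs.length + 1 ≤ (listWords f xs).length := by
  simp only [listWords, List.length_append, List.length_flatMap, List.length_cons, List.length_nil]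
  induction xs with
  | nil => simp
  | cons x xs ih => simp at ih ⊢; omega

namespace MesaInstance

variable (I : MesaInstance)

/-- A number that occurs in binary in the description is less than `2 ^ L`. -/
theorem lt_two_pow_descLen_of_bits_mem {k : ℕ}
    (h : k.bits ∈ ratWords I.tol ++ ratWords I.ℓ ++ ratWords I.Γ ++ I.valueCircuit.words ++
      I.gradCircuit.words) : k < 2 ^ I.descLen :=
  (lt_two_pow_length_bits k).trans_le
    (Nat.pow_le_pow_right (by norm_num) (length_le_length_encodeWords h))

theorem slope_le : I.Γ ≤ 2 ^ I.descLen := by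
  have h := I.lt_two_pow_descLen_of_bits_mem (k := I.Γ.num.natAbs) (by simp [ratWords])
  calc I.Γ ≤ |I.Γ| := le_abs_self _
    _ = (I.Γ.num.natAbs : ℚ) / I.Γ.den := by
      rw [Nat.cast_natAbs, Int.cast_abs, ← Nat.abs_cast I.Γ.den, ← abs_div, Rat.num_div_den]
    _ ≤ I.Γ.num.natAbs := div_le_self (by positivity) (by exact_mod_cast I.Γ.pos)
    _ ≤ 2 ^ I.descLen := by exact_mod_cast h.le

theorem one_div_le_tol (h : 0 < I.tol) : 1 / 2 ^ I.descLen ≤ I.tol := by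
  have hd := I.lt_two_pow_descLen_of_bits_mem (k := I.tol.den) (by simp [ratWords])
  have hn : (1 : ℚ) ≤ I.tol.num := by exact_mod_cast Rat.num_pos.2 h
  have hd' : (I.tol.den : ℚ) ≤ 2 ^ I.descLen := by exact_mod_cast hd.le
  have hp : (0 : ℚ) < I.tol.den := by exact_mod_cast I.tol.pos
  rw [← Rat.num_div_den I.tol, Rat.num_div_den]
  calc 1 / 2 ^ I.descLen ≤ 1 / (I.tol.den : ℚ) := one_div_le_one_div_of_le hp hd'
    _ ≤ I.tol.num / I.tol.den := div_le_div_of_nonneg_right hn hp.le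
    _ = I.tol := Rat.num_div_den _

theorem outputs_le : I.valueCircuit.outputs.length + I.gradCircuit.outputs.length + 1 ≤
    2 ^ I.descLen := by
  refine le_trans ?_ (I.descLen.lt_two_pow_self).le
  refine le_trans ?_ (card_le_length_encodeWords _)
  have h₁ := length_listWords (fun j => [unaryWord j]) I.valueCircuit.outputs
  have h₂ := length_listWords (fun j => [unaryWord j]) I.gradCircuit.outputs
  simp only [List.length_append, BoolCircuit.words]
  omega

end MesaInstance

/-! ### Robustness of the circuit -/

/-- With `K = 2 ^ L`, the slope, the number of outputs, `m + 10` and the reciprocal of the tolerance are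
at most `K`.  The errors are products of two of these and `δ`, hence of the order `K ^ 2 * δ`, which is
small in comparison with `1 / K`. -/
theorem robustlyImplements_circuit (I : MesaInstance) (hI : I.Valid) :
    RobustlyImplements I.circuit I.perturbationBound I := by
  obtain ⟨K, hK⟩ : ∃ K : ℝ, K = 2 ^ I.descLen := ⟨_, rfl⟩
  have hK1 : 1 ≤ K := hK ▸ one_le_pow₀ (by norm_num)
  have hΓK : (I.Γ : ℝ) ≤ K := by
    rw [hK]; exact_mod_cast (Rat.cast_le (K := ℝ)).2 I.slope_le
  have htol : 1 / K ≤ I.tol := by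
    have := (Rat.cast_le (K := ℝ)).2 (I.one_div_le_tol hI.tol_pos)
    push_cast at this
    rwa [hK]
  have hout : (I.valueCircuit.outputs.length : ℝ) + I.gradCircuit.outputs.length + 1 ≤ K := by
    rw [hK]; exact_mod_cast I.outputs_le
  obtain ⟨δ, hδ⟩ : ∃ δ : ℝ, δ = I.perturbationBound := ⟨_, rfl⟩
  have hδK : δ * K ^ 3 = 1 / 2 ^ 20 := by
    rw [hδ, MesaInstance.perturbationBound, hK, ← pow_mul]
    push_cast
    rw [pow_add, mul_comm I.descLen 3]
    field_simp
  have hδ0 : 0 ≤ δ := by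
    rw [hδ, MesaInstance.perturbationBound]
    positivity
  intro π hπ
  rw [← hδ] at hπ
  obtain ⟨tol, n, Γ, CV, CG⟩ := I
  obtain ⟨m, rfl⟩ : ∃ m, n = m + 1 := ⟨n - 1, (Nat.sub_add_cancel hI.n_pos).symm⟩
  have hΓ : 12 * ((2 : ℝ) ^ (m + 1) - 1) ≤ Γ := by
    have h := (Rat.cast_le (K := ℝ)).2 hI.slope
    simpa [MesaInstance.ℓ] using h
  have hm : ((m : ℝ) + 10) ≤ K := by
    have : m + 2 ≤ 2 ^ (m + 1) := Nat.succ_le_of_lt (Nat.lt_two_pow_self)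
    have : ((m : ℝ) + 2) ≤ 2 ^ (m + 1) := by exact_mod_cast this
    have h0 : (0 : ℝ) ≤ m := by positivity
    refine le_trans ?_ (hΓ.trans hΓK)
    linarith
  have hm0 : (0 : ℝ) ≤ m + 10 := by positivity
  have hprod : ∀ t : ℝ, t ≤ K → t * ((m + 10) * δ) ≤ 1 / K / 2 ^ 20 := by
    intro t ht
    have h1 : t * ((m + 10) * δ) ≤ K * (K * δ) :=
      mul_le_mul ht (mul_le_mul_of_nonneg_right hm hδ0) (by positivity) (by linarith)
    refine h1.trans (le_of_eq ?_)
    rw [div_div, eq_div_iff (by positivity)]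
    linear_combination (2 : ℝ) ^ 20 * hδK
  have hKi : 0 < 1 / K := by positivity
  have hKi1 : 1 / K ≤ 1 := by rw [div_le_one (by linarith)]; exact hK1
  obtain ⟨E, hE, hW⟩ := exists_values (mesaGates m Γ CV CG) (by simp [mesaGates])
    (isTruncatedLinear_mesaGates m Γ CV CG)
    (wellFormed_mesaGates hI.value_wellFormed hI.grad_wellFormed) δ hδ0 π hπ
  obtain ⟨τ, hτ, hspec⟩ := mesaGates_spec (T := 1 / K / 1000) hE hΓ
    ((hprod _ hΓK).trans (by linarith)) ((hprod _ hout).trans (by linarith)) (by linarith)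
    hI.value_wellFormed hI.grad_wellFormed
    (fun i hi j hj => hI.value_mem ![⟨i, hi⟩, ⟨j, hj⟩])
    (fun i hi j hj => hI.grad_mem ![⟨i, hi⟩, ⟨j, hj⟩])
  refine ⟨fun p => τ (p 0) (p 1), fun p d => ?_, fun x hx => ?_⟩
  · have h := abs_le.1 (hτ _ (p 0).2 _ (p 1).2 d)
    change (1 / K : ℝ) ≤ tol at htol
    exact ⟨by change -(tol : ℝ) ≤ _; linarith, by change _ ≤ (tol : ℝ); linarith⟩
  · obtain ⟨W, hW₀, hW₁, hA, hout⟩ := hW x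
    obtain ⟨hle, i, hi, j, hj, hge⟩ := hspec W (hW₀ ▸ (hx 0).1) (hW₀ ▸ (hx 0).2) (hW₁ ▸ (hx 1).1)
      (hW₁ ▸ (hx 1).2) hA
    have hxW : (fun k : Fin 2 => W k) = x := by
      funext k
      fin_cases k
      · exact hW₀
      · exact hW₁
    rw [hxW] at hle hge
    rw [← hout] at hle hge
    have hmesa : ∀ p : GridIndex (m + 1), mesa ((⟨tol, m + 1, Γ, CV, CG⟩ : MesaInstance).ℓ : ℝ) Γ x
        ((⟨tol, m + 1, Γ, CV, CG⟩ : MesaInstance).point p)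
        (fun d => ((⟨tol, m + 1, Γ, CV, CG⟩ : MesaInstance).value p : ℝ) + τ (p 0) (p 1) d)
        (fun k => ((⟨tol, m + 1, Γ, CV, CG⟩ : MesaInstance).grad p k : ℝ)) =
        gridMesa m Γ CV CG (τ (p 0) (p 1)) x (p 0) (p 1) := by
      intro p
      have hℓ : ((⟨tol, m + 1, Γ, CV, CG⟩ : MesaInstance).ℓ : ℝ) = 1 / (2 ^ (m + 1) - 1) := by
        simp [MesaInstance.ℓ]
      have hp : (⟨tol, m + 1, Γ, CV, CG⟩ : MesaInstance).point p =
          ![((p 0 : ℕ) : ℝ) / (2 ^ (m + 1) - 1), ((p 1 : ℕ) : ℝ) / (2 ^ (m + 1) - 1)] := by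
        funext k
        rw [MesaInstance.point, hℓ]
        fin_cases k <;> simp [div_eq_mul_inv]
      rw [hℓ, hp]
      rfl
    refine le_antisymm ?_ (Finset.sup'_le _ _ fun p _ => ?_)
    · refine le_trans ?_ (Finset.le_sup' _ (Finset.mem_univ (![⟨i, hi⟩, ⟨j, hj⟩] : GridIndex (m + 1))))
      exact hge.trans_eq (hmesa ![⟨i, hi⟩, ⟨j, hj⟩]).symm
    · exact (hmesa p).trans_le (hle _ (p 0).2 _ (p 1).2)

/-- The first part gives a circuit of truncated linear gates only, in which all gates are perturbed;
the second part gives a circuit that may use all types of gates, in which the minimum, maximum and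
truncation gates are perturbed. -/
theorem mainTheorem5 :
    (∃ F : {I : MesaInstance // I.Valid} → ℚ × LinearCircuit,
      PolyTimeConstruction F ∧
      ∀ I : {I : MesaInstance // I.Valid},
        0 < (F I).1 ∧ (F I).2.WellFormed 2 ∧ (F I).2.IsTruncatedLinear ∧
        RobustlyImplements (F I).2 (F I).1 I.1) ∧
    (∃ F : {I : MesaInstance // I.Valid} → ℚ × LinearCircuit,
      PolyTimeConstruction F ∧
      ∀ I : {I : MesaInstance // I.Valid},
        0 < (F I).1 ∧ (F I).2.WellFormed 2 ∧
        RobustlyImplements (F I).2 (F I).1 I.1) := by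
  have h : ∀ I : {I : MesaInstance // I.Valid}, 0 < I.1.perturbationBound ∧
      I.1.circuit.WellFormed 2 ∧ I.1.circuit.IsTruncatedLinear ∧
      RobustlyImplements I.1.circuit I.1.perturbationBound I.1 := by
    rintro ⟨I, hI⟩
    have hn : I.n - 1 + 1 = I.n := Nat.sub_add_cancel hI.n_pos
    refine ⟨by unfold MesaInstance.perturbationBound; positivity, wellFormed_of_along
      (wellFormed_mesaGates (hn.symm ▸ hI.value_wellFormed) (hn.symm ▸ hI.grad_wellFormed)),
      isTruncatedLinear_mesaGates _ _ _ _, robustlyImplements_circuit I hI⟩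
  exact ⟨⟨_, polyTimeConstruction_circuit, h⟩,
    ⟨_, polyTimeConstruction_circuit, fun I => ⟨(h I).1, (h I).2.1, (h I).2.2.2⟩⟩⟩
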